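/- Conventions. Let $M$ be a smooth (Hausdorff) oriented $n$-manifold with a Riemannian metric $g$ and Levi-Civita connection $\nabla$. For an endomorphism $A$ of $T_xM$ and a tensor $\xi$ of type $(p,q)$ ($p$ contravariant, $q$ covariant indices), put $A\diamond\xi=\frac{d}{ds}\big|_{s=0}(e^{sA})^*\xi$, where $(L^*\xi)(\theta_1,\dots;v_1,\dots)=\xi(\theta_1\circ L^{-1},\dots;Lv_1,\dots)$; the net degree of $\xi$ is $\ell=q-p$. Fix a tensor $\xi_0$ of type $(p,q)$ on $\mathbb R^n$ and let $H=\mathrm{Stab}(\xi_0)\subset \mathrm{SO}(n)$. An *$H$-structure* on $(M,g)$ is a smooth tensor field $\xi$ such that at each point some oriented $g$-orthonormal frame identifies $\xi$ with $\xi_0$. At each point let $\mathfrak h$ be the space of $g$-skew endomorphisms $A$ with $A\diamond\xi=0$, let $\mathfrak m$ be its orthogonal complement in the skew endomorphisms, and let $\pi_{\mathfrak m}$ be the orthogonal projection of endomorphisms onto $\mathfrak m$. The *torsion* of $\xi$ is the $\mathfrak m$-valued $1$-form $T$ determined by $\nabla_Y\xi=T(Y)\diamond\xi$; $\mathrm{Div}\,T=\sum_i(\nabla_{e_i}T)(e_i)$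 for an orthonormal frame $(e_i)$; $X\lrcorner T=T(X)$; and $\nabla_{\mathfrak m}X=\pi_{\mathfrak m}(\nabla X)$, where $\nabla X$ is the endomorphism $u\mapsto\nabla_uX$. The case $n=8$, $(p,q)=(0,4)$, $\xi_0=\Phi_0$ the Cayley form, $H=\mathrm{Spin}(7)$, $\ell=4$, is that of $\mathrm{Spin}(7)$-structures $\Phi$ with induced metric $g$; there $\mathfrak h=\Omega^2_{21}$, $\mathfrak m=\Omega^2_7$ and one writes $\nabla_7$ for $\nabla_{\mathfrak m}$. The *harmonic flow* is $\partial_t\xi_t=\mathrm{Div}\,T_t\diamond\xi_t$, for $H$-structures $\xi_t$ on $(M,g)$, where $T_t$ is the torsion of $\xi_t$. A smooth solution on an interval $I\ni \hat t$ is *self-similar*, normalised at time $\hat t$, if $\xi_t=\rho(t)^\ell f_t^*\xi$ for $t\in I$, with a positive function $\rho$ such that $\rho(\hat t)=1$, an $H$-structure $\xi$ and diffeomorphisms $f_t$ of $M$. **Theorem.** Let $(\hat\Phi,\hat X,c)$ be a harmonic $\mathrm{Spin}(7)$-soliton on $(M^8,g)$, that is, $\hat\Phi$ is a $\mathrm{Spin}(7)$-structure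 with induced metric $g$, $\hat X$ is a smooth vector field, and $$\mathcal L_{\hat X}g=c\,g,\qquad \mathrm{Div}\,\hat T=\hat X\lrcorner\hat T+\nabla_7\hat X,$$ with $c\in\{-1,0,1\}$. Suppose that $M$ is compact or, more generally, that $\hat X$ is complete. Let $\hat t\in\mathbb R$ and put $$\rho(t)=\sqrt{1-c(t-\hat t)},\qquad \alpha(t)=\frac{1}{1-c(t-\hat t)},\qquad \hat I=\{t\in\mathbb R: 1-c(t-\hat t)>0\}.$$ 1. $\hat I$ is an open interval that contains $\hat t$; it contains $\,]-\infty,\hat t\,]$ if $c\ge0$ and $[\,\hat t,\infty[\,$ if $c\le0$. On $\hat I$ the functions $\rho$ and $\alpha$ are smooth, $\rho>0$ and $c\,\alpha=-2(\log\rho)'$; moreover $\rho(\hat t)=\alpha(\hat t)=1$. For every $\delta>0$ there is a positive smooth function on all of $\mathbb R$ that agrees with $\rho$ on $\{t:1-c(t-\hat t)\ge\delta\}$. 2. There is a family of diffeomorphisms $f_t$ of $M$, $t\in\hat I$, smooth in $(t,x)\in\hat I\times M$, with $$\frac{d}{dt}f_t=\alpha(t)\,\hat X\circ f_t,\qquad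 f_{\hat t}=\mathrm{Id}_M,$$ and it is the only solution of this problem on $\hat I$. 3. $\Phi_t:=\rho(t)^4f_t^*\hat\Phi$, $t\in\hat I$, is a self-similar solution of the harmonic flow, normalised at time $\hat t$; in particular all $\Phi_t$ induce the metric $g$. 4. The vector fields $X_t:=\alpha(t)\hat X$ satisfy $\mathrm{Div}\,T_t=X_t\lrcorner T_t+\nabla_7X_t$ for all $t\in\hat I$, where $T_t$ is the torsion of $\Phi_t$. More generally, the same holds for $H=\mathrm{Stab}(\xi_0)\subset\mathrm{SO}(n)$ and a harmonic $H$-soliton $(\hat\xi,\hat X,c)$ on $(M^n,g)$, that is, an $H$-structure $\hat\xi$ and a smooth vector field $\hat X$ with $\mathcal L_{\hat X}g=cg$ and $\mathrm{Div}\,\hat T=\hat X\lrcorner\hat T+\nabla_{\mathfrak m}\hat X$, with $\xi_t:=\rho(t)^\ell f_t^*\hat\xi$ in place of $\Phi_t$ and $\nabla_{\mathfrak m}$ in place of $\nabla_7$. -/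

import Mathlib

open scoped Manifold ContDiff

noncomputable section

namespace HarmonicSoliton

/-- The model space `ℝⁿ` with its Euclidean inner product. -/
abbrev Model (n : ℕ) : Type := EuclideanSpace ℝ (Fin n)

/-- Tensors of type `(p, q)` on `ℝⁿ`: multilinear in `p` covectors and `q` vectors.  Their *net
degree* is `q - p`.

In Mathlib the tangent space of an `n`-manifold at `x` is by definition `ℝⁿ`, a tangent vector
being its coordinate vector in the preferred chart at `x`.  So `Tensor n p q` is also the space of
`(p, q)`-tensors at a point of an `n`-manifold. -/
abbrev Tensor (n p q : ℕ) : Type :=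
  ContinuousMultilinearMap ℝ (fun _ : Fin p => Model n →L[ℝ] ℝ)
    (ContinuousMultilinearMap ℝ (fun _ : Fin q => Model n) ℝ)

/-- Endomorphisms of a tangent space. -/
abbrev EndT (n : ℕ) : Type := Model n →L[ℝ] Model n

section LinearAlgebra

variable {n p q : ℕ}

/-- `θ ↦ θ ∘ A` on covectors. -/
def covectorComp (A : EndT n) : (Model n →L[ℝ] ℝ) →L[ℝ] (Model n →L[ℝ] ℝ) :=
  (ContinuousLinearMap.compL ℝ (Model n) (Model n) ℝ).flip A

/-- Pull-back of a tensor by a linear isomorphism `L`: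
`(L^* ξ)(θ₁, …; v₁, …) = ξ(θ₁ ∘ L⁻¹, …; L v₁, …)`. -/
def Tensor.pullback (L : EndT n) (ξ : Tensor n p q) : Tensor n p q :=
  (ContinuousMultilinearMap.compContinuousLinearMapL
      (fun _ : Fin q => L)).compContinuousMultilinearMap
    (ξ.compContinuousLinearMap fun _ : Fin p => covectorComp L.inverse)

/-- The infinitesimal action `A ⋄ ξ = d/dt|₀ (e^{tA})^* ξ`, i.e.
`(A ⋄ ξ)(θ; v) = ∑ₛ ξ(θ; …, A vₛ, …) - ∑ᵣ ξ(…, θᵣ ∘ A, …; v)`. -/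
def diamond (A : EndT n) (ξ : Tensor n p q) : Tensor n p q :=
  (∑ s : Fin q,
    (ContinuousMultilinearMap.compContinuousLinearMapL
      (Function.update (fun _ : Fin q => ContinuousLinearMap.id ℝ (Model n))
        s A)).compContinuousMultilinearMap ξ) -
  ∑ r : Fin p,
    ξ.compContinuousLinearMap
      (Function.update (fun _ : Fin p => ContinuousLinearMap.id ℝ (Model n →L[ℝ] ℝ))
        r (covectorComp A))

theorem Tensor.pullback_apply (L : EndT n) (ξ : Tensor n p q)
    (θ : Fin p → Model n →L[ℝ] ℝ) (v : Fin q → Model n) :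
    Tensor.pullback L ξ θ v = ξ (fun i => (θ i).comp L.inverse) (fun j => L (v j)) := rfl

theorem diamond_apply (A : EndT n) (ξ : Tensor n p q)
    (θ : Fin p → Model n →L[ℝ] ℝ) (v : Fin q → Model n) :
    diamond A ξ θ v =
      ∑ s : Fin q, ξ θ (Function.update v s (A (v s))) -
        ∑ r : Fin p, ξ (Function.update θ r ((θ r).comp A)) v := by
  have h1 : ∀ s : Fin q,
      (fun i => (Function.update (fun _ : Fin q => ContinuousLinearMap.id ℝ (Model n)) s A i)
        (v i)) = Function.update v s (A (v s)) := by
    intro s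
    funext i
    by_cases h : i = s
    · subst h; simp
    · simp [h]
  have h2 : ∀ r : Fin p,
      (fun i => (Function.update (fun _ : Fin p => ContinuousLinearMap.id ℝ (Model n →L[ℝ] ℝ))
        r (covectorComp A) i) (θ i)) = Function.update θ r ((θ r).comp A) := by
    intro r
    funext i
    by_cases h : i = r
    · subst h; simp [covectorComp]
    · simp [h]
  simp only [diamond, sub_apply, sum_apply,
    ContinuousLinearMap.compContinuousMultilinearMap_coe, Function.comp_apply,
    ContinuousMultilinearMap.compContinuousLinearMapL_apply,
    ContinuousMultilinearMap.compContinuousLinearMap_apply, h1, h2]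

/-- Endomorphisms that are skew-symmetric for the inner product `b`; lowering an index they are
the `2`-forms. -/
def IsSkew (b : Model n →L[ℝ] Model n →L[ℝ] ℝ) (A : EndT n) : Prop :=
  ∀ u v, b (A u) v = -b u (A v)

/-- The subspace `𝔥 ⊆ 𝔰𝔬(b)`: the Lie algebra of the stabiliser of `ξ` in the orthogonal group
of `b`. -/
def hSpace (b : Model n →L[ℝ] Model n →L[ℝ] ℝ) (ξ : Tensor n p q) : Set (EndT n) :=
  {B | IsSkew b B ∧ diamond B ξ = 0}

/-- The orthogonal complement `𝔪` of `𝔥` in `𝔰𝔬(b)`, for the inner product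
`⟨A, B⟩ = -tr (A B)`. -/
def mSpace (b : Model n →L[ℝ] Model n →L[ℝ] ℝ) (ξ : Tensor n p q) : Set (EndT n) :=
  {A | IsSkew b A ∧ ∀ B ∈ hSpace b ξ,
    LinearMap.trace ℝ (Model n) (A.comp B : EndT n).toLinearMap = 0}

/-- The orthogonal projection `π_𝔪` of endomorphisms onto `𝔪`: the unique `B ∈ 𝔪` such that
`A - B` is orthogonal to `𝔪`.  (The inner product `tr (Aᵗ C)` of an endomorphism `A` with a
skew-symmetric one `C` is `-tr (A C)`.) -/
def mProj (b : Model n →L[ℝ] Model n →L[ℝ] ℝ) (ξ : Tensor n p q) (A : EndT n) : EndT n :=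
  Classical.epsilon fun B : EndT n => B ∈ mSpace b ξ ∧ ∀ C ∈ mSpace b ξ,
    LinearMap.trace ℝ (Model n) ((A - B).comp C : EndT n).toLinearMap = 0

end LinearAlgebra

section Manifold

variable {n p q : ℕ} {M : Type*} [TopologicalSpace M] [ChartedSpace (Model n) M]

/-- The coordinate frame of the preferred chart at `x₀`, as a linear map from `ℝⁿ` to the tangent
space at the point `z` with coordinates `y`.  As tangent vectors at `z` are coordinate vectors in
the preferred chart at `z`, it is the derivative at `y` of the transition map between the two
charts, i.e. the differential of the inverse of the chart at `x₀`. -/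
def chartFrame (x₀ : M) (y : Model n) : EndT n :=
  fderiv ℝ (extChartAt 𝓘(ℝ, Model n) ((extChartAt 𝓘(ℝ, Model n) x₀).symm y) ∘
    (extChartAt 𝓘(ℝ, Model n) x₀).symm) y

/-- A tensor field in the coordinates of the preferred chart at `x₀`. -/
def tensorInChart (ξ : M → Tensor n p q) (x₀ : M) (y : Model n) : Tensor n p q :=
  Tensor.pullback (chartFrame x₀ y) (ξ ((extChartAt 𝓘(ℝ, Model n) x₀).symm y))

/-- A vector field in the coordinates of the preferred chart at `x₀`. -/
def vectorInChart (X : (x : M) → TangentSpace 𝓘(ℝ, Model n) x) (x₀ : M) (y : Model n) : Model n :=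
  (chartFrame x₀ y).inverse (X ((extChartAt 𝓘(ℝ, Model n) x₀).symm y))

/-- An endomorphism-valued `1`-form in the coordinates of the preferred chart at `x₀`:
`u ↦ L⁻¹ ∘ S(L u) ∘ L`, with `L` the coordinate frame. -/
def endFormInChart (S : M → Model n →L[ℝ] EndT n) (x₀ : M) (y : Model n) :
    Model n →L[ℝ] EndT n :=
  (((ContinuousLinearMap.compL ℝ (Model n) (Model n) (Model n) (chartFrame x₀ y).inverse).comp
    ((ContinuousLinearMap.compL ℝ (Model n) (Model n) (Model n)).flip (chartFrame x₀ y))).comp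
    (S ((extChartAt 𝓘(ℝ, Model n) x₀).symm y))).comp (chartFrame x₀ y)

/-- Smoothness of a tensor field: its components are smooth in every preferred chart. -/
def SmoothTensorField (ξ : M → Tensor n p q) : Prop :=
  ∀ x₀ : M, ContDiffOn ℝ ∞ (tensorInChart ξ x₀) (extChartAt 𝓘(ℝ, Model n) x₀).target

/-- Joint smoothness in time and space of a family of tensor fields, for times in `I`. -/
def SmoothTensorFamilyOn (I : Set ℝ) (ξ : ℝ → M → Tensor n p q) : Prop :=
  ∀ x₀ : M, ContDiffOn ℝ ∞ (fun z : ℝ × Model n => tensorInChart (ξ z.1) x₀ z.2)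
    (I ×ˢ (extChartAt 𝓘(ℝ, Model n) x₀).target)

/-- The pull-back `f^* ξ` of a tensor field by a diffeomorphism. -/
def pullbackField (f : M → M) (ξ : M → Tensor n p q) (x : M) : Tensor n p q :=
  Tensor.pullback (mfderiv 𝓘(ℝ, Model n) 𝓘(ℝ, Model n) f x : EndT n) (ξ (f x))

/-- Smooth vector fields. -/
def SmoothVectorField (X : (x : M) → TangentSpace 𝓘(ℝ, Model n) x)
    [IsManifold 𝓘(ℝ, Model n) ∞ M] : Prop :=
  ContMDiff 𝓘(ℝ, Model n) (𝓘(ℝ, Model n)).tangent ∞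
    (fun x => (⟨x, X x⟩ : TangentBundle 𝓘(ℝ, Model n) M))

/-- Complete vector fields: through every point there is an integral curve defined for all
times. -/
def IsCompleteVectorField (X : (x : M) → TangentSpace 𝓘(ℝ, Model n) x) : Prop :=
  ∀ x : M, ∃ γ : ℝ → M, γ 0 = x ∧ IsMIntegralCurve γ X

/-- An orientation of `M`, given by a continuous nowhere vanishing `n`-form. -/
structure ManifoldOrientation (n : ℕ) (M : Type*) [TopologicalSpace M]
    [ChartedSpace (Model n) M] where
  vol : M → (Model n) [⋀^Fin n]→L[ℝ] ℝ
  ne_zero : ∀ x, vol x ≠ 0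
  continuousOn : ∀ x₀ : M, ContinuousOn
    (fun y : Model n => (vol ((extChartAt 𝓘(ℝ, Model n) x₀).symm y)).compContinuousLinearMap
      (chartFrame x₀ y)) (extChartAt 𝓘(ℝ, Model n) x₀).target

variable [IsManifold 𝓘(ℝ, Model n) ∞ M]

/-- Smooth Riemannian metrics on `M`. -/
abbrev RiemMetric (n : ℕ) (M : Type*) [TopologicalSpace M] [ChartedSpace (Model n) M]
    [IsManifold 𝓘(ℝ, Model n) ∞ M] : Type _ :=
  Bundle.ContMDiffRiemannianMetric 𝓘(ℝ, Model n) ∞ (Model n)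
    (fun x : M => TangentSpace 𝓘(ℝ, Model n) x)

/-- The inner product on the tangent space at `x`. -/
def RiemMetric.at (g : RiemMetric n M) (x : M) : Model n →L[ℝ] Model n →L[ℝ] ℝ := g.inner x

/-- The metric in the coordinates of the preferred chart at `x₀`. -/
def metricInChart (g : RiemMetric n M) (x₀ : M) (y : Model n) : Model n →L[ℝ] Model n →L[ℝ] ℝ :=
  (g.at ((extChartAt 𝓘(ℝ, Model n) x₀).symm y)).bilinearComp (chartFrame x₀ y) (chartFrame x₀ y)

/-- The Christoffel symbols of the Levi-Civita connection in the preferred chart at `x₀`, as the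
endomorphism `Γ_u = Γ(u, ·)`; writing `G` for the metric in the chart,
`G(Γ_u v, w) = ½ (D_u G(v, w) + D_v G(u, w) - D_w G(u, v))`. -/
def christoffel (g : RiemMetric n M) (x₀ : M) (y u : Model n) : EndT n :=
  let D := fderiv ℝ (metricInChart g x₀) y
  (1 / 2 : ℝ) • (metricInChart g x₀ y).inverse.comp (D u + D.flip u - (D.flip u).flip)

/-- The Levi-Civita covariant derivative `∇_u ξ` of a tensor field at `x`, computed in the
preferred chart at `x`, where it is `D_u ξ - Γ_u ⋄ ξ`. -/
def covDeriv (g : RiemMetric n M) (ξ : M → Tensor n p q) (x : M) (u : Model n) : Tensor n p q :=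
  let y := extChartAt 𝓘(ℝ, Model n) x x
  fderiv ℝ (tensorInChart ξ x) y u - diamond (christoffel g x y u) (ξ x)

/-- The covariant derivative `u ↦ ∇_u X` of a vector field at `x`, as an endomorphism, computed in
the preferred chart at `x`, where it is `D_u X + Γ_u X = D_u X + Γ_X u`. -/
def nabla (g : RiemMetric n M) (X : (x : M) → TangentSpace 𝓘(ℝ, Model n) x) (x : M) : EndT n :=
  let y := extChartAt 𝓘(ℝ, Model n) x x
  fderiv ℝ (vectorInChart X x) y + christoffel g x y (X x)

/-- The covariant derivative `(∇_u S)(v)` of an endomorphism-valued `1`-form at `x`, computed in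
the preferred chart at `x`:
`D_u S(v) + Γ_u ∘ S(v) - S(v) ∘ Γ_u - S(Γ_u v)`. -/
def covDerivEndForm (g : RiemMetric n M) (S : M → Model n →L[ℝ] EndT n) (x : M) (u v : Model n) :
    EndT n :=
  let y := extChartAt 𝓘(ℝ, Model n) x x
  let Γ := christoffel g x y u
  fderiv ℝ (endFormInChart S x) y u v + Γ.comp (S x v) - (S x v).comp Γ - S x (Γ v)

/-- The divergence `Div S = ∑ᵢⱼ gⁱʲ (∇ᵢ S)ⱼ` of an endomorphism-valued `1`-form; the vector
`∑ⱼ gⁱʲ eⱼ` is the metric dual of the `i`-th coordinate covector. -/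
def divergence (g : RiemMetric n M) (S : M → Model n →L[ℝ] EndT n) (x : M) : EndT n :=
  ∑ i : Fin n, covDerivEndForm g S x (EuclideanSpace.single i 1)
    ((g.at x).inverse (EuclideanSpace.proj i))

/-- The Lie derivative of the metric, computed in the preferred chart at `x`:
`(L_X g)(u, v) = D_X g(u, v) + g(D_u X, v) + g(u, D_v X)`. -/
def lieDerivMetric (g : RiemMetric n M) (X : (x : M) → TangentSpace 𝓘(ℝ, Model n) x) (x : M)
    (u v : Model n) : ℝ :=
  let y := extChartAt 𝓘(ℝ, Model n) x x
  let DX := fderiv ℝ (vectorInChart X x) y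
  fderiv ℝ (metricInChart g x) y (X x) u v + g.at x (DX u) v + g.at x u (DX v)

/-- The torsion of `ξ`: the endomorphism-valued `1`-form `T` with values in `𝔪` determined by
`∇_u ξ = T(u) ⋄ ξ`. -/
def torsion (g : RiemMetric n M) (ξ : M → Tensor n p q) (x : M) : Model n →L[ℝ] EndT n :=
  Classical.epsilon fun T : Model n →L[ℝ] EndT n =>
    ∀ u, T u ∈ mSpace (g.at x) (ξ x) ∧ covDeriv g ξ x u = diamond (T u) (ξ x)

/-- `∇_𝔪 X = π_𝔪 (∇ X)`. -/
def nablaM (g : RiemMetric n M) (ξ : M → Tensor n p q) (X : (x : M) → TangentSpace 𝓘(ℝ, Model n) x)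
    (x : M) : EndT n :=
  mProj (g.at x) (ξ x) (nabla g X x)

/-- `ξ` is an `H`-structure on the oriented Riemannian manifold `(M, g)`, for `H` the stabiliser
in `SO(n)` of the model tensor `ξ₀`: it is smooth, and at every point some oriented orthonormal
frame identifies it with `ξ₀`. -/
structure IsHStructure (ξ₀ : Tensor n p q) (g : RiemMetric n M) (o : ManifoldOrientation n M)
    (ξ : M → Tensor n p q) : Prop where
  smooth : SmoothTensorField ξ
  frame : ∀ x : M, ∃ e : Model n ≃L[ℝ] Model n,
    (∀ u v, g.at x (e u) (e v) = inner ℝ u v) ∧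
    0 < o.vol x (fun i => e (EuclideanSpace.single i 1)) ∧
    Tensor.pullback (e : EndT n) (ξ x) = ξ₀

/-- The soliton equation `Div T = X ⌟ T + ∇_𝔪 X`. -/
def SolitonEquation (g : RiemMetric n M) (ξ : M → Tensor n p q)
    (X : (x : M) → TangentSpace 𝓘(ℝ, Model n) x) : Prop :=
  ∀ x : M, divergence g (torsion g ξ) x = torsion g ξ x (X x) + nablaM g ξ X x

/-- Harmonic `H`-solitons `(ξ, X, c)` on `(M, g)`. -/
structure IsHarmonicHSoliton (ξ₀ : Tensor n p q) (g : RiemMetric n M) (o : ManifoldOrientation n M)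
    (ξ : M → Tensor n p q) (X : (x : M) → TangentSpace 𝓘(ℝ, Model n) x) (c : ℝ) : Prop where
  isHStructure : IsHStructure ξ₀ g o ξ
  smooth : SmoothVectorField X
  lie : ∀ (x : M) (u v : Model n), lieDerivMetric g X x u v = c * g.at x u v
  equation : SolitonEquation g ξ X

/-- `(ξ_t)`, `t ∈ I`, is a smooth solution of the harmonic flow `∂_t ξ_t = Div T_t ⋄ ξ_t` of
`H`-structures on `(M, g)`. -/
structure IsHarmonicHFlow (ξ₀ : Tensor n p q) (g : RiemMetric n M) (o : ManifoldOrientation n M)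
    (I : Set ℝ) (ξ : ℝ → M → Tensor n p q) : Prop where
  isHStructure : ∀ t ∈ I, IsHStructure ξ₀ g o (ξ t)
  smooth : SmoothTensorFamilyOn I ξ
  equation : ∀ t ∈ I, ∀ x : M,
    HasDerivAt (fun s => ξ s x) (diamond (divergence g (torsion g (ξ t)) x) (ξ t x)) t

/-- Self-similar solutions of the harmonic flow, `ξ_t = ρ(t)^ℓ f_t^* ξ`, where `ℓ` is the net
degree; `t₀` is the instant at which the scaling `ρ` is normalised. -/
def IsSelfSimilarHSolution (ξ₀ : Tensor n p q) (g : RiemMetric n M) (o : ManifoldOrientation n M)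
    (I : Set ℝ) (t₀ : ℝ) (ξ : ℝ → M → Tensor n p q) : Prop :=
  IsHarmonicHFlow ξ₀ g o I ξ ∧ t₀ ∈ I ∧
    ∃ (ρ : ℝ → ℝ) (η : M → Tensor n p q)
      (f : ℝ → (M ≃ₘ^∞⟮𝓘(ℝ, Model n), 𝓘(ℝ, Model n)⟯ M)),
      ρ t₀ = 1 ∧ (∀ t ∈ I, 0 < ρ t) ∧ IsHStructure ξ₀ g o η ∧
      ∀ t ∈ I, ξ t = fun x => ρ t ^ ((q : ℤ) - (p : ℤ)) • pullbackField (f t) η x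

/-- `f` solves `d/dt f_t = α(t) X ∘ f_t` for `t ∈ I`, with `f_{t₀} = id`. -/
def IsFlowOfScaledField (X : (x : M) → TangentSpace 𝓘(ℝ, Model n) x) (α : ℝ → ℝ) (I : Set ℝ)
    (t₀ : ℝ) (f : ℝ → M → M) : Prop :=
  (∀ x, f t₀ x = x) ∧ ∀ t ∈ I, ∀ x : M,
    HasMFDerivAt 𝓘(ℝ, ℝ) 𝓘(ℝ, Model n) (fun s => f s x) t
      ((1 : ℝ →L[ℝ] ℝ).smulRight (α t • X (f t x)))

end Manifold

section Spin7

/-- The tensor `εⁱ ⊗ εʲ ⊗ εᵏ ⊗ εˡ` on `ℝ⁸`, with `ε` the dual of the standard basis. -/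
def coordTensor (i : Fin 4 → Fin 8) : ContinuousMultilinearMap ℝ (fun _ : Fin 4 => Model 8) ℝ :=
  (ContinuousMultilinearMap.mkPiAlgebra ℝ (Fin 4) ℝ).compContinuousLinearMap
    (fun s => (EuclideanSpace.proj (i s) : Model 8 →L[ℝ] ℝ))

/-- The `4`-form `εⁱ ∧ εʲ ∧ εᵏ ∧ εˡ` on `ℝ⁸`. -/
def coordForm (i j k l : Fin 8) : ContinuousMultilinearMap ℝ (fun _ : Fin 4 => Model 8) ℝ :=
  ∑ σ : Equiv.Perm (Fin 4), ((Equiv.Perm.sign σ : ℤ) : ℝ) • coordTensor (![i, j, k, l] ∘ σ)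

/-- The Cayley `4`-form `Φ₀` on `ℝ⁸`, whose stabiliser is `Spin(7) ⊆ SO(8)`.  The sign convention
is the one for which `Φ₀` is self-dual and `(Φ₀)ᵢⱼₖₗ(Φ₀)ₐᵦₖₗ = 6 δᵢₐδⱼᵦ - 6 δᵢᵦδⱼₐ - 4 (Φ₀)ᵢⱼₐᵦ`. -/
def cayleyForm : Tensor 8 0 4 :=
  ContinuousMultilinearMap.constOfIsEmpty ℝ _
    (coordForm 0 1 2 3 + coordForm 0 1 4 5 - coordForm 0 1 6 7 + coordForm 0 2 4 6
      + coordForm 0 2 5 7 + coordForm 0 3 4 7 - coordForm 0 3 5 6 - coordForm 1 2 4 7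
      + coordForm 1 2 5 6 + coordForm 1 3 4 6 + coordForm 1 3 5 7 - coordForm 2 3 4 5
      + coordForm 2 3 6 7 + coordForm 4 5 6 7)

variable {M : Type*} [TopologicalSpace M] [ChartedSpace (Model 8) M]
  [IsManifold 𝓘(ℝ, Model 8) ∞ M]

/-- `Φ` is a `Spin(7)`-structure on `M` whose induced metric and orientation are `g` and `o`.
(Being the Cayley form in suitable frames, `Φ` is a `4`-form.) -/
abbrev IsSpin7Structure (g : RiemMetric 8 M) (o : ManifoldOrientation 8 M) (Φ : M → Tensor 8 0 4) :
    Prop :=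
  IsHStructure cayleyForm g o Φ

/-- `∇₇ X = π₇ (∇ X)`, where `Ω²₇` is the orthogonal complement in `Ω²` of
`Ω²₂₁ = 𝔰𝔭𝔦𝔫(7) = ker (⋄ Φ)`. -/
abbrev nabla7 (g : RiemMetric 8 M) (Φ : M → Tensor 8 0 4)
    (X : (x : M) → TangentSpace 𝓘(ℝ, Model 8) x) (x : M) : EndT 8 :=
  nablaM g Φ X x

/-- The soliton equation `Div T = X ⌟ T + ∇₇ X`. -/
def Spin7SolitonEquation (g : RiemMetric 8 M) (Φ : M → Tensor 8 0 4)
    (X : (x : M) → TangentSpace 𝓘(ℝ, Model 8) x) : Prop :=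
  ∀ x : M, divergence g (torsion g Φ) x = torsion g Φ x (X x) + nabla7 g Φ X x

/-- Harmonic `Spin(7)`-solitons `(Φ, X, c)`: `Φ` is a `Spin(7)`-structure with induced metric `g`,
`L_X g = c g` and `Div T = X ⌟ T + ∇₇ X`. -/
structure IsHarmonicSpin7Soliton (g : RiemMetric 8 M) (o : ManifoldOrientation 8 M)
    (Φ : M → Tensor 8 0 4) (X : (x : M) → TangentSpace 𝓘(ℝ, Model 8) x) (c : ℝ) : Prop where
  isSpin7Structure : IsSpin7Structure g o Φ
  smooth : SmoothVectorField X
  lie : ∀ (x : M) (u v : Model 8), lieDerivMetric g X x u v = c * g.at x u v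
  equation : Spin7SolitonEquation g Φ X

/-- Smooth solutions of the harmonic `Spin(7)`-flow `∂_t Φ_t = Div T_t ⋄ Φ_t`, for times in `I`.
The flow is isometric: all `Φ_t` induce the metric `g`. -/
structure IsHarmonicSpin7Flow (g : RiemMetric 8 M) (o : ManifoldOrientation 8 M) (I : Set ℝ)
    (Φ : ℝ → M → Tensor 8 0 4) : Prop where
  isSpin7Structure : ∀ t ∈ I, IsSpin7Structure g o (Φ t)
  smooth : SmoothTensorFamilyOn I Φ
  equation : ∀ t ∈ I, ∀ x : M,
    HasDerivAt (fun s => Φ s x) (diamond (divergence g (torsion g (Φ t)) x) (Φ t x)) t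

/-- Self-similar solutions `Φ_t = ρ(t)⁴ f_t^* Φ` of the harmonic `Spin(7)`-flow; `t₀` is the
instant at which the scaling `ρ` is normalised. -/
def IsSelfSimilarSpin7Solution (g : RiemMetric 8 M) (o : ManifoldOrientation 8 M)
    (I : Set ℝ) (t₀ : ℝ) (Φ : ℝ → M → Tensor 8 0 4) : Prop :=
  IsHarmonicSpin7Flow g o I Φ ∧ t₀ ∈ I ∧
    ∃ (ρ : ℝ → ℝ) (Ψ : M → Tensor 8 0 4)
      (f : ℝ → (M ≃ₘ^∞⟮𝓘(ℝ, Model 8), 𝓘(ℝ, Model 8)⟯ M)),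
      ρ t₀ = 1 ∧ (∀ t ∈ I, 0 < ρ t) ∧ IsSpin7Structure g o Ψ ∧
      ∀ t ∈ I, Φ t = fun x => ρ t ^ 4 • pullbackField (f t) Ψ x

end Spin7

/-- The scaling `ρ(t) = √(1 - c (t - t₀))`. -/
def solitonScale (c t₀ t : ℝ) : ℝ := √(1 - c * (t - t₀))

/-- The rate `α(t) = 1 / (1 - c (t - t₀))`. -/
def solitonRate (c t₀ t : ℝ) : ℝ := 1 / (1 - c * (t - t₀))

/-- The interval of existence `{t | 1 - c (t - t₀) > 0}`. -/
def solitonInterval (c t₀ : ℝ) : Set ℝ := {t | 0 < 1 - c * (t - t₀)}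

end HarmonicSoliton

end

open HarmonicSoliton

universe u

/-! Let `φ` be the flow of `X`, and write `⋄` for `diamond`. Since `L_X g = c g`, `φ_s^* g = e^{cs}
g`. Let `τ` be the primitive of `α` with `τ(t₀) = 0`. Then `f_t = φ_{τ(t)}` solves `d/dt f_t = α(t)
X ∘ f_t`, and `e^{cτ} = α = ρ⁻²`, so `f_t^* g = α g`. Hence `ρ⁻¹ (df_t)⁻¹` carries orthonormal
frames to orthonormal frames, and `ξ_t = ρ^ℓ f_t^* ξ` is again an `H`-structure for the same metric.
The orientation is preserved because `f_t` is joined to the identity through the flow.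

A homothety preserves the Levi-Civita connection, and neither `𝔥` nor `𝔪` changes when the metric or
the tensor is multiplied by a nonzero constant. So the torsion of `ξ_t` is `f_t^* T`, and `∇_𝔪 X` is
natural because the flow fixes `X`. The divergence also contracts with the inverse metric, which
contributes one factor: `Div T_t = α f_t^* (Div T)`. This gives the soliton equation for `X_t = α
X`.

For the evolution, `L_X ξ = ∇_X ξ + ∇X ⋄ ξ`, with `∇_X ξ = T(X) ⋄ ξ`. The symmetric part of `∇X` is
`(c/2) id`, the identity acts on `ξ` as multiplication by `ℓ`, and `𝔥` acts by zero; so `∇X ⋄ ξ =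
∇_𝔪 X ⋄ ξ + (cℓ/2) ξ` (`diamond_mProj`). By the soliton equation `L_X ξ = Div T ⋄ ξ + (cℓ/2) ξ`, and
after transport by `f_t` the last term cancels against the derivative of `ρ^ℓ`, because `ρ'/ρ =
-(c/2) α`.

Three facts behind this need real work. The torsion exists: in coordinates `(g, ξ)` stays in one
orbit of the general linear group, and compactness of the set of orthonormal frames shows that its
derivative is tangent to the orbit (`exists_fderiv_eq_diamond`). The torsion is differentiable, so
that its divergence makes sense: it solves a linear system of constant rank
(`differentiableAt_of_constant_rank`). The flow is jointly smooth: the inverse function theorem in a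
space of continuous curves gives this near time zero (`exists_smooth_rescaled_curves`), and the
group law spreads it to all times (`exists_isGlobalFlow`). -/

noncomputable section

open scoped Manifold ContDiff

namespace HarmonicSoliton

/-! ### The scaling, the rate and the change of time -/

section Scale

variable {c t₀ t : ℝ}

theorem mem_solitonInterval : t ∈ solitonInterval c t₀ ↔ 0 < 1 - c * (t - t₀) := Iff.rfl

theorem self_mem_solitonInterval (c t₀ : ℝ) : t₀ ∈ solitonInterval c t₀ := by
  simp [mem_solitonInterval]

theorem contDiff_solitonAffine (c t₀ : ℝ) : ContDiff ℝ ∞ fun t : ℝ => 1 - c * (t - t₀) := by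
  fun_prop

theorem isOpen_solitonInterval (c t₀ : ℝ) : IsOpen (solitonInterval c t₀) :=
  isOpen_lt continuous_const (contDiff_solitonAffine c t₀).continuous

theorem ordConnected_solitonInterval (c t₀ : ℝ) : (solitonInterval c t₀).OrdConnected := by
  refine ⟨fun a ha b hb t ht => ?_⟩
  rw [mem_solitonInterval] at *
  rcases le_total 0 c with h | h
  · nlinarith [mul_le_mul_of_nonneg_left ht.2 h]
  · nlinarith [mul_le_mul_of_nonpos_left ht.1 h]

theorem solitonScale_pos (ht : t ∈ solitonInterval c t₀) : 0 < solitonScale c t₀ t :=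
  Real.sqrt_pos.2 ht

theorem solitonScale_self (c t₀ : ℝ) : solitonScale c t₀ t₀ = 1 := by simp [solitonScale]

theorem solitonRate_self (c t₀ : ℝ) : solitonRate c t₀ t₀ = 1 := by simp [solitonRate]

theorem solitonScale_sq_mul_solitonRate (ht : t ∈ solitonInterval c t₀) :
    solitonScale c t₀ t ^ 2 * solitonRate c t₀ t = 1 := by
  rw [solitonScale, solitonRate, Real.sq_sqrt (mem_solitonInterval.1 ht).le]
  exact mul_one_div_cancel (mem_solitonInterval.1 ht).ne'

theorem contDiffOn_solitonScale (c t₀ : ℝ) :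
    ContDiffOn ℝ ∞ (solitonScale c t₀) (solitonInterval c t₀) := fun _ ht =>
  ((contDiff_solitonAffine c t₀).contDiffAt.sqrt
    (mem_solitonInterval.1 ht).ne').contDiffWithinAt

theorem contDiffOn_solitonRate (c t₀ : ℝ) :
    ContDiffOn ℝ ∞ (solitonRate c t₀) (solitonInterval c t₀) := fun _ ht =>
  (contDiffAt_const.div (contDiff_solitonAffine c t₀).contDiffAt
    (mem_solitonInterval.1 ht).ne').contDiffWithinAt

theorem hasDerivAt_solitonAffine (c t₀ t : ℝ) :
    HasDerivAt (fun t : ℝ => 1 - c * (t - t₀)) (-c) t := by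
  simpa using (((hasDerivAt_id t).sub_const t₀).const_mul c).const_sub 1

theorem hasDerivAt_solitonScale (ht : t ∈ solitonInterval c t₀) :
    HasDerivAt (solitonScale c t₀) (-(c / 2) * solitonRate c t₀ t * solitonScale c t₀ t) t := by
  have h := (hasDerivAt_solitonAffine c t₀ t).sqrt (mem_solitonInterval.1 ht).ne'
  refine h.congr_deriv ?_
  have h1 := solitonScale_sq_mul_solitonRate ht
  have h2 := (solitonScale_pos ht).ne'
  change -c / (2 * solitonScale c t₀ t) = _
  field_simp
  linear_combination c * h1

theorem solitonRate_eq_logDeriv (ht : t ∈ solitonInterval c t₀) :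
    c * solitonRate c t₀ t = -2 * deriv (fun s => Real.log (solitonScale c t₀ s)) t := by
  rw [((hasDerivAt_solitonScale ht).log (solitonScale_pos ht).ne').deriv]
  have h2 := (solitonScale_pos ht).ne'
  field_simp

/-- The argument `s` of the square root is replaced by the convex combination `χ(s) s + (1 - χ(s))`
of `s` and `1`. The cut-off `χ` vanishes for `s ≤ δ/2` and is `1` for `s ≥ δ`, so the combination is
positive everywhere and equals `s` where it has to. -/
theorem exists_pos_smooth_extension_solitonScale (c t₀ : ℝ) {δ : ℝ} (hδ : 0 < δ) :
    ∃ r : ℝ → ℝ, ContDiff ℝ ∞ r ∧ (∀ t, 0 < r t) ∧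
      ∀ t, δ ≤ 1 - c * (t - t₀) → r t = solitonScale c t₀ t := by
  set χ : ℝ → ℝ := fun s => Real.smoothTransition ((s - δ / 2) / (δ / 2)) with hχ
  set h : ℝ → ℝ := fun s => χ s * s + (1 - χ s) with hh
  have hχs : ContDiff ℝ ∞ χ := Real.smoothTransition.contDiff.comp (by fun_prop)
  have hpos : ∀ s, 0 < h s := by
    intro s
    rcases le_or_gt s (δ / 2) with hs | hs
    · have : χ s = 0 := Real.smoothTransition.zero_of_nonpos
        (div_nonpos_of_nonpos_of_nonneg (by linarith) (by linarith))
      simp [hh, this]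
    · have h0 : 0 ≤ χ s := Real.smoothTransition.nonneg _
      have h1 : χ s ≤ 1 := Real.smoothTransition.le_one _
      have hs0 : 0 < s := by linarith
      simp only [hh]
      rcases h0.eq_or_lt with h | h
      · rw [← h]; norm_num
      · nlinarith [mul_pos h hs0]
  have hsm : ContDiff ℝ ∞ h := (hχs.mul contDiff_id).add (contDiff_const.sub hχs)
  refine ⟨fun t => √(h (1 - c * (t - t₀))),
    (hsm.comp (contDiff_solitonAffine c t₀)).sqrt fun t => (hpos _).ne',
    fun t => Real.sqrt_pos.2 (hpos _), fun t ht => ?_⟩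
  have : χ (1 - c * (t - t₀)) = 1 := Real.smoothTransition.one_of_one_le (by
    rw [le_div_iff₀ (by linarith)]; linarith)
  simp [hh, this, solitonScale]

/-- The new time `τ` with `τ' = α` and `τ(t₀) = 0`. -/
def solitonTime (c t₀ t : ℝ) : ℝ :=
  if c = 0 then t - t₀ else -(Real.log (1 - c * (t - t₀)) / c)

/-- The inverse of `solitonTime`. -/
def solitonTimeInv (c t₀ s : ℝ) : ℝ :=
  if c = 0 then t₀ + s else t₀ + (1 - Real.exp (-(c * s))) / c

theorem solitonTime_self (c t₀ : ℝ) : solitonTime c t₀ t₀ = 0 := by simp [solitonTime]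

theorem hasDerivAt_solitonTime (ht : t ∈ solitonInterval c t₀) :
    HasDerivAt (solitonTime c t₀) (solitonRate c t₀ t) t := by
  by_cases hc : c = 0
  · subst hc
    have h2 : solitonTime 0 t₀ = fun t => id t - t₀ := by funext t; simp [solitonTime]
    rw [h2, show solitonRate 0 t₀ t = 1 by simp [solitonRate]]
    exact (hasDerivAt_id t).sub_const t₀
  · have h := (((hasDerivAt_solitonAffine c t₀ t).log
      (mem_solitonInterval.1 ht).ne').div_const c).neg
    have h2 : solitonTime c t₀ = fun t => -(Real.log (1 - c * (t - t₀)) / c) := by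
      funext t; simp [solitonTime, hc]
    rw [h2]
    refine h.congr_deriv ?_
    have := (mem_solitonInterval.1 ht).ne'
    rw [solitonRate]
    field_simp

theorem contDiffOn_solitonTime (c t₀ : ℝ) :
    ContDiffOn ℝ ∞ (solitonTime c t₀) (solitonInterval c t₀) := by
  rw [contDiffOn_infty_iff_deriv_of_isOpen (isOpen_solitonInterval c t₀)]
  refine ⟨fun t ht => (hasDerivAt_solitonTime ht).differentiableAt.differentiableWithinAt,
    (contDiffOn_solitonRate c t₀).congr fun t ht => (hasDerivAt_solitonTime ht).deriv⟩

/-- Turns the homothety factor `e^{cs}` of the flow at `s = τ(t)` into `α(t)`. -/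
theorem exp_solitonTime (ht : t ∈ solitonInterval c t₀) :
    Real.exp (c * solitonTime c t₀ t) = solitonRate c t₀ t := by
  by_cases hc : c = 0
  · subst hc; simp [solitonRate]
  · rw [solitonTime, if_neg hc, solitonRate]
    rw [show c * -(Real.log (1 - c * (t - t₀)) / c) = -Real.log (1 - c * (t - t₀)) by field_simp,
      Real.exp_neg, Real.exp_log (mem_solitonInterval.1 ht), one_div]

theorem one_sub_mul_solitonTimeInv (c t₀ s : ℝ) :
    1 - c * (solitonTimeInv c t₀ s - t₀) = Real.exp (-(c * s)) := by
  by_cases hc : c = 0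
  · subst hc; simp
  · rw [solitonTimeInv, if_neg hc]; field_simp; ring

/-- The inverse time change is defined on all of `ℝ`, so a solution of the rescaled equation on the
interval becomes an integral curve of `X` for all times. This is what uniqueness uses. -/
theorem solitonTimeInv_mem (c t₀ s : ℝ) : solitonTimeInv c t₀ s ∈ solitonInterval c t₀ := by
  rw [mem_solitonInterval, one_sub_mul_solitonTimeInv]
  exact Real.exp_pos _

theorem solitonTimeInv_solitonTime (ht : t ∈ solitonInterval c t₀) :
    solitonTimeInv c t₀ (solitonTime c t₀ t) = t := by
  by_cases hc : c = 0
  · simp [solitonTimeInv, solitonTime, hc]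
  · have h := one_sub_mul_solitonTimeInv c t₀ (solitonTime c t₀ t)
    rw [Real.exp_neg, exp_solitonTime ht, solitonRate, one_div, inv_inv] at h
    have h' : c * (solitonTimeInv c t₀ (solitonTime c t₀ t) - t) = 0 := by linarith
    exact sub_eq_zero.1 ((mul_eq_zero.1 h').resolve_left hc)

theorem solitonTimeInv_zero (c t₀ : ℝ) : solitonTimeInv c t₀ 0 = t₀ := by
  simp [solitonTimeInv]

theorem hasDerivAt_solitonTimeInv (c t₀ s : ℝ) :
    HasDerivAt (solitonTimeInv c t₀) (Real.exp (-(c * s))) s := by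
  by_cases hc : c = 0
  · subst hc
    have h2 : solitonTimeInv 0 t₀ = fun s => t₀ + id s := by funext s; simp [solitonTimeInv]
    rw [h2, show Real.exp (-(0 * s)) = 1 by simp]
    exact (hasDerivAt_id s).const_add t₀
  · have h := ((((((hasDerivAt_id s).const_mul c).neg).exp).const_sub 1).div_const c).const_add t₀
    have h2 : solitonTimeInv c t₀ = fun s => t₀ + (1 - Real.exp (-(c * s))) / c := by
      funext t; simp [solitonTimeInv, hc]
    rw [h2]
    refine h.congr_deriv ?_
    field_simp
    simp

end Scale

end HarmonicSoliton

end

noncomputable section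

open scoped Manifold ContDiff

namespace HarmonicSoliton

/-! ### Smoothness of composition operators on spaces of continuous curves -/

section SuperpositionOperator

variable {K : Type*} [TopologicalSpace K] [CompactSpace K]

/-- Pointwise evaluation of a continuous family of linear maps along a continuous map. -/
def pointwiseApplyL (K : Type*) [TopologicalSpace K] [CompactSpace K] (E F : Type*)
    [NormedAddCommGroup E] [NormedSpace ℝ E] [NormedAddCommGroup F] [NormedSpace ℝ F] :
    C(K, E →L[ℝ] F) →L[ℝ] C(K, E) →L[ℝ] C(K, F) :=
  LinearMap.mkContinuous₂
    (LinearMap.mk₂ ℝ (fun (A : C(K, E →L[ℝ] F)) (h : C(K, E)) =>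
        (⟨fun k => A k (h k), A.continuous.clm_apply h.continuous⟩ : C(K, F)))
      (fun _ _ _ => by ext; simp) (fun _ _ _ => by ext; simp)
      (fun _ _ _ => by ext; simp) (fun _ _ _ => by ext; simp)) 1 (by
    intro A h
    rw [ContinuousMap.norm_le _ (by positivity)]
    intro k
    calc ‖A k (h k)‖ ≤ ‖A k‖ * ‖h k‖ := (A k).le_opNorm _
      _ ≤ 1 * ‖A‖ * ‖h‖ := by
        rw [one_mul]
        exact mul_le_mul (A.norm_coe_le_norm k) (h.norm_coe_le_norm k) (norm_nonneg _)
          (norm_nonneg A))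

variable {E F : Type*} [NormedAddCommGroup E] [NormedSpace ℝ E]
  [NormedAddCommGroup F] [NormedSpace ℝ F]

/-- The superposition operator `γ ↦ v ∘ γ` is differentiable, with derivative
`h ↦ (Dv ∘ γ) h`. -/
theorem hasFDerivAt_postcomp (v : C(E, F)) (v' : C(E, E →L[ℝ] F))
    (hv : ∀ x, HasFDerivAt v (v' x) x) (γ : C(K, E)) :
    HasFDerivAt (fun γ : C(K, E) => v.comp γ) (pointwiseApplyL K E F (v'.comp γ)) γ := by
  rw [hasFDerivAt_iff_isLittleO_nhds_zero, Asymptotics.isLittleO_iff]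
  intro ε hε
  have hc : Continuous fun γ : C(K, E) => v'.comp γ := ContinuousMap.continuous_postcomp v'
  obtain ⟨δ, hδ, H⟩ := (Metric.continuousAt_iff (α := C(K, E)) (β := C(K, E →L[ℝ] F))).1
    (hc.continuousAt (x := γ)) ε hε
  filter_upwards [Metric.ball_mem_nhds (0 : C(K, E)) hδ] with h hh
  rw [mem_ball_zero_iff] at hh
  rw [ContinuousMap.norm_le _ (by positivity)]
  intro k
  -- The points of the segment are values at `k` of the curves `γ + s h`, all within `δ` of `γ` in
  -- the supremum norm. So the oscillation of `v'` is at most `ε` uniformly in `k`, and the mean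
  -- value inequality applies at each `k`.
  have hseg : ∀ z ∈ segment ℝ (γ k) (γ k + h k), ‖v' z - v' (γ k)‖ ≤ ε := by
    intro z hz
    rw [segment_eq_image'] at hz
    obtain ⟨s, hs, rfl⟩ := hz
    have hd : dist (γ + s • h) γ < δ := by
      rw [dist_eq_norm, add_sub_cancel_left, norm_smul, Real.norm_of_nonneg hs.1]
      exact lt_of_le_of_lt (mul_le_of_le_one_left (norm_nonneg _) hs.2) hh
    have := (ContinuousMap.dist_apply_le_dist (f := v'.comp (γ + s • h)) (g := v'.comp γ) k).trans
      (H hd).le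
    simpa [dist_eq_norm] using this
  have := (convex_segment (γ k) (γ k + h k)).norm_image_sub_le_of_norm_hasFDerivWithin_le'
    (f := v) (f' := v') (φ := v' (γ k)) (C := ε)
    (fun x _ => (hv x).hasFDerivWithinAt) hseg (left_mem_segment ℝ _ _) (right_mem_segment ℝ _ _)
  rw [add_sub_cancel_left] at this
  refine le_trans ?_ (this.trans (mul_le_mul_of_nonneg_left (h.norm_coe_le_norm k) hε.le))
  rfl

end SuperpositionOperator

section SuperpositionSmooth

universe w

variable {K : Type*} [TopologicalSpace K] [CompactSpace K]

/-- The derivative is a continuous linear map composed with the superposition operator of `Dv`, so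
one order is gained at each step. The statement quantifies over `E` and `F` in one universe so that
the induction hypothesis applies to the target `E →L[ℝ] F`. -/
theorem contDiff_nat_postcomp (m : ℕ) : ∀ {E F : Type w} [NormedAddCommGroup E] [NormedSpace ℝ E]
    [NormedAddCommGroup F] [NormedSpace ℝ F] (v : C(E, F)), ContDiff ℝ ∞ v →
    ContDiff ℝ m (fun γ : C(K, E) => v.comp γ) := by
  induction m with
  | zero =>
    intro E F _ _ _ _ v hv
    exact contDiff_zero.2 (ContinuousMap.continuous_postcomp v)
  | succ m ih =>
    intro E F _ _ _ _ v hv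
    obtain ⟨hd, hs⟩ := contDiff_infty_iff_fderiv.1 hv
    refine contDiff_succ_iff_hasFDerivAt.2
      ⟨fun γ => pointwiseApplyL K E F ((⟨fderiv ℝ v, hs.continuous⟩ : C(E, E →L[ℝ] F)).comp γ),
        (pointwiseApplyL K E F).contDiff.comp (ih _ hs), fun γ =>
        hasFDerivAt_postcomp v ⟨fderiv ℝ v, hs.continuous⟩ (fun x => (hd x).hasFDerivAt) γ⟩

/-- The superposition operator of a smooth map is smooth. -/
theorem contDiff_postcomp {E F : Type w} [NormedAddCommGroup E] [NormedSpace ℝ E]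
    [NormedAddCommGroup F] [NormedSpace ℝ F] (v : C(E, F)) (hv : ContDiff ℝ ∞ v) :
    ContDiff ℝ ∞ (fun γ : C(K, E) => v.comp γ) :=
  contDiff_infty.2 fun m => contDiff_nat_postcomp m v hv

end SuperpositionSmooth

/-! ### Smooth dependence of integral curves on the initial point and the speed -/

section SmoothDependence

variable {E : Type*} [NormedAddCommGroup E] [NormedSpace ℝ E] [CompleteSpace E]

/-- The time interval on which the rescaled integral curves are constructed. -/
abbrev CurveTime : Type := Set.Icc (-2 : ℝ) 2

theorem zero_mem_curveTime : (0 : ℝ) ∈ Set.Icc (-2 : ℝ) 2 := by constructor <;> norm_num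

/-- Extension of a curve to all times. -/
abbrev curveExtend (γ : C(CurveTime, E)) : ℝ → E :=
  Set.IccExtend (by norm_num : (-2 : ℝ) ≤ 2) γ

theorem continuous_curveExtend {E : Type*} [NormedAddCommGroup E] (γ : C(CurveTime, E)) : Continuous (curveExtend γ) :=
  γ.continuous.Icc_extend'

theorem norm_curveExtend_le {E : Type*} [NormedAddCommGroup E] (γ : C(CurveTime, E)) (s : ℝ) : ‖curveExtend γ s‖ ≤ ‖γ‖ :=
  γ.norm_coe_le_norm _

/-- The primitive of a curve that vanishes at time `0`. -/
def curvePrimitive (E : Type*) [NormedAddCommGroup E] [NormedSpace ℝ E] [CompleteSpace E] :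
    C(CurveTime, E) →L[ℝ] C(CurveTime, E) :=
  LinearMap.mkContinuous
    { toFun := fun γ => ⟨fun s => ∫ r in (0 : ℝ)..s, curveExtend γ r,
        (intervalIntegral.continuous_primitive
          (fun a b => (continuous_curveExtend γ).intervalIntegrable a b) 0).comp
          continuous_subtype_val⟩
      map_add' := by
        intro γ η
        ext s
        exact intervalIntegral.integral_add ((continuous_curveExtend γ).intervalIntegrable _ _)
          ((continuous_curveExtend η).intervalIntegrable _ _)
      map_smul' := by
        intro a γ
        ext s
        exact intervalIntegral.integral_smul a _ } 2 (by
    intro γ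
    rw [ContinuousMap.norm_le _ (by positivity)]
    intro s
    have h := intervalIntegral.norm_integral_le_of_norm_le_const (a := 0) (b := (s : ℝ))
      (f := curveExtend γ) (C := ‖γ‖) (fun r _ => norm_curveExtend_le γ r)
    have hs : |(s : ℝ) - 0| ≤ 2 := by rw [sub_zero]; exact abs_le.2 s.2
    calc _ ≤ ‖γ‖ * |(s : ℝ) - 0| := h
      _ ≤ ‖γ‖ * 2 := by gcongr
      _ = 2 * ‖γ‖ := mul_comm _ _)

/-- Smooth dependence on parameters: near `(0, x₀)` the solutions on `[-2, 2]` of the equation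
`γ' = ε v(γ)`, `γ(0) = x`, depend smoothly on `(ε, x)`. -/
theorem exists_smooth_rescaled_curves {v : E → E} (hv : ContDiff ℝ ∞ v) (x₀ : E) :
    ∃ Γ : ℝ × E → C(CurveTime, E), ContDiffAt ℝ ∞ Γ (0, x₀) ∧
      Γ (0, x₀) = ContinuousMap.const _ x₀ ∧
      ∀ᶠ z in nhds ((0 : ℝ), x₀), curveExtend (Γ z) 0 = z.2 ∧
        ∀ s ∈ Set.Ioo (-2 : ℝ) 2,
          HasDerivAt (curveExtend (Γ z)) (z.1 • v (curveExtend (Γ z) s)) s := by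
  set V : C(E, E) := ⟨v, hv.continuous⟩ with hV
  set cst : E →L[ℝ] C(CurveTime, E) := ContinuousLinearMap.const ℝ CurveTime with hcst
  have hN : ContDiff ℝ ∞ (fun γ : C(CurveTime, E) => V.comp γ) := contDiff_postcomp V hv
  -- The second component vanishes exactly when `γ = x + ε ∫ v(γ)`. Carrying the parameters `(ε, x)`
  -- along in the first component lets the inverse function theorem play the part of the implicit
  -- one.
  set Φ : (ℝ × E) × C(CurveTime, E) → (ℝ × E) × C(CurveTime, E) := fun z =>
    (z.1, z.2 - cst z.1.2 - z.1.1 • curvePrimitive E (V.comp z.2)) with hΦ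
  have hΦs : ContDiff ℝ ∞ Φ := by
    refine contDiff_fst.prodMk (((contDiff_snd.sub (cst.contDiff.comp
      (contDiff_snd.comp contDiff_fst)))).sub ?_)
    exact (contDiff_fst.comp contDiff_fst).smul
      ((curvePrimitive E).contDiff.comp (hN.comp contDiff_snd))
  set z₀ : (ℝ × E) × C(CurveTime, E) := ((0, x₀), cst x₀) with hz₀
  set ℓ : ℝ × E →L[ℝ] C(CurveTime, E) :=
    -(cst.comp (ContinuousLinearMap.snd ℝ ℝ E)) -
      (ContinuousLinearMap.fst ℝ ℝ E).smulRight (curvePrimitive E (V.comp (cst x₀))) with hℓ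
  -- At `ε = 0` the partial derivative in `γ` is the identity, so the derivative is triangular and
  -- invertible without any estimate. This is the benefit of scaling the field by `ε` on a fixed
  -- time interval.
  set Φ' : ((ℝ × E) × C(CurveTime, E)) ≃L[ℝ] ((ℝ × E) × C(CurveTime, E)) :=
    (ContinuousLinearEquiv.refl ℝ (ℝ × E)).skewProd
      (ContinuousLinearEquiv.refl ℝ C(CurveTime, E)) ℓ with hΦ'
  have hd : HasFDerivAt Φ (Φ' : _ →L[ℝ] _) z₀ := by
    have hJ : HasFDerivAt (fun z : (ℝ × E) × C(CurveTime, E) => curvePrimitive E (V.comp z.2))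
        (fderiv ℝ (fun z : (ℝ × E) × C(CurveTime, E) => curvePrimitive E (V.comp z.2)) z₀) z₀ :=
      (((curvePrimitive E).contDiff.comp (hN.comp contDiff_snd)).differentiable
        (by simp)).differentiableAt.hasFDerivAt
    have h11 : HasFDerivAt (fun z : (ℝ × E) × C(CurveTime, E) => z.1.1)
        ((ContinuousLinearMap.fst ℝ ℝ E).comp (ContinuousLinearMap.fst ℝ _ _)) z₀ :=
      ((ContinuousLinearMap.fst ℝ ℝ E).comp
        (ContinuousLinearMap.fst ℝ (ℝ × E) C(CurveTime, E))).hasFDerivAt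
    have h12 : HasFDerivAt (fun z : (ℝ × E) × C(CurveTime, E) => cst z.1.2)
        (cst.comp ((ContinuousLinearMap.snd ℝ ℝ E).comp (ContinuousLinearMap.fst ℝ _ _))) z₀ :=
      (cst.comp ((ContinuousLinearMap.snd ℝ ℝ E).comp
        (ContinuousLinearMap.fst ℝ (ℝ × E) C(CurveTime, E)))).hasFDerivAt
    have h := (hasFDerivAt_fst (𝕜 := ℝ) (p := z₀)).prodMk
      (((hasFDerivAt_snd (𝕜 := ℝ) (p := z₀)).sub h12).sub (h11.smul hJ))
    refine h.congr_fderiv ?_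
    refine ContinuousLinearMap.ext fun w => Prod.ext rfl ?_
    change w.2 - cst w.1.2 - ((0 : ℝ) • _ + w.1.1 • curvePrimitive E (V.comp (cst x₀))) =
      w.2 + (-cst w.1.2 - w.1.1 • curvePrimitive E (V.comp (cst x₀)))
    rw [zero_smul]
    abel
  have hne : (∞ : WithTop ℕ∞) ≠ 0 := by simp
  have hΦa : ContDiffAt ℝ ∞ Φ z₀ := hΦs.contDiffAt
  have hΦ0 : Φ z₀ = ((0, x₀), 0) := by simp [hΦ, hz₀]
  set Ψ := hΦa.localInverse hd hne with hΨ
  have hΨs : ContDiffAt ℝ ∞ Ψ ((0, x₀), 0) := hΦ0 ▸ hΦa.to_localInverse hd hne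
  have hΨ0 : Ψ ((0, x₀), 0) = z₀ := hΦ0 ▸ hΦa.localInverse_apply_image hd hne
  have hinv : ∀ᶠ w in nhds (((0 : ℝ), x₀), (0 : C(CurveTime, E))), Φ (Ψ w) = w :=
    hΦ0 ▸ (hΦa.hasStrictFDerivAt' hd hne).eventually_right_inverse
  have hi : ContDiff ℝ ∞ (fun z : ℝ × E => (z, (0 : C(CurveTime, E)))) :=
    contDiff_id.prodMk contDiff_const
  refine ⟨fun z => (Ψ (z, 0)).2, ?_, ?_, ?_⟩
  · exact contDiff_snd.contDiffAt.comp _ (ContDiffAt.comp (g := Ψ) (0, x₀) hΨs hi.contDiffAt)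
  · simp only [hΨ0, hz₀]; rfl
  · have := hi.continuous.continuousAt (x := ((0 : ℝ), x₀)) |>.eventually hinv
    filter_upwards [this] with z hz
    have h1 : (Ψ (z, 0)).1 = z := congrArg Prod.fst hz
    have h2 := congrArg Prod.snd hz
    set γ := (Ψ (z, 0)).2 with hγ
    have h2' : γ = cst z.2 + z.1 • curvePrimitive E (V.comp γ) := by
      simp only [hΦ, h1] at h2
      rw [sub_sub] at h2
      exact sub_eq_zero.1 h2
    have hval : ∀ s ∈ Set.Icc (-2 : ℝ) 2,
        curveExtend γ s = z.2 + z.1 • ∫ r in (0 : ℝ)..s, v (curveExtend γ r) := by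
      intro s hs
      have h3 := congrArg (fun η : C(CurveTime, E) => η ⟨s, hs⟩) h2'
      simp only [ContinuousMap.add_apply, ContinuousMap.smul_apply] at h3
      rw [curveExtend, Set.IccExtend_of_mem _ _ hs, h3]
      rfl
    refine ⟨?_, fun s hs => ?_⟩
    · rw [hval 0 zero_mem_curveTime]; simp
    · have hcont : Continuous fun r => v (curveExtend γ r) :=
        hv.continuous.comp (continuous_curveExtend γ)
      have := ((hcont.integral_hasStrictDerivAt 0 s).hasDerivAt.const_smul z.1).const_add z.2
      refine this.congr_of_eventuallyEq ?_
      filter_upwards [Ioo_mem_nhds hs.1 hs.2] with r hr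
      exact hval r (Set.Ioo_subset_Icc_self hr)

end SmoothDependence

end HarmonicSoliton

end

noncomputable section

open scoped Manifold ContDiff

namespace HarmonicSoliton

/-! ### Calculus of multilinear maps -/

section MultilinearCalculus

variable {m : ℕ} {Z D W W' : Type*} [NormedAddCommGroup Z] [NormedSpace ℝ Z]
  [NormedAddCommGroup D] [NormedSpace ℝ D] [NormedAddCommGroup W] [NormedSpace ℝ W]
  [NormedAddCommGroup W'] [NormedSpace ℝ W']

theorem contDiffAt_compContinuousLinearMapL {A : Fin m → Z → D →L[ℝ] D} {z : Z}
    (hA : ∀ i, ContDiffAt ℝ ∞ (A i) z) :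
    ContDiffAt ℝ ∞ (fun z => (ContinuousMultilinearMap.compContinuousLinearMapL (F := W)
      (fun i => A i z))) z :=
  (ContinuousMultilinearMap.compContinuousLinearMapContinuousMultilinear ℝ
    (fun _ : Fin m => D) (fun _ : Fin m => D) W).contDiff.contDiffAt.comp z (contDiffAt_pi.2 hA)

theorem contDiffAt_compContinuousLinearMap
    {ξ : Z → ContinuousMultilinearMap ℝ (fun _ : Fin m => D) W}
    {A : Fin m → Z → D →L[ℝ] D} {z : Z} (hξ : ContDiffAt ℝ ∞ ξ z)
    (hA : ∀ i, ContDiffAt ℝ ∞ (A i) z) :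
    ContDiffAt ℝ ∞ (fun z => (ξ z).compContinuousLinearMap fun i => A i z) z :=
  (contDiffAt_compContinuousLinearMapL hA).clm_apply hξ

theorem contDiffAt_compContinuousMultilinearMap
    {ξ : Z → ContinuousMultilinearMap ℝ (fun _ : Fin m => D) W} {K : Z → W →L[ℝ] W'} {z : Z}
    (hK : ContDiffAt ℝ ∞ K z) (hξ : ContDiffAt ℝ ∞ ξ z) :
    ContDiffAt ℝ ∞ (fun z => (K z).compContinuousMultilinearMap (ξ z)) z := by
  have h := hK.continuousLinearMap_comp
    (G := ContinuousMultilinearMap ℝ (fun _ : Fin m => D) W →L[ℝ]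
      ContinuousMultilinearMap ℝ (fun _ : Fin m => D) W')
    (ContinuousLinearMap.compContinuousMultilinearMapL ℝ (fun _ : Fin m => D) W W')
  exact h.clm_apply hξ

theorem hasDerivAt_multilinear_apply
    {ξ : ℝ → ContinuousMultilinearMap ℝ (fun _ : Fin m => D) W}
    {ξ' : ContinuousMultilinearMap ℝ (fun _ : Fin m => D) W} {θ : ℝ → Fin m → D} {θ' : Fin m → D}
    {s : ℝ} (hξ : HasDerivAt ξ ξ' s) (hθ : ∀ i, HasDerivAt (fun s => θ s i) (θ' i) s) :
    HasDerivAt (fun s => ξ s (θ s))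
      (ξ' (θ s) + ∑ r, ξ s (Function.update (θ s) r (θ' r))) s := by
  have h := (ContinuousMultilinearMap.hasStrictFDerivAt_uncurry (ξ s, θ s)).hasFDerivAt
  have h2 := h.comp_hasDerivAt (f := fun s => (ξ s, θ s)) s (hξ.prodMk (hasDerivAt_pi.2 hθ))
  refine h2.congr_deriv ?_
  simp [ContinuousMultilinearMap.linearDeriv_apply]

/-- Evaluation of multilinear maps separates derivatives. -/
theorem hasDerivAt_of_eval
    {ξ : ℝ → ContinuousMultilinearMap ℝ (fun _ : Fin m => D) W}
    {ξ' : ContinuousMultilinearMap ℝ (fun _ : Fin m => D) W} {s : ℝ}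
    (hd : DifferentiableAt ℝ ξ s)
    (h : ∀ θ, DifferentiableAt ℝ (fun s => ξ s θ) s → HasDerivAt (fun s => ξ s θ) (ξ' θ) s) :
    HasDerivAt ξ ξ' s := by
  obtain ⟨d, hd'⟩ : ∃ d, HasDerivAt ξ d s := ⟨_, DifferentiableAt.hasDerivAt (𝕜 := ℝ)
    (F := ContinuousMultilinearMap ℝ (fun _ : Fin m => D) W) (f := ξ) (x := s) hd⟩
  have he : d = ξ' := by
    refine ContinuousMultilinearMap.ext fun θ => ?_
    have h1 : HasDerivAt (fun s => ξ s θ) (d θ) s := by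
      -- With constant arguments the product rule leaves only terms with an argument replaced by
      -- zero.
      have h0 : ∀ r, ξ s (Function.update θ r 0) = 0 := fun r =>
        (ξ s).map_coord_zero r (by simp)
      simpa [h0] using hasDerivAt_multilinear_apply hd' (fun i => hasDerivAt_const s (θ i))
    exact h1.unique (h θ h1.differentiableAt)
  exact he ▸ hd'

end MultilinearCalculus

/-! ### Pull-back of tensors and the infinitesimal action -/

section TensorCalculus

variable {n p q : ℕ}

theorem tensor_ext {ξ η : Tensor n p q} (h : ∀ θ v, ξ θ v = η θ v) : ξ = η :=
  ContinuousMultilinearMap.ext fun θ => ContinuousMultilinearMap.ext fun v => h θ v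

theorem diamond_add_left (A B : EndT n) (ξ : Tensor n p q) :
    diamond (A + B) ξ = diamond A ξ + diamond B ξ := by
  refine tensor_ext fun θ v => ?_
  change _ = diamond A ξ θ v + diamond B ξ θ v
  simp only [diamond_apply, add_apply, ContinuousLinearMap.comp_add,
    ContinuousMultilinearMap.map_update_add, Finset.sum_add_distrib]
  abel

theorem diamond_smul_left (a : ℝ) (A : EndT n) (ξ : Tensor n p q) :
    diamond (a • A) ξ = a • diamond A ξ := by
  refine tensor_ext fun θ v => ?_
  change _ = a • diamond A ξ θ v
  simp only [diamond_apply, smul_apply, ContinuousLinearMap.comp_smul,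
    ContinuousMultilinearMap.map_update_smul, ← Finset.smul_sum, smul_sub]

theorem diamond_smul_right (a : ℝ) (A : EndT n) (ξ : Tensor n p q) :
    diamond A (a • ξ) = a • diamond A ξ := by
  refine tensor_ext fun θ v => ?_
  change _ = a • diamond A ξ θ v
  simp only [diamond_apply, smul_apply, ← Finset.smul_sum, smul_sub]

theorem diamond_neg_left (A : EndT n) (ξ : Tensor n p q) :
    diamond (-A) ξ = -diamond A ξ := by
  rw [← neg_one_smul ℝ A, diamond_smul_left]
  module

theorem diamond_sub_left (A B : EndT n) (ξ : Tensor n p q) :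
    diamond (A - B) ξ = diamond A ξ - diamond B ξ := by
  rw [sub_eq_add_neg, diamond_add_left, diamond_neg_left]
  abel

theorem diamond_zero_left (ξ : Tensor n p q) : diamond 0 ξ = 0 := by
  rw [← zero_smul ℝ (0 : EndT n), diamond_smul_left]
  module

theorem pullback_add (L : EndT n) (ξ η : Tensor n p q) :
    Tensor.pullback L (ξ + η) = Tensor.pullback L ξ + Tensor.pullback L η :=
  tensor_ext fun _ _ => rfl

theorem pullback_sub (L : EndT n) (ξ η : Tensor n p q) :
    Tensor.pullback L (ξ - η) = Tensor.pullback L ξ - Tensor.pullback L η :=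
  tensor_ext fun _ _ => rfl

theorem pullback_smul (L : EndT n) (a : ℝ) (ξ : Tensor n p q) :
    Tensor.pullback L (a • ξ) = a • Tensor.pullback L ξ :=
  tensor_ext fun _ _ => rfl

theorem pullback_zero (L : EndT n) : Tensor.pullback L (0 : Tensor n p q) = 0 :=
  tensor_ext fun _ _ => rfl

theorem pullback_id (ξ : Tensor n p q) :
    Tensor.pullback (ContinuousLinearMap.id ℝ (Model n)) ξ = ξ := by
  refine tensor_ext fun θ v => ?_
  simp [Tensor.pullback_apply, ContinuousLinearMap.inverse_id]

/-- Invertibility of `L` suffices for `(L L')⁻¹ = L'⁻¹ L⁻¹`: if `L'` is singular, both sides take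
the default value zero. -/
theorem pullback_comp {L : EndT n} (hL : L.IsInvertible) (L' : EndT n) (ξ : Tensor n p q) :
    Tensor.pullback (L.comp L') ξ = Tensor.pullback L' (Tensor.pullback L ξ) := by
  refine tensor_ext fun θ v => ?_
  simp only [Tensor.pullback_apply, hL.inverse_comp_of_left]
  rfl

theorem pullback_inverse_pullback {L : EndT n} (hL : L.IsInvertible) (ξ : Tensor n p q) :
    Tensor.pullback L.inverse (Tensor.pullback L ξ) = ξ := by
  rw [← pullback_comp hL, hL.self_comp_inverse, pullback_id]

/-- Equivariance of the infinitesimal action: `L^* (A ⋄ ξ) = B ⋄ L^* ξ` if `L B = A L`. -/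
theorem pullback_diamond {L A B : EndT n} (hL : L.IsInvertible) (h : L.comp B = A.comp L)
    (ξ : Tensor n p q) :
    Tensor.pullback L (diamond A ξ) = diamond B (Tensor.pullback L ξ) := by
  refine tensor_ext fun θ v => ?_
  have hv : ∀ w, L (B w) = A (L w) := fun w => congrArg (fun T : EndT n => T w) h
  have hθ : B.comp L.inverse = L.inverse.comp A := by
    refine ContinuousLinearMap.ext fun w => hL.injective ?_
    simp [hv, hL.self_apply_inverse]
  rw [Tensor.pullback_apply, diamond_apply, diamond_apply]
  simp only [Tensor.pullback_apply]
  congr 1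
  · refine Finset.sum_congr rfl fun s _ => ?_
    congr 1
    funext j
    by_cases hj : j = s
    · subst hj; simp [hv]
    · simp [hj]
  · refine Finset.sum_congr rfl fun r _ => ?_
    have : Function.update (fun i => (θ i).comp L.inverse) r (((θ r).comp L.inverse).comp A) =
        fun i => (Function.update θ r ((θ r).comp B) i).comp L.inverse := by
      funext j
      by_cases hj : j = r
      · subst hj; simp [ContinuousLinearMap.comp_assoc, hθ]
      · simp [hj]
    rw [this]

/-- Each of the `q` vectors contributes `a` and each of the `p` covectors `a⁻¹`. This is where the
net degree enters as the exponent of `ρ`. -/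
theorem pullback_smul_id {a : ℝ} (ha : a ≠ 0) (ξ : Tensor n p q) :
    Tensor.pullback (a • ContinuousLinearMap.id ℝ (Model n)) ξ = a ^ ((q : ℤ) - (p : ℤ)) • ξ := by
  have hinv : (a • ContinuousLinearMap.id ℝ (Model n)).inverse =
      a⁻¹ • ContinuousLinearMap.id ℝ (Model n) := by
    apply ContinuousLinearMap.inverse_eq <;> ext1 v <;> simp [smul_smul, ha]
  refine tensor_ext fun θ v => ?_
  rw [Tensor.pullback_apply, hinv]
  have h1 : (fun i => (θ i).comp (a⁻¹ • ContinuousLinearMap.id ℝ (Model n))) =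
      fun i => (fun _ : Fin p => a⁻¹) i • θ i := by funext i; ext; simp
  have h2 : (fun j => (a • ContinuousLinearMap.id ℝ (Model n)) (v j)) =
      fun j => (fun _ : Fin q => a) j • v j := rfl
  rw [h1, h2, ContinuousMultilinearMap.map_smul_univ, smul_apply,
    ContinuousMultilinearMap.map_smul_univ]
  simp only [Finset.prod_const, Finset.card_univ, Fintype.card_fin, smul_eq_mul, smul_apply]
  rw [zpow_sub₀ ha, zpow_natCast, zpow_natCast, inv_pow]
  field_simp

/-- The infinitesimal form of `pullback_smul_id`. It produces the term that the derivative of `ρ^ℓ`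
has to cancel. -/
theorem diamond_id (ξ : Tensor n p q) :
    diamond (ContinuousLinearMap.id ℝ (Model n)) ξ = ((q : ℝ) - (p : ℝ)) • ξ := by
  refine tensor_ext fun θ v => ?_
  rw [diamond_apply]
  simp [sub_mul]

theorem contDiffAt_covectorComp {Z : Type*} [NormedAddCommGroup Z] [NormedSpace ℝ Z]
    {L : Z → EndT n} {z : Z} (hL : ContDiffAt ℝ ∞ L z) :
    ContDiffAt ℝ ∞ (fun z => covectorComp (L z)) z := by
  have h := ContDiffAt.continuousLinearMap_comp (F := EndT n)
    (G := (Model n →L[ℝ] ℝ) →L[ℝ] (Model n →L[ℝ] ℝ))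
    ((ContinuousLinearMap.compL ℝ (Model n) (Model n) ℝ).flip) hL
  exact h

theorem contDiffAt_inverse {Z : Type*} [NormedAddCommGroup Z] [NormedSpace ℝ Z]
    {L : Z → EndT n} {z : Z} (hL : ContDiffAt ℝ ∞ L z) (hi : (L z).IsInvertible) :
    ContDiffAt ℝ ∞ (fun z => (L z).inverse) z :=
  hi.contDiffAt_map_inverse.comp z hL

theorem contDiffAt_pullback {Z : Type*} [NormedAddCommGroup Z] [NormedSpace ℝ Z]
    {L : Z → EndT n} {ξ : Z → Tensor n p q} {z : Z} (hL : ContDiffAt ℝ ∞ L z)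
    (hi : (L z).IsInvertible) (hξ : ContDiffAt ℝ ∞ ξ z) :
    ContDiffAt ℝ ∞ (fun z => Tensor.pullback (L z) (ξ z)) z :=
  contDiffAt_compContinuousMultilinearMap (contDiffAt_compContinuousLinearMapL fun _ => hL)
    (contDiffAt_compContinuousLinearMap hξ fun _ =>
      contDiffAt_covectorComp (contDiffAt_inverse hL hi))

theorem contDiffAt_diamond {Z : Type*} [NormedAddCommGroup Z] [NormedSpace ℝ Z]
    {A : Z → EndT n} {ξ : Z → Tensor n p q} {z : Z} (hA : ContDiffAt ℝ ∞ A z)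
    (hξ : ContDiffAt ℝ ∞ ξ z) : ContDiffAt ℝ ∞ (fun z => diamond (A z) (ξ z)) z := by
  have h1 : ∀ s : Fin q, ContDiffAt ℝ ∞ (fun z =>
      (ContinuousMultilinearMap.compContinuousLinearMapL
        (Function.update (fun _ : Fin q => ContinuousLinearMap.id ℝ (Model n))
          s (A z))).compContinuousMultilinearMap (ξ z)) z := fun s => by
    refine contDiffAt_compContinuousMultilinearMap
      (contDiffAt_compContinuousLinearMapL
        (A := fun i z => Function.update (fun _ : Fin q => ContinuousLinearMap.id ℝ (Model n)) s
          (A z) i) fun i => ?_) hξ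
    by_cases h : i = s
    · subst h; simpa using hA
    · simpa [h] using contDiffAt_const
  have h2 : ∀ r : Fin p, ContDiffAt ℝ ∞ (fun z => (ξ z).compContinuousLinearMap
      (Function.update (fun _ : Fin p => ContinuousLinearMap.id ℝ (Model n →L[ℝ] ℝ))
        r (covectorComp (A z)))) z := fun r => by
    refine contDiffAt_compContinuousLinearMap
      (A := fun i z => Function.update (fun _ : Fin p => ContinuousLinearMap.id ℝ _) r
        (covectorComp (A z)) i) hξ fun i => ?_
    by_cases h : i = r
    · subst h; simpa using contDiffAt_covectorComp hA
    · simpa [h] using contDiffAt_const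
  have h := ContDiffAt.sub (F := Tensor n p q) (ContDiffAt.sum (s := Finset.univ) fun s _ => h1 s)
    (ContDiffAt.sum (s := Finset.univ) fun r _ => h2 r)
  exact h

theorem hasDerivAt_inverse {L : ℝ → EndT n} {L' : EndT n} {s : ℝ} (hL : HasDerivAt L L' s)
    (hi : (L s).IsInvertible) :
    HasDerivAt (fun s => (L s).inverse) (-((L s).inverse.comp (L'.comp (L s).inverse))) s := by
  obtain ⟨e, he⟩ := hi
  have h := hasFDerivAt_ringInverse (𝕜 := ℝ) (ContinuousLinearEquiv.toUnit e)
  rw [ContinuousLinearMap.ringInverse_eq_inverse] at h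
  have he' : ((ContinuousLinearEquiv.toUnit e : (EndT n)ˣ) : EndT n) = L s := he
  have h2 := (he' ▸ h).comp_hasDerivAt s hL
  refine h2.congr_deriv ?_
  rw [← he, ContinuousLinearMap.inverse_equiv]
  rfl

/-- The derivative of a pull-back along a curve of linear isomorphisms and tensors. -/
theorem hasDerivAt_pullback {L : ℝ → EndT n} {L' : EndT n} {ξ : ℝ → Tensor n p q}
    {ξ' : Tensor n p q} {s : ℝ} (hL : HasDerivAt L L' s) (hi : (L s).IsInvertible)
    (hξ : HasDerivAt ξ ξ' s) (hd : DifferentiableAt ℝ (fun s => Tensor.pullback (L s) (ξ s)) s) :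
    HasDerivAt (fun s => Tensor.pullback (L s) (ξ s))
      (Tensor.pullback (L s) (ξ' + diamond (L'.comp (L s).inverse) (ξ s))) s := by
  -- As differentiability is given, the derivative can be identified after evaluation on fixed
  -- covectors and vectors, where the product rule applies. The vectors `L v` give the positive sum
  -- in the infinitesimal action, the covectors `θ ∘ L⁻¹` the negative one.
  refine hasDerivAt_of_eval hd fun θ hdθ => hasDerivAt_of_eval hdθ fun v _ => ?_
  have hθ : ∀ i, HasDerivAt (fun s => (θ i).comp (L s).inverse)
      ((θ i).comp (-((L s).inverse.comp (L'.comp (L s).inverse)))) s := fun i =>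
    ((ContinuousLinearMap.compL ℝ (Model n) (Model n) ℝ (θ i)).hasFDerivAt).comp_hasDerivAt s
      (hasDerivAt_inverse hL hi)
  have hv : ∀ j, HasDerivAt (fun s => L s (v j)) (L' (v j)) s := fun j =>
    hL.clm_apply (hasDerivAt_const s (v j)) |>.congr_deriv (by simp)
  have h1 := hasDerivAt_multilinear_apply hξ hθ
  have h2 := hasDerivAt_multilinear_apply h1 hv
  refine h2.congr_deriv ?_
  rw [pullback_add]
  change _ = Tensor.pullback (L s) ξ' θ v + Tensor.pullback (L s) _ θ v
  rw [Tensor.pullback_apply, Tensor.pullback_apply, diamond_apply]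
  have e1 : ∀ j, (L'.comp (L s).inverse) (L s (v j)) = L' (v j) := fun j => by
    rw [ContinuousLinearMap.comp_apply, hi.inverse_apply_self]
  have e2 : ∀ r, (θ r).comp (-((L s).inverse.comp (L'.comp (L s).inverse))) =
      -(((θ r).comp (L s).inverse).comp (L'.comp (L s).inverse)) := fun r => by
    ext w; simp
  have e3 : ∀ r, (ξ s) (Function.update (fun i => (θ i).comp (L s).inverse) r
      (-(((θ r).comp (L s).inverse).comp (L'.comp (L s).inverse)))) =
      -(ξ s) (Function.update (fun i => (θ i).comp (L s).inverse) r
        (((θ r).comp (L s).inverse).comp (L'.comp (L s).inverse))) := fun r =>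
    (ξ s).toMultilinearMap.map_update_neg _ _ _
  simp only [e1, e2, e3, add_apply, sum_apply, neg_apply, Finset.sum_neg_distrib]
  ring

end TensorCalculus

end HarmonicSoliton

end

noncomputable section

open scoped Manifold ContDiff

namespace HarmonicSoliton

/-! ### The trace form, the splitting of skew endomorphisms and its equivariance -/

section Projections

variable {n p q : ℕ}

/-- `e` is an orthonormal frame of `b`. -/
def IsOrthFrame (b : Model n →L[ℝ] Model n →L[ℝ] ℝ) (e : Model n ≃L[ℝ] Model n) : Prop :=
  ∀ u v, b (e u) (e v) = inner ℝ u v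

/-- The trace pairing of endomorphisms. -/
def trPair (A B : EndT n) : ℝ := LinearMap.trace ℝ (Model n) (A.comp B : EndT n).toLinearMap

theorem trPair_comm (A B : EndT n) : trPair A B = trPair B A :=
  LinearMap.trace_mul_comm ℝ A.toLinearMap B.toLinearMap

theorem trPair_add_left (A A' B : EndT n) : trPair (A + A') B = trPair A B + trPair A' B := by
  rw [trPair, ContinuousLinearMap.add_comp]
  exact map_add _ _ _

theorem trPair_smul_left (a : ℝ) (A B : EndT n) : trPair (a • A) B = a * trPair A B := by
  rw [trPair, ContinuousLinearMap.smul_comp]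
  exact map_smul _ _ _

theorem trPair_sub_left (A A' B : EndT n) : trPair (A - A') B = trPair A B - trPair A' B := by
  rw [trPair, ContinuousLinearMap.sub_comp]
  exact map_sub _ _ _

theorem trPair_add_right (A B B' : EndT n) : trPair A (B + B') = trPair A B + trPair A B' := by
  simp only [trPair_comm A, trPair_add_left]

theorem trPair_smul_right (a : ℝ) (A B : EndT n) : trPair A (a • B) = a * trPair A B := by
  simp only [trPair_comm A, trPair_smul_left]

/-- The trace pairing as a bilinear form. -/
def trForm (n : ℕ) : LinearMap.BilinForm ℝ (EndT n) :=
  LinearMap.mk₂ ℝ trPair trPair_add_left trPair_smul_left trPair_add_right trPair_smul_right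

theorem trForm_apply (A B : EndT n) : trForm n A B = trPair A B := rfl

theorem trForm_isRefl (n : ℕ) : (trForm n).IsRefl := fun A B h => by
  rw [trForm_apply] at *
  rw [trPair_comm, h]

/-- Conjugation of an endomorphism by an isomorphism, `L⁻¹ A L`. -/
def conjEnd (L A : EndT n) : EndT n := L.inverse.comp (A.comp L)

theorem comp_conjEnd {L : EndT n} (hL : L.IsInvertible) (A : EndT n) :
    L.comp (conjEnd L A) = A.comp L := by
  rw [conjEnd, ← ContinuousLinearMap.comp_assoc, hL.self_comp_inverse,
    ContinuousLinearMap.id_comp]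

theorem apply_conjEnd {L : EndT n} (hL : L.IsInvertible) (A : EndT n) (u : Model n) :
    L (conjEnd L A u) = A (L u) := congrArg (fun T : EndT n => T u) (comp_conjEnd hL A)

theorem conjEnd_conjEnd_inverse {L : EndT n} (hL : L.IsInvertible) (A : EndT n) :
    conjEnd L (conjEnd L.inverse A) = A := by
  refine ContinuousLinearMap.ext fun u => hL.injective ?_
  rw [apply_conjEnd hL, conjEnd, hL.inverse_inverse]
  simp [hL.inverse_apply_self]

theorem trPair_conjEnd {L : EndT n} (hL : L.IsInvertible) (A B : EndT n) :
    trPair (conjEnd L A) (conjEnd L B) = trPair A B := by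
  have h : (conjEnd L A).comp (conjEnd L B) = conjEnd L (A.comp B) := by
    refine ContinuousLinearMap.ext fun u => hL.injective ?_
    simp [apply_conjEnd hL]
  rw [trPair, h, conjEnd, ← ContinuousLinearMap.comp_assoc]
  have h2 : trPair (L.inverse.comp (A.comp B)) L = trPair L (L.inverse.comp (A.comp B)) :=
    trPair_comm _ _
  rw [trPair, trPair, ← ContinuousLinearMap.comp_assoc L, hL.self_comp_inverse,
    ContinuousLinearMap.id_comp] at h2
  exact h2

theorem trace_eq_sum (A : EndT n) : LinearMap.trace ℝ (Model n) A.toLinearMap =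
    ∑ i, inner ℝ (EuclideanSpace.basisFun (Fin n) ℝ i) (A (EuclideanSpace.basisFun (Fin n) ℝ i)) :=
  LinearMap.trace_eq_sum_inner _ _

variable {b b' : Model n →L[ℝ] Model n →L[ℝ] ℝ} {e : Model n ≃L[ℝ] Model n}

theorem IsOrthFrame.inner_conj (he : IsOrthFrame b e) {A : EndT n} (hA : IsSkew b A)
    (u v : Model n) :
    inner ℝ (conjEnd (e : EndT n) A u) v = -inner ℝ u (conjEnd (e : EndT n) A v) := by
  have hi : (e : EndT n).IsInvertible := ContinuousLinearMap.isInvertible_equiv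
  rw [← he, ← he]
  have h1 : e (conjEnd (e : EndT n) A u) = A (e u) := apply_conjEnd hi A u
  have h2 : e (conjEnd (e : EndT n) A v) = A (e v) := apply_conjEnd hi A v
  rw [h1, h2, hA]

/-- The trace form is negative definite on skew endomorphisms: in an orthonormal frame `tr (C²) = -∑
‖C eᵢ‖²`. All uniqueness statements about `𝔪` rest on this. -/
theorem IsOrthFrame.trPair_self (he : IsOrthFrame b e) {A : EndT n} (hA : IsSkew b A)
    (h : trPair A A = 0) : A = 0 := by
  have hi : (e : EndT n).IsInvertible := ContinuousLinearMap.isInvertible_equiv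
  have h1 : trPair (conjEnd (e : EndT n) A) (conjEnd (e : EndT n) A) = 0 := by
    rw [trPair_conjEnd hi, h]
  rw [trPair, trace_eq_sum] at h1
  set C := conjEnd (e : EndT n) A with hC
  have h2 : ∀ u : Model n, inner ℝ u ((C.comp C : EndT n) u) = -‖C u‖ ^ 2 := fun u => by
    rw [ContinuousLinearMap.comp_apply, ← real_inner_self_eq_norm_sq, he.inner_conj hA, neg_neg]
  simp only [h2, Finset.sum_neg_distrib, neg_eq_zero] at h1
  have h3 := (Finset.sum_eq_zero_iff_of_nonneg (fun i _ => sq_nonneg _)).1 h1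
  have hC0 : C = 0 := by
    have : C.toLinearMap = 0 := (EuclideanSpace.basisFun (Fin n) ℝ).toBasis.ext fun i => by
      have := h3 i (Finset.mem_univ i)
      rw [sq_eq_zero_iff, norm_eq_zero] at this
      simpa using this
    exact ContinuousLinearMap.coe_injective this
  refine ContinuousLinearMap.ext fun u => ?_
  have h4 := apply_conjEnd hi A (e.symm u)
  rw [← hC, hC0] at h4
  simpa using h4.symm

/-- Multiples of the identity are orthogonal to skew endomorphisms, so `π_𝔪` does not see the trace
part of `∇X`. -/
theorem IsOrthFrame.trace_skew (he : IsOrthFrame b e) {A : EndT n} (hA : IsSkew b A) :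
    trPair (ContinuousLinearMap.id ℝ (Model n)) A = 0 := by
  have hi : (e : EndT n).IsInvertible := ContinuousLinearMap.isInvertible_equiv
  rw [← trPair_conjEnd hi]
  have h1 : conjEnd (e : EndT n) (ContinuousLinearMap.id ℝ (Model n)) =
      ContinuousLinearMap.id ℝ (Model n) := by
    rw [conjEnd, ContinuousLinearMap.id_comp, hi.inverse_comp_self]
  rw [h1, trPair, ContinuousLinearMap.id_comp, trace_eq_sum]
  refine Finset.sum_eq_zero fun i _ => ?_
  set u := EuclideanSpace.basisFun (Fin n) ℝ i
  have := he.inner_conj hA u u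
  rw [real_inner_comm] at this
  linarith

theorem IsSkew.add {A B : EndT n} (hA : IsSkew b A) (hB : IsSkew b B) : IsSkew b (A + B) :=
  fun u v => by simp only [add_apply, map_add, hA u v, hB u v]; ring

theorem IsSkew.smul {A : EndT n} (a : ℝ) (hA : IsSkew b A) : IsSkew b (a • A) :=
  fun u v => by simp only [smul_apply, map_smul, smul_eq_mul, hA u v]; ring

theorem isSkew_zero (b : Model n →L[ℝ] Model n →L[ℝ] ℝ) : IsSkew b 0 := fun u v => by simp

theorem IsSkew.sub {A B : EndT n} (hA : IsSkew b A) (hB : IsSkew b B) : IsSkew b (A - B) := by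
  rw [sub_eq_add_neg, ← neg_one_smul ℝ B]; exact hA.add (hB.smul _)

/-- `hSpace` as a subspace. -/
def hSub (b : Model n →L[ℝ] Model n →L[ℝ] ℝ) (ξ : Tensor n p q) : Submodule ℝ (EndT n) where
  carrier := hSpace b ξ
  zero_mem' := ⟨isSkew_zero b, diamond_zero_left ξ⟩
  add_mem' := fun hA hB => ⟨hA.1.add hB.1, by
    rw [diamond_add_left, hA.2, hB.2]; abel⟩
  smul_mem' := fun a A hA => ⟨hA.1.smul a, by
    rw [diamond_smul_left, hA.2]; module⟩

/-- `mSpace` as a subspace. -/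
def mSub (b : Model n →L[ℝ] Model n →L[ℝ] ℝ) (ξ : Tensor n p q) : Submodule ℝ (EndT n) where
  carrier := mSpace b ξ
  zero_mem' := ⟨isSkew_zero b, fun B _ => by
    simp⟩
  add_mem' := fun {A A'} hA hB => ⟨hA.1.add hB.1, fun B h => by
    have h1 := hA.2 B h
    have h2 := hB.2 B h
    change trPair _ _ = 0 at h1 h2
    change trPair _ _ = 0
    rw [trPair_add_left, h1, h2, add_zero]⟩
  smul_mem' := fun a A hA => ⟨hA.1.smul a, fun B h => by
    have h1 := hA.2 B h
    change trPair _ _ = 0 at h1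
    change trPair _ _ = 0
    rw [trPair_smul_left, h1, mul_zero]⟩

theorem sub_mem_mSpace {ξ : Tensor n p q} {A B : EndT n} (hA : A ∈ mSpace b ξ)
    (hB : B ∈ mSpace b ξ) : A - B ∈ mSpace b ξ := (mSub b ξ).sub_mem hA hB

theorem smul_mem_mSpace {ξ : Tensor n p q} {A : EndT n} (a : ℝ) (hA : A ∈ mSpace b ξ) :
    a • A ∈ mSpace b ξ := (mSub b ξ).smul_mem a hA

theorem add_mem_mSpace {ξ : Tensor n p q} {A B : EndT n} (hA : A ∈ mSpace b ξ)
    (hB : B ∈ mSpace b ξ) : A + B ∈ mSpace b ξ := (mSub b ξ).add_mem hA hB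

/-- A subspace of skew endomorphisms is complemented by its orthogonal. -/
theorem IsOrthFrame.exists_decomp (he : IsOrthFrame b e) (W : Submodule ℝ (EndT n))
    (hW : ∀ A ∈ W, IsSkew b A) (A : EndT n) :
    ∃ B ∈ W, ∀ C ∈ W, trPair (A - B) C = 0 := by
  -- The trace form is indefinite on all endomorphisms but definite on `W`, which is enough for `W`
  -- and its orthogonal to be complementary.
  have hnd : ((trForm n).restrict W).Nondegenerate := by
    exact ⟨fun A hA => Subtype.ext (he.trPair_self (hW A A.2) (hA A)),
      fun A hA => Subtype.ext (he.trPair_self (hW A A.2) (hA A))⟩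
  have hc := LinearMap.BilinForm.isCompl_orthogonal_of_restrict_nondegenerate
    (trForm_isRefl n) hnd
  obtain ⟨B, hB, C', hC', h⟩ :=
    Submodule.mem_sup.1 (hc.sup_eq_top ▸ Submodule.mem_top (x := A))
  refine ⟨B, hB, fun D hD => ?_⟩
  have := (LinearMap.BilinForm.mem_orthogonal_iff.1 hC') D hD
  rw [← h, add_sub_cancel_left, trPair_comm]
  exact this

theorem eq_of_mem_mSpace (he : IsOrthFrame b e) {ξ : Tensor n p q} {A B : EndT n}
    (hA : A ∈ mSpace b ξ) (hB : B ∈ mSpace b ξ) (h : ∀ C ∈ mSpace b ξ, trPair (A - B) C = 0) :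
    A = B :=
  sub_eq_zero.1 (he.trPair_self (sub_mem_mSpace hA hB).1 (h _ (sub_mem_mSpace hA hB)))

/-- The difference lies in both `𝔥` and `𝔪`, hence is orthogonal to itself. This makes the torsion
unique. -/
theorem eq_of_diamond_eq (he : IsOrthFrame b e) {ξ : Tensor n p q} {A B : EndT n}
    (hA : A ∈ mSpace b ξ) (hB : B ∈ mSpace b ξ) (h : diamond A ξ = diamond B ξ) : A = B := by
  have hm := sub_mem_mSpace hA hB
  have hh : A - B ∈ hSpace b ξ := ⟨hm.1, by rw [diamond_sub_left, h]; abel⟩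
  exact sub_eq_zero.1 (he.trPair_self hm.1 (hm.2 _ hh))

theorem mProj_spec (he : IsOrthFrame b e) (ξ : Tensor n p q) (A : EndT n) :
    mProj b ξ A ∈ mSpace b ξ ∧ ∀ C ∈ mSpace b ξ, trPair (A - mProj b ξ A) C = 0 := by
  obtain ⟨B, hB, h⟩ := he.exists_decomp (mSub b ξ) (fun A hA => hA.1) A
  exact Classical.epsilon_spec (p := fun B : EndT n => B ∈ mSpace b ξ ∧ ∀ C ∈ mSpace b ξ,
    LinearMap.trace ℝ (Model n) ((A - B).comp C : EndT n).toLinearMap = 0) ⟨B, hB, h⟩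

theorem mProj_eq (he : IsOrthFrame b e) {ξ : Tensor n p q} {A B : EndT n}
    (hB : B ∈ mSpace b ξ) (h : ∀ C ∈ mSpace b ξ, trPair (A - B) C = 0) : mProj b ξ A = B := by
  obtain ⟨h1, h2⟩ := mProj_spec he ξ A
  refine eq_of_mem_mSpace he h1 hB fun C hC => ?_
  rw [show mProj b ξ A - B = (A - B) - (A - mProj b ξ A) by abel, trPair_sub_left, h C hC,
    h2 C hC, sub_zero]

theorem exists_mSpace_of_isSkew (he : IsOrthFrame b e) (ξ : Tensor n p q) {A : EndT n}
    (hA : IsSkew b A) : ∃ B ∈ mSpace b ξ, A - B ∈ hSpace b ξ := by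
  obtain ⟨B, hB, h⟩ := he.exists_decomp (hSub b ξ) (fun A hA => hA.1) A
  refine ⟨A - B, ⟨hA.sub hB.1, h⟩, ?_⟩
  rw [sub_sub_cancel]
  exact hB

/-- If `A` is skew up to the multiple `κ` of the identity, then `A` acts on `ξ` as `π_𝔪 A` up to
scaling. -/
theorem diamond_mProj (he : IsOrthFrame b e) (ξ : Tensor n p q) {A : EndT n} {κ : ℝ}
    (hA : IsSkew b (A - κ • ContinuousLinearMap.id ℝ (Model n))) :
    diamond A ξ = diamond (mProj b ξ A) ξ + (κ * ((q : ℝ) - (p : ℝ))) • ξ := by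
  obtain ⟨B, hB, h⟩ := exists_mSpace_of_isSkew he ξ hA
  -- `A - B` is the sum of an element of `𝔥` and a multiple of the identity, both orthogonal to `𝔪`.
  have hAB : mProj b ξ A = B := by
    refine mProj_eq he hB fun C hC => ?_
    rw [show A - B = (A - κ • ContinuousLinearMap.id ℝ (Model n) - B) +
      κ • ContinuousLinearMap.id ℝ (Model n) by abel, trPair_add_left, trPair_smul_left,
      he.trace_skew hC.1, trPair_comm, mul_zero, add_zero]
    exact hC.2 _ h
  rw [hAB]
  have h2 := h.2
  rw [diamond_sub_left, diamond_sub_left, diamond_smul_left, diamond_id] at h2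
  have h3 : diamond A ξ = diamond B ξ + κ • (((q : ℝ) - (p : ℝ)) • ξ) +
    (diamond A ξ - κ • (((q : ℝ) - (p : ℝ)) • ξ) - diamond B ξ) := by abel
  rw [h3, h2]
  module

section Equivariance

variable {L : EndT n} {κ l : ℝ} {ξ ξ' : Tensor n p q}

theorem isSkew_conjEnd (hL : L.IsInvertible) (hκ : κ ≠ 0)
    (hb : ∀ u v, b (L u) (L v) = κ * b' u v) {A : EndT n} (hA : IsSkew b A) :
    IsSkew b' (conjEnd L A) := by
  intro u v
  refine mul_left_cancel₀ hκ ?_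
  rw [mul_neg, ← hb, ← hb, apply_conjEnd hL, apply_conjEnd hL, hA]

theorem conjEnd_mem_hSpace (hL : L.IsInvertible) (hκ : κ ≠ 0)
    (hb : ∀ u v, b (L u) (L v) = κ * b' u v) (hξ : ξ' = l • Tensor.pullback L ξ)
    {A : EndT n} (hA : A ∈ hSpace b ξ) : conjEnd L A ∈ hSpace b' ξ' := by
  refine ⟨isSkew_conjEnd hL hκ hb hA.1, ?_⟩
  rw [hξ, diamond_smul_right, ← pullback_diamond hL (comp_conjEnd hL A), hA.2, pullback_zero]
  module

/-- A test element of the new `𝔥` is carried back by `L⁻¹`, which scales the form by `κ⁻¹` and the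
tensor by `l⁻¹`; the trace form is invariant under conjugation. The free constants `κ` and `l` let
the lemma cover homotheties and rescaled tensors. -/
theorem conjEnd_mem_mSpace (hL : L.IsInvertible) (hκ : κ ≠ 0) (hl : l ≠ 0)
    (hb : ∀ u v, b (L u) (L v) = κ * b' u v) (hξ : ξ' = l • Tensor.pullback L ξ)
    {A : EndT n} (hA : A ∈ mSpace b ξ) : conjEnd L A ∈ mSpace b' ξ' := by
  refine ⟨isSkew_conjEnd hL hκ hb hA.1, fun B hB => ?_⟩
  have hB' : conjEnd L.inverse B ∈ hSpace b ξ := by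
    refine conjEnd_mem_hSpace (κ := κ⁻¹) (l := l⁻¹) hL.inverse (inv_ne_zero hκ) (fun u v => ?_) ?_ hB
    · have := hb (L.inverse u) (L.inverse v)
      rw [hL.self_apply_inverse, hL.self_apply_inverse] at this
      rw [this]
      field_simp
    · rw [hξ, pullback_smul, pullback_inverse_pullback hL]
      rw [smul_smul, inv_mul_cancel₀ hl]
      exact (one_smul ℝ ξ).symm
  have h := hA.2 _ hB'
  change trPair _ _ = 0 at h
  rw [← trPair_conjEnd hL, conjEnd_conjEnd_inverse hL] at h
  exact h

end Equivariance

end Projections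

end HarmonicSoliton

end

noncomputable section

open scoped Manifold ContDiff Topology

namespace HarmonicSoliton

/-! ### Naturality of the Levi-Civita connection under homotheties, in coordinates -/

section LocalCalculus

variable {n p q : ℕ}

theorem two_le_infty : (2 : WithTop ℕ∞) ≤ ∞ := 
  WithTop.coe_le_coe.2 (le_top : (2 : ℕ∞) ≤ ⊤)

section Abstract

variable {E V W Z : Type*} [NormedAddCommGroup E] [NormedSpace ℝ E] [NormedAddCommGroup V]
  [NormedSpace ℝ V] [NormedAddCommGroup W] [NormedSpace ℝ W] [NormedAddCommGroup Z]
  [NormedSpace ℝ Z]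

theorem exists_hasFDerivAt_bilinear_comp {E' : Type*} [NormedAddCommGroup E'] [NormedSpace ℝ E']
    {G : E' → V →L[ℝ] W →L[ℝ] Z} {F : E → E'} {a : E → V} {b : E → W} {y : E}
    {F' : E →L[ℝ] E'} {a' : E →L[ℝ] V} {b' : E →L[ℝ] W}
    (hG : DifferentiableAt ℝ G (F y)) (hF : HasFDerivAt F F' y)
    (ha : HasFDerivAt a a' y) (hb : HasFDerivAt b b' y) :
    ∃ D : E →L[ℝ] Z, HasFDerivAt (fun z => G (F z) (a z) (b z)) D y ∧
      ∀ u, D u = fderiv ℝ G (F y) (F' u) (a y) (b y) + G (F y) (a' u) (b y) +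
        G (F y) (a y) (b' u) := by
  have h1 := HasFDerivAt.comp (g := G) y hG.hasFDerivAt hF
  refine ⟨_, (h1.clm_apply ha).clm_apply hb, fun u => ?_⟩
  simp
  abel

theorem hasDerivAt_comp_curve {η : E → W} {γ : ℝ → E} {γ' y : E} {s : ℝ} (hy : γ s = y)
    (hη : DifferentiableAt ℝ η y) (hγ : HasDerivAt γ γ' s) :
    HasDerivAt (fun s => η (γ s)) (fderiv ℝ η y γ') s := by
  subst hy
  exact hη.hasFDerivAt.comp_hasDerivAt s hγ

theorem exists_hasFDerivAt_linear {L : E → V →L[ℝ] W} {L' : E →L[ℝ] V →L[ℝ] W}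
    {a : E → V} {y : E} {a' : E →L[ℝ] V} (hL : HasFDerivAt L L' y)
    (ha : HasFDerivAt a a' y) :
    ∃ D : E →L[ℝ] W, HasFDerivAt (fun z => L z (a z)) D y ∧
      ∀ u, D u = L' u (a y) + L y (a' u) := by
  refine ⟨_, hL.clm_apply ha, fun u => ?_⟩
  simp
  abel

theorem exists_hasFDerivAt_comp_eval {S : E → V →L[ℝ] W} {y : E} (hS : DifferentiableAt ℝ S y)
    (v : V) : HasFDerivAt (fun z => S z v) ((fderiv ℝ S y).flip v) y := by
  refine (hS.hasFDerivAt.clm_apply (hasFDerivAt_const v y)).congr_fderiv ?_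
  ext u
  simp

theorem hasFDerivAt_eval₂ {S : E → V →L[ℝ] W →L[ℝ] Z} {y : E} (hS : DifferentiableAt ℝ S y)
    (v : V) (w : W) :
    HasFDerivAt (fun z => S z v w) (((fderiv ℝ S y).flip v).flip w) y := by
  refine ((hS.hasFDerivAt.clm_apply (hasFDerivAt_const v y)).clm_apply
    (hasFDerivAt_const w y)).congr_fderiv ?_
  ext u
  simp

end Abstract

/-- Bilinear forms on the model space. -/
abbrev Bil (n : ℕ) : Type := Model n →L[ℝ] Model n →L[ℝ] ℝ

/-- The Christoffel symbols of a metric given in coordinates. -/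
def christoffelOf (G : Model n → Bil n) (y u : Model n) : EndT n :=
  let D := fderiv ℝ G y
  (1 / 2 : ℝ) • (G y).inverse.comp (D u + D.flip u - (D.flip u).flip)

/-- A metric in coordinates near `y`. -/
structure IsMetricAt (G : Model n → Bil n) (y : Model n) : Prop where
  smooth : ContDiffAt ℝ ∞ G y
  inv : (G y).IsInvertible
  symm : ∀ᶠ z in 𝓝 y, ∀ a b, G z a b = G z b a

theorem IsMetricAt.differentiableAt {G : Model n → Bil n} {y : Model n} (h : IsMetricAt G y) :
    DifferentiableAt ℝ G y := h.smooth.differentiableAt (by simp)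

/-- `F` is a local diffeomorphism at `y` that multiplies the metric by `κ`. -/
structure IsHomothetyAt (κ : ℝ) (G G' : Model n → Bil n) (F : Model n → Model n)
    (y : Model n) : Prop where
  ne_zero : κ ≠ 0
  smooth : ContDiffAt ℝ ∞ F y
  inv : (fderiv ℝ F y).IsInvertible
  metric : ∀ᶠ z in 𝓝 y, ∀ a b, G' (F z) (fderiv ℝ F z a) (fderiv ℝ F z b) = κ * G z a b

/-- Koszul's formula for coordinate vector fields, whose brackets vanish. -/
theorem christoffelOf_spec {G : Model n → Bil n} {y : Model n} (hG : (G y).IsInvertible)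
    (u v w : Model n) :
    G y (christoffelOf G y u v) w =
      (1 / 2) * (fderiv ℝ G y u v w + fderiv ℝ G y v u w - fderiv ℝ G y w u v) := by
  simp only [christoffelOf, smul_apply, map_smul, smul_eq_mul, ContinuousLinearMap.comp_apply,
    hG.self_apply_inverse]
  rfl

theorem IsMetricAt.fderiv_symm {G : Model n → Bil n} {y : Model n} (h : IsMetricAt G y)
    (u a b : Model n) : fderiv ℝ G y u a b = fderiv ℝ G y u b a := by
  have h1 := hasFDerivAt_eval₂ h.differentiableAt a b
  have h2 := (hasFDerivAt_eval₂ h.differentiableAt b a).congr_of_eventuallyEq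
    (f₁ := fun z => G z a b) (by filter_upwards [h.symm] with z hz using hz a b)
  exact congrArg (fun T : Model n →L[ℝ] ℝ => T u) (h1.unique h2)

section Homothety

variable {κ : ℝ} {G G' : Model n → Bil n} {F : Model n → Model n} {y : Model n}

theorem IsHomothetyAt.hasFDerivAt_fderiv (h : IsHomothetyAt κ G G' F y) :
    HasFDerivAt (fderiv ℝ F) (fderiv ℝ (fderiv ℝ F) y) y :=
  ((h.smooth.fderiv_right (m := 1) (by simpa [one_add_one_eq_two] using two_le_infty)).differentiableAt (by simp)).hasFDerivAt

theorem IsHomothetyAt.hasFDerivAt (h : IsHomothetyAt κ G G' F y) :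
    HasFDerivAt F (fderiv ℝ F y) y :=
  (h.smooth.differentiableAt (by simp)).hasFDerivAt

theorem IsHomothetyAt.hasFDerivAt_eval (h : IsHomothetyAt κ G G' F y) (a : Model n) :
    HasFDerivAt (fun z => fderiv ℝ F z a) ((fderiv ℝ (fderiv ℝ F) y).flip a) y :=
  exists_hasFDerivAt_comp_eval h.hasFDerivAt_fderiv.differentiableAt a

theorem IsHomothetyAt.second_symm (h : IsHomothetyAt κ G G' F y) (u v : Model n) :
    fderiv ℝ (fderiv ℝ F) y u v = fderiv ℝ (fderiv ℝ F) y v u :=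
  (h.smooth.isSymmSndFDerivAt (by simpa using two_le_infty)).eq u v

theorem IsHomothetyAt.metric_self (h : IsHomothetyAt κ G G' F y) (a b : Model n) :
    G' (F y) (fderiv ℝ F y a) (fderiv ℝ F y b) = κ * G y a b := h.metric.self_of_nhds a b

theorem IsHomothetyAt.fderiv_metric (h : IsHomothetyAt κ G G' F y) (hG : IsMetricAt G y)
    (hG' : IsMetricAt G' (F y)) (u a b : Model n) :
    κ * fderiv ℝ G y u a b =
      fderiv ℝ G' (F y) (fderiv ℝ F y u) (fderiv ℝ F y a) (fderiv ℝ F y b) +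
        G' (F y) (fderiv ℝ (fderiv ℝ F) y u a) (fderiv ℝ F y b) +
        G' (F y) (fderiv ℝ F y a) (fderiv ℝ (fderiv ℝ F) y u b) := by
  have h1 := (hasFDerivAt_eval₂ hG.differentiableAt a b).const_mul κ
  obtain ⟨D, hD, hDu⟩ := exists_hasFDerivAt_bilinear_comp hG'.differentiableAt h.hasFDerivAt
    (h.hasFDerivAt_eval a) (h.hasFDerivAt_eval b)
  have h2 := hD.congr_of_eventuallyEq
    (f₁ := fun z => κ * G z a b) (by filter_upwards [h.metric] with z hz using (hz a b).symm)
  have h3 := congrArg (fun T : Model n →L[ℝ] ℝ => T u) (h1.unique h2)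
  exact h3.trans (hDu u)

/-- The transformation law of the Christoffel symbols. -/
theorem IsHomothetyAt.christoffelOf (h : IsHomothetyAt κ G G' F y) (hG : IsMetricAt G y)
    (hG' : IsMetricAt G' (F y)) (u v : Model n) :
    fderiv ℝ F y (christoffelOf G y u v) = fderiv ℝ (fderiv ℝ F) y u v +
      christoffelOf G' (F y) (fderiv ℝ F y u) (fderiv ℝ F y v) := by
  -- Both sides are paired with `DF w` in the metric `G'`. In the Koszul combination of the three
  -- derivatives of `F^* G' = κ G`, the symmetry of `D²F` and of `G'` leaves only twice the term
  -- with `D²F(u, v)`; the constant `κ` is the same on both sides.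
  refine hG'.inv.injective (ContinuousLinearMap.ext fun w' => ?_)
  obtain ⟨w, rfl⟩ := h.inv.surjective w'
  rw [h.metric_self, christoffelOf_spec hG.inv, map_add, add_apply, christoffelOf_spec hG'.inv]
  have s : ∀ a b, G' (F y) a b = G' (F y) b a := hG'.symm.self_of_nhds
  have e1 := h.fderiv_metric hG hG' u v w
  have e2 := h.fderiv_metric hG hG' v u w
  have e3 := h.fderiv_metric hG hG' w u v
  rw [h.second_symm v u] at e2
  rw [h.second_symm w u, h.second_symm w v] at e3
  rw [s (fderiv ℝ (fderiv ℝ F) y u w)] at e3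
  rw [s (fderiv ℝ F y u)] at e2
  rw [s (fderiv ℝ F y u)] at e3
  linear_combination (1 / 2) * (e1 + e2 - e3)

/-- Naturality of the covariant derivative of tensors. -/
theorem IsHomothetyAt.covDeriv (h : IsHomothetyAt κ G G' F y) (hG : IsMetricAt G y)
    (hG' : IsMetricAt G' (F y)) {ξ η : Model n → Tensor n p q}
    (hη : ContDiffAt ℝ ∞ η (F y))
    (hξ : ∀ᶠ z in 𝓝 y, ξ z = Tensor.pullback (fderiv ℝ F z) (η (F z))) (u : Model n) :
    fderiv ℝ ξ y u - diamond (HarmonicSoliton.christoffelOf G y u) (ξ y) =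
      Tensor.pullback (fderiv ℝ F y) (fderiv ℝ η (F y) (fderiv ℝ F y u) -
        diamond (HarmonicSoliton.christoffelOf G' (F y) (fderiv ℝ F y u)) (η (F y))) := by
  have hcurve : HasDerivAt (fun s : ℝ => y + s • u) u 0 := by
    simpa using ((hasDerivAt_id (0 : ℝ)).smul_const u).const_add y
  have hy : y + (0 : ℝ) • u = y := by simp
  have hL : HasDerivAt (fun s : ℝ => fderiv ℝ F (y + s • u)) (fderiv ℝ (fderiv ℝ F) y u) 0 :=
    hasDerivAt_comp_curve hy h.hasFDerivAt_fderiv.differentiableAt hcurve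
  have hF : HasDerivAt (fun s : ℝ => F (y + s • u)) (fderiv ℝ F y u) 0 :=
    hasDerivAt_comp_curve hy h.hasFDerivAt.differentiableAt hcurve
  have hη' : HasDerivAt (fun s : ℝ => η (F (y + s • u)))
      (fderiv ℝ η (F y) (fderiv ℝ F y u)) 0 :=
    hasDerivAt_comp_curve (by rw [hy]) (hη.differentiableAt (by simp)) hF
  have hsm : ContDiffAt ℝ ∞ (fun z => Tensor.pullback (fderiv ℝ F z) (η (F z))) y :=
    contDiffAt_pullback (h.smooth.fderiv_right (by simp)) h.inv (ContDiffAt.comp y hη h.smooth)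
  have hd : DifferentiableAt ℝ (fun z => Tensor.pullback (fderiv ℝ F z) (η (F z))) y :=
    hsm.differentiableAt (by simp)
  have h1 := hasDerivAt_comp_curve (W := Tensor n p q)
    (η := fun z => Tensor.pullback (fderiv ℝ F z) (η (F z))) hy hd hcurve
  have h2 := hasDerivAt_pullback hL (by rw [hy]; exact h.inv) hη' h1.differentiableAt
  have h3 := h1.unique h2
  rw [hy] at h3
  have hξ0 := hξ.self_of_nhds
  -- Differentiating the pull-back produces the action of `D²F(u) ∘ DF⁻¹`. By the transformation
  -- law, adding `Γ'` to it gives the conjugate of `Γ_u` by `DF`, so equivariance of the action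
  -- matches the Christoffel terms.
  rw [Filter.EventuallyEq.fderiv_eq (f := fun z => Tensor.pullback (fderiv ℝ F z) (η (F z))) hξ,
    h3, hξ0, ← pullback_diamond (A := (fderiv ℝ (fderiv ℝ F) y u).comp (fderiv ℝ F y).inverse +
      HarmonicSoliton.christoffelOf G' (F y) (fderiv ℝ F y u)) h.inv, ← pullback_sub,
    diamond_add_left]
  · congr 1
    abel
  · ext v
    simp [h.christoffelOf hG hG', h.inv.inverse_apply_self]

/-- Naturality of the covariant derivative of vector fields. -/
theorem IsHomothetyAt.nabla (h : IsHomothetyAt κ G G' F y) (hG : IsMetricAt G y)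
    (hG' : IsMetricAt G' (F y)) {X X' : Model n → Model n} (hX : DifferentiableAt ℝ X y)
    (hX' : DifferentiableAt ℝ X' (F y))
    (hXX' : ∀ᶠ z in 𝓝 y, fderiv ℝ F z (X z) = X' (F z)) (u : Model n) :
    fderiv ℝ F y (fderiv ℝ X y u + HarmonicSoliton.christoffelOf G y (X y) u) =
      fderiv ℝ X' (F y) (fderiv ℝ F y u) +
        HarmonicSoliton.christoffelOf G' (F y) (X' (F y)) (fderiv ℝ F y u) := by
  obtain ⟨D, h1, hD⟩ := exists_hasFDerivAt_linear h.hasFDerivAt_fderiv hX.hasFDerivAt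
  have h2 := (hX'.hasFDerivAt.comp y h.hasFDerivAt).congr_of_eventuallyEq
    (f₁ := fun z => fderiv ℝ F z (X z)) (by filter_upwards [hXX'] with z hz using hz)
  have h3 := (hD u).symm.trans (congrArg (fun T : EndT n => T u) (h1.unique h2))
  rw [ContinuousLinearMap.comp_apply] at h3
  rw [map_add, h.christoffelOf hG hG', hXX'.self_of_nhds, h.second_symm (X y) u, ← h3]
  abel

/-- Naturality of the covariant derivative of endomorphism-valued `1`-forms. -/
theorem IsHomothetyAt.covDerivEndForm (h : IsHomothetyAt κ G G' F y) (hG : IsMetricAt G y)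
    (hG' : IsMetricAt G' (F y)) {S S' : Model n → Model n →L[ℝ] EndT n}
    (hS : DifferentiableAt ℝ S y) (hS' : DifferentiableAt ℝ S' (F y))
    (hSS' : ∀ᶠ z in 𝓝 y, ∀ v w, fderiv ℝ F z (S z v w) =
      S' (F z) (fderiv ℝ F z v) (fderiv ℝ F z w)) (u v w : Model n) :
    fderiv ℝ F y (fderiv ℝ S y u v w + HarmonicSoliton.christoffelOf G y u (S y v w) -
        S y v (HarmonicSoliton.christoffelOf G y u w) -
        S y (HarmonicSoliton.christoffelOf G y u v) w) =
      fderiv ℝ S' (F y) (fderiv ℝ F y u) (fderiv ℝ F y v) (fderiv ℝ F y w) +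
        HarmonicSoliton.christoffelOf G' (F y) (fderiv ℝ F y u)
          (S' (F y) (fderiv ℝ F y v) (fderiv ℝ F y w)) -
        S' (F y) (fderiv ℝ F y v)
          (HarmonicSoliton.christoffelOf G' (F y) (fderiv ℝ F y u) (fderiv ℝ F y w)) -
        S' (F y) (HarmonicSoliton.christoffelOf G' (F y) (fderiv ℝ F y u) (fderiv ℝ F y v))
          (fderiv ℝ F y w) := by
  obtain ⟨D, h1, hD⟩ := exists_hasFDerivAt_linear h.hasFDerivAt_fderiv (hasFDerivAt_eval₂ hS v w)
  obtain ⟨D', h2, hD'⟩ := exists_hasFDerivAt_bilinear_comp hS' h.hasFDerivAt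
    (h.hasFDerivAt_eval v) (h.hasFDerivAt_eval w)
  have h2' := h2.congr_of_eventuallyEq (f₁ := fun z => fderiv ℝ F z (S z v w))
    (by filter_upwards [hSS'] with z hz using hz v w)
  have h3 := (hD u).symm.trans ((congrArg (fun T : EndT n => T u) (h1.unique h2')).trans (hD' u))
  simp only [ContinuousLinearMap.flip_apply] at h3
  have hs := hSS'.self_of_nhds
  simp only [map_add, map_sub, hs, h.christoffelOf hG hG', add_apply]
  rw [eq_sub_of_add_eq' h3]
  abel

end Homothety

end LocalCalculus

end HarmonicSoliton

end

noncomputable section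

open scoped Manifold ContDiff Topology
set_option linter.unusedSectionVars false

namespace HarmonicSoliton

/-! ### Coordinate frames and coordinate expressions on the manifold -/

section Charts

variable {n p q : ℕ} {M : Type*} [TopologicalSpace M] [ChartedSpace (Model n) M]

theorem target_mem_nhds {x₀ : M} {y : Model n} (hy : y ∈ (extChartAt 𝓘(ℝ, Model n) x₀).target) :
    (extChartAt 𝓘(ℝ, Model n) x₀).target ∈ 𝓝 y :=
  (isOpen_extChartAt_target x₀).mem_nhds hy

theorem isInvertible_of_comp_eq_id {A B : EndT n}
    (h : A.comp B = ContinuousLinearMap.id ℝ (Model n)) : A.IsInvertible := by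
  have h' : B.comp A = ContinuousLinearMap.id ℝ (Model n) := by
    have h1 : A.toLinearMap ∘ₗ B.toLinearMap = LinearMap.id :=
      LinearMap.ext fun v => congrArg (fun T : EndT n => T v) h
    have h2 := (LinearMap.comp_eq_id_comm ℝ (Model n)).1 h1
    exact ContinuousLinearMap.ext fun v => congrArg (fun T : Model n →ₗ[ℝ] Model n => T v) h2
  exact ⟨ContinuousLinearEquiv.equivOfInverse A B
    (fun v => congrArg (fun T : EndT n => T v) h')
    (fun v => congrArg (fun T : EndT n => T v) h), rfl⟩

variable [IsManifold 𝓘(ℝ, Model n) ∞ M]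

theorem contMDiffAt_chart_symm {x₀ : M} {y : Model n}
    (hy : y ∈ (extChartAt 𝓘(ℝ, Model n) x₀).target) :
    ContMDiffAt 𝓘(ℝ, Model n) 𝓘(ℝ, Model n) ∞ (extChartAt 𝓘(ℝ, Model n) x₀).symm y :=
  (contMDiffOn_extChartAt_symm x₀).contMDiffAt (target_mem_nhds hy)

theorem contMDiffAt_chart {x₀ x : M} (hx : x ∈ (extChartAt 𝓘(ℝ, Model n) x₀).source) :
    ContMDiffAt 𝓘(ℝ, Model n) 𝓘(ℝ, Model n) ∞ (extChartAt 𝓘(ℝ, Model n) x₀) x :=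
  contMDiffAt_extChartAt' (by simpa using hx)

theorem chartFrame_eq_mfderiv {x₀ : M} {y : Model n}
    (hy : y ∈ (extChartAt 𝓘(ℝ, Model n) x₀).target) :
    chartFrame x₀ y =
      mfderiv 𝓘(ℝ, Model n) 𝓘(ℝ, Model n) (extChartAt 𝓘(ℝ, Model n) x₀).symm y := by
  have h := (contMDiffAt_chart_symm hy).mdifferentiableAt (by simp)
  have h1 : chartFrame x₀ y = fderivWithin ℝ (writtenInExtChartAt 𝓘(ℝ, Model n) 𝓘(ℝ, Model n) y
      (extChartAt 𝓘(ℝ, Model n) x₀).symm) (Set.range 𝓘(ℝ, Model n))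
      (extChartAt 𝓘(ℝ, Model n) y y) := by
    simp only [writtenInExtChartAt, chartFrame, mfld_simps, fderivWithin_univ]
    rfl
  exact h1.trans h.mfderiv.symm

/-- The expression of `f` in the charts at `x₀` and `x₁`. -/
def chartRep (f : M → M) (x₀ x₁ : M) : Model n → Model n :=
  extChartAt 𝓘(ℝ, Model n) x₁ ∘ f ∘ (extChartAt 𝓘(ℝ, Model n) x₀).symm

theorem contDiffAt_chartRep {f : M → M} {x₀ x₁ : M} {y : Model n}
    (hy : y ∈ (extChartAt 𝓘(ℝ, Model n) x₀).target)
    (hf : ContMDiffAt 𝓘(ℝ, Model n) 𝓘(ℝ, Model n) ∞ f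
      ((extChartAt 𝓘(ℝ, Model n) x₀).symm y))
    (h : f ((extChartAt 𝓘(ℝ, Model n) x₀).symm y) ∈ (extChartAt 𝓘(ℝ, Model n) x₁).source) :
    ContDiffAt ℝ ∞ (chartRep (n := n) f x₀ x₁) y :=
  contMDiffAt_iff_contDiffAt.1
    ((contMDiffAt_chart h).comp y (hf.comp y (contMDiffAt_chart_symm hy)))

theorem chart_symm_chartRep {f : M → M} {x₀ x₁ : M} {y : Model n}
    (h : f ((extChartAt 𝓘(ℝ, Model n) x₀).symm y) ∈ (extChartAt 𝓘(ℝ, Model n) x₁).source) :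
    (extChartAt 𝓘(ℝ, Model n) x₁).symm (chartRep f x₀ x₁ y) =
      f ((extChartAt 𝓘(ℝ, Model n) x₀).symm y) :=
  (extChartAt 𝓘(ℝ, Model n) x₁).left_inv h

theorem chartRep_mem_target {f : M → M} {x₀ x₁ : M} {y : Model n}
    (h : f ((extChartAt 𝓘(ℝ, Model n) x₀).symm y) ∈ (extChartAt 𝓘(ℝ, Model n) x₁).source) :
    chartRep f x₀ x₁ y ∈ (extChartAt 𝓘(ℝ, Model n) x₁).target :=
  (extChartAt 𝓘(ℝ, Model n) x₁).map_source h

/-- The chain rule for the expression of a map in charts. -/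
theorem chartFrame_comp_fderiv {f : M → M} {x₀ x₁ : M} {y : Model n}
    (hy : y ∈ (extChartAt 𝓘(ℝ, Model n) x₀).target)
    (hf : ContMDiffAt 𝓘(ℝ, Model n) 𝓘(ℝ, Model n) ∞ f
      ((extChartAt 𝓘(ℝ, Model n) x₀).symm y))
    (h : f ((extChartAt 𝓘(ℝ, Model n) x₀).symm y) ∈ (extChartAt 𝓘(ℝ, Model n) x₁).source) :
    (chartFrame x₁ (chartRep f x₀ x₁ y)).comp (fderiv ℝ (chartRep f x₀ x₁) y) =
      ContinuousLinearMap.comp (mfderiv 𝓘(ℝ, Model n) 𝓘(ℝ, Model n) f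
        ((extChartAt 𝓘(ℝ, Model n) x₀).symm y) : EndT n) (chartFrame x₀ y) := by
  have hs := contMDiffAt_chart_symm hy
  have h1 : HasMFDerivAt 𝓘(ℝ, Model n) 𝓘(ℝ, Model n)
      (f ∘ (extChartAt 𝓘(ℝ, Model n) x₀).symm) y _ :=
    (hf.mdifferentiableAt (by simp)).hasMFDerivAt.comp y
      (hs.mdifferentiableAt (by simp)).hasMFDerivAt
  have hF : HasMFDerivAt 𝓘(ℝ, Model n) 𝓘(ℝ, Model n) (chartRep (n := n) f x₀ x₁) y _ :=
    (((contDiffAt_chartRep hy hf h).differentiableAt (by simp)).hasFDerivAt).hasMFDerivAt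
  have h2 : HasMFDerivAt 𝓘(ℝ, Model n) 𝓘(ℝ, Model n)
      ((extChartAt 𝓘(ℝ, Model n) x₁).symm ∘ chartRep f x₀ x₁) y _ :=
    ((contMDiffAt_chart_symm (chartRep_mem_target h)).mdifferentiableAt
      (by simp)).hasMFDerivAt.comp y hF
  have he : (f ∘ (extChartAt 𝓘(ℝ, Model n) x₀).symm) =ᶠ[𝓝 y]
      ((extChartAt 𝓘(ℝ, Model n) x₁).symm ∘ chartRep f x₀ x₁) := by
    have hc : ContinuousAt (f ∘ (extChartAt 𝓘(ℝ, Model n) x₀).symm) y := h1.continuousAt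
    filter_upwards [hc.preimage_mem_nhds
      ((isOpen_extChartAt_source (I := 𝓘(ℝ, Model n)) x₁).mem_nhds h)] with z hz
    exact (chart_symm_chartRep hz).symm
  have h3 := hasMFDerivAt_unique h1 (h2.congr_of_eventuallyEq he)
  rw [chartFrame_eq_mfderiv hy, chartFrame_eq_mfderiv (chartRep_mem_target h)]
  exact h3.symm

theorem chartFrame_self (x : M) :
    chartFrame x (extChartAt 𝓘(ℝ, Model n) x x) = ContinuousLinearMap.id ℝ (Model n) := by
  have he : (extChartAt 𝓘(ℝ, Model n) x) ∘ (extChartAt 𝓘(ℝ, Model n) x).symm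
      =ᶠ[𝓝 (extChartAt 𝓘(ℝ, Model n) x x)] id := by
    filter_upwards [target_mem_nhds (mem_extChartAt_target (I := 𝓘(ℝ, Model n)) x)] with z hz
    exact (extChartAt 𝓘(ℝ, Model n) x).right_inv hz
  rw [chartFrame, extChartAt_to_inv, he.fderiv_eq]
  exact fderiv_id

/-- The chain rule for the identity map, read from the preferred chart at `z` to the chart at `x₀`,
exhibits a right inverse, because the frame of a chart at its own base point is the identity. In
finite dimension this suffices. -/
theorem chartFrame_isInvertible {x₀ : M} {y : Model n}
    (hy : y ∈ (extChartAt 𝓘(ℝ, Model n) x₀).target) : (chartFrame x₀ y).IsInvertible := by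
  set z := (extChartAt 𝓘(ℝ, Model n) x₀).symm y with hz
  have hzs : z ∈ (extChartAt 𝓘(ℝ, Model n) x₀).source :=
    (extChartAt 𝓘(ℝ, Model n) x₀).map_target hy
  have hy' := mem_extChartAt_target (I := 𝓘(ℝ, Model n)) z
  have h := chartFrame_comp_fderiv (f := id) (x₀ := z) (x₁ := x₀) hy' contMDiffAt_id
    (by rw [extChartAt_to_inv]; exact hzs)
  have hr : chartRep (n := n) id z x₀ (extChartAt 𝓘(ℝ, Model n) z z) = y := by
    simp only [chartRep, Function.comp_apply, extChartAt_to_inv, id]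
    exact (extChartAt 𝓘(ℝ, Model n) x₀).right_inv hy
  rw [hr, chartFrame_self, mfderiv_id] at h
  exact isInvertible_of_comp_eq_id (h.trans (by rfl))

/-- The coordinate frame as a transition map of the tangent bundle. -/
theorem chartFrame_eq_symmL {x₀ : M} {y : Model n}
    (hy : y ∈ (extChartAt 𝓘(ℝ, Model n) x₀).target) :
    chartFrame x₀ y = (trivializationAt (Model n) (TangentSpace 𝓘(ℝ, Model n)) x₀).symmL ℝ
      ((extChartAt 𝓘(ℝ, Model n) x₀).symm y) := by
  have hzs := (extChartAt 𝓘(ℝ, Model n) x₀).map_target hy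
  rw [TangentBundle.symmL_trivializationAt_eq_core (by simpa using hzs),
    tangentBundleCore_coordChange_achart, (extChartAt 𝓘(ℝ, Model n) x₀).right_inv hy]
  simp [chartFrame]

theorem chart_symm_mem_baseSet {x₀ : M} {y : Model n}
    (hy : y ∈ (extChartAt 𝓘(ℝ, Model n) x₀).target) :
    (extChartAt 𝓘(ℝ, Model n) x₀).symm y ∈
      (trivializationAt (Model n) (TangentSpace 𝓘(ℝ, Model n)) x₀).baseSet := by
  have hzs := (extChartAt 𝓘(ℝ, Model n) x₀).map_target hy
  simpa using hzs

theorem trivialization_apply_chartFrame {x₀ : M} {y : Model n}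
    (hy : y ∈ (extChartAt 𝓘(ℝ, Model n) x₀).target) (a : Model n) :
    (trivializationAt (Model n) (TangentSpace 𝓘(ℝ, Model n)) x₀
      ⟨(extChartAt 𝓘(ℝ, Model n) x₀).symm y, chartFrame x₀ y a⟩).2 = a := by
  rw [chartFrame_eq_symmL hy]
  have h := (trivializationAt (Model n)
    (TangentSpace 𝓘(ℝ, Model n)) x₀).continuousLinearMapAt_symmL
    (R := ℝ) (chart_symm_mem_baseSet hy) a
  rw [Bundle.Trivialization.continuousLinearMapAt_apply, Bundle.Trivialization.linearMapAt_apply,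
    if_pos (chart_symm_mem_baseSet hy)] at h
  exact h

theorem chartFrame_inverse_apply {x₀ : M} {y : Model n}
    (hy : y ∈ (extChartAt 𝓘(ℝ, Model n) x₀).target) (v : Model n) :
    (chartFrame x₀ y).inverse v = (trivializationAt (Model n) (TangentSpace 𝓘(ℝ, Model n)) x₀
      ⟨(extChartAt 𝓘(ℝ, Model n) x₀).symm y, v⟩).2 := by
  have h := trivialization_apply_chartFrame hy ((chartFrame x₀ y).inverse v)
  have e := (chartFrame_isInvertible hy).self_apply_inverse (y := v)
  generalize chartFrame x₀ y ((chartFrame x₀ y).inverse v) = w at h e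
  subst e
  exact h.symm

theorem vectorInChart_eq {X : (x : M) → TangentSpace 𝓘(ℝ, Model n) x} {x₀ : M} {y : Model n}
    (hy : y ∈ (extChartAt 𝓘(ℝ, Model n) x₀).target) :
    vectorInChart X x₀ y = (trivializationAt (Model n) (TangentSpace 𝓘(ℝ, Model n)) x₀
      ⟨(extChartAt 𝓘(ℝ, Model n) x₀).symm y, X ((extChartAt 𝓘(ℝ, Model n) x₀).symm y)⟩).2 :=
  chartFrame_inverse_apply hy _

theorem contDiffAt_vectorInChart {X : (x : M) → TangentSpace 𝓘(ℝ, Model n) x}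
    (hX : SmoothVectorField X) {x₀ : M} {y : Model n}
    (hy : y ∈ (extChartAt 𝓘(ℝ, Model n) x₀).target) :
    ContDiffAt ℝ ∞ (vectorInChart X x₀) y := by
  have h1 := (((trivializationAt (Model n) (TangentSpace 𝓘(ℝ, Model n)) x₀).contMDiffAt_section_iff
    (IB := 𝓘(ℝ, Model n)) (n := ∞) (s := X) (chart_symm_mem_baseSet hy)).1 (hX _)).comp y
      (contMDiffAt_chart_symm hy)
  refine (contMDiffAt_iff_contDiffAt.1 h1).congr_of_eventuallyEq ?_
  filter_upwards [target_mem_nhds hy] with z hz using vectorInChart_eq hz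

theorem contMDiffAt_chartFrame_apply {x₀ : M} {y : Model n}
    (hy : y ∈ (extChartAt 𝓘(ℝ, Model n) x₀).target) (a : Model n) :
    ContMDiffAt 𝓘(ℝ, Model n) (𝓘(ℝ, Model n)).tangent ∞
      (fun z => (⟨(extChartAt 𝓘(ℝ, Model n) x₀).symm z, chartFrame x₀ z a⟩ :
        TangentBundle 𝓘(ℝ, Model n) M)) y := by
  refine ((trivializationAt (Model n) (TangentSpace 𝓘(ℝ, Model n)) x₀).contMDiffAt_iff
    (IB := 𝓘(ℝ, Model n)) ?_).2 ⟨contMDiffAt_chart_symm hy, ?_⟩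
  · rw [Bundle.Trivialization.mem_source]
    exact chart_symm_mem_baseSet hy
  · refine (contMDiffAt_const (c := a)).congr_of_eventuallyEq ?_
    filter_upwards [target_mem_nhds hy] with z hz using trivialization_apply_chartFrame hz a

theorem metricInChart_apply (g : RiemMetric n M) (x₀ : M) (y a b : Model n) :
    metricInChart g x₀ y a b = g.at ((extChartAt 𝓘(ℝ, Model n) x₀).symm y)
      (chartFrame x₀ y a) (chartFrame x₀ y b) := rfl

theorem contDiffAt_clm_of_apply {E V W : Type*} [NormedAddCommGroup E] [NormedSpace ℝ E]
    [NormedAddCommGroup V] [NormedSpace ℝ V] [FiniteDimensional ℝ V] [NormedAddCommGroup W]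
    [NormedSpace ℝ W] {k : WithTop ℕ∞} {f : E → V →L[ℝ] W} {y : E}
    (h : ∀ v, ContDiffAt ℝ k (fun z => f z v) y) : ContDiffAt ℝ k f y := by
  have hb : f = fun z => ∑ i, ((Module.finBasis ℝ V).coord i).toContinuousLinearMap.smulRight
      (f z (Module.finBasis ℝ V i)) := by
    funext z
    ext v
    conv_lhs => rw [← (Module.finBasis ℝ V).sum_repr v, map_sum]
    simp
  rw [hb]
  refine ContDiffAt.sum fun i _ => ?_
  exact ((ContinuousLinearMap.smulRightL ℝ V W
    ((Module.finBasis ℝ V).coord i).toContinuousLinearMap).contDiff.contDiffAt).comp y (h _)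

theorem contDiffAt_metricInChart (g : RiemMetric n M) {x₀ : M} {y : Model n}
    (hy : y ∈ (extChartAt 𝓘(ℝ, Model n) x₀).target) :
    ContDiffAt ℝ ∞ (metricInChart g x₀) y := by
  -- The components of the metric are its values on the coordinate frame fields, which are smooth
  -- sections of the tangent bundle.
  refine contDiffAt_clm_of_apply fun a => contDiffAt_clm_of_apply fun b => ?_
  have hg := (g.contMDiff ((extChartAt 𝓘(ℝ, Model n) x₀).symm y)).comp y
    (contMDiffAt_chart_symm hy)
  have h1 := ContMDiffAt.clm_bundle_apply₂ (F₁ := Model n) (F₂ := Model n) (F₃ := ℝ)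
    (E₁ := fun x : M => TangentSpace 𝓘(ℝ, Model n) x)
    (E₂ := fun x : M => TangentSpace 𝓘(ℝ, Model n) x) (E₃ := Bundle.Trivial M ℝ)
    (IB := 𝓘(ℝ, Model n)) (b := (extChartAt 𝓘(ℝ, Model n) x₀).symm)
    (ψ := fun z => g.inner ((extChartAt 𝓘(ℝ, Model n) x₀).symm z)) hg
    (contMDiffAt_chartFrame_apply hy a) (contMDiffAt_chartFrame_apply hy b)
  have h2 := (Bundle.contMDiffAt_totalSpace.1 h1).2
  exact contMDiffAt_iff_contDiffAt.1 h2

end Charts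

end HarmonicSoliton

end

noncomputable section

open scoped Manifold ContDiff Topology
set_option linter.unusedSectionVars false

namespace HarmonicSoliton

/-! ### Naturality of covariant derivatives on the manifold -/

section Naturality

variable {n p q : ℕ} {M : Type*} [TopologicalSpace M] [ChartedSpace (Model n) M]
  [IsManifold 𝓘(ℝ, Model n) ∞ M]

/-- The differential of `f` at `x`, as an endomorphism of the model space. -/
def dMap (n : ℕ) {M : Type*} [TopologicalSpace M] [ChartedSpace (Model n) M] (f : M → M) (x : M) :
    EndT n :=
  mfderiv 𝓘(ℝ, Model n) 𝓘(ℝ, Model n) f x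

theorem dMap_id (x : M) : dMap n id x = ContinuousLinearMap.id ℝ (Model n) :=
  mfderiv_id

theorem pullbackField_eq (f : M → M) (ξ : M → Tensor n p q) (x : M) :
    pullbackField f ξ x = Tensor.pullback (dMap n f x) (ξ (f x)) := rfl

theorem RiemMetric.at_symm (g : RiemMetric n M) (x : M) (u v : Model n) :
    g.at x u v = g.at x v u := g.symm x u v

theorem RiemMetric.at_pos (g : RiemMetric n M) (x : M) {u : Model n} (hu : u ≠ 0) :
    0 < g.at x u u := g.pos x u hu

theorem isInvertible_of_pos {b : Bil n} (hb : ∀ u, u ≠ 0 → 0 < b u u) : b.IsInvertible := by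
  have hinj : Function.Injective b.toLinearMap := by
    refine (injective_iff_map_eq_zero _).2 fun u hu => ?_
    by_contra h
    have h1 := hb u h
    have h2 : b u = 0 := hu
    rw [h2] at h1
    simp at h1
  have hfin : Module.finrank ℝ (Model n) = Module.finrank ℝ (Model n →L[ℝ] ℝ) := by
    rw [← (LinearMap.toContinuousLinearMap (𝕜 := ℝ) (E := Model n) (F' := ℝ)).finrank_eq]
    exact (Subspace.dual_finrank_eq (K := ℝ) (V := Model n)).symm
  exact ⟨(LinearEquiv.ofInjectiveOfFinrankEq b.toLinearMap hinj hfin).toContinuousLinearEquiv, rfl⟩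

theorem RiemMetric.at_isInvertible (g : RiemMetric n M) (x : M) : (g.at x).IsInvertible :=
  isInvertible_of_pos fun _ hu => g.at_pos x hu

theorem metricInChart_pos (g : RiemMetric n M) {x₀ : M} {y : Model n}
    (hy : y ∈ (extChartAt 𝓘(ℝ, Model n) x₀).target) {u : Model n} (hu : u ≠ 0) :
    0 < metricInChart g x₀ y u u := by
  refine g.at_pos _ fun h => hu ?_
  exact (chartFrame_isInvertible hy).injective (h.trans (map_zero (chartFrame x₀ y)).symm)

theorem isMetricAt_metricInChart (g : RiemMetric n M) {x₀ : M} {y : Model n}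
    (hy : y ∈ (extChartAt 𝓘(ℝ, Model n) x₀).target) : IsMetricAt (metricInChart g x₀) y where
  smooth := contDiffAt_metricInChart g hy
  inv := isInvertible_of_pos fun _ hu => metricInChart_pos g hy hu
  symm := Filter.Eventually.of_forall fun _ _ _ => g.at_symm _ _ _

theorem metricInChart_self (g : RiemMetric n M) (x : M) :
    metricInChart g x (extChartAt 𝓘(ℝ, Model n) x x) = g.at x := by
  refine ContinuousLinearMap.ext fun u => ContinuousLinearMap.ext fun v => ?_
  rw [metricInChart_apply, chartFrame_self, extChartAt_to_inv]
  rfl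

theorem tensorInChart_self (ξ : M → Tensor n p q) (x : M) :
    tensorInChart ξ x (extChartAt 𝓘(ℝ, Model n) x x) = ξ x := by
  rw [tensorInChart, chartFrame_self, extChartAt_to_inv, pullback_id]

theorem vectorInChart_self (X : (x : M) → TangentSpace 𝓘(ℝ, Model n) x) (x : M) :
    vectorInChart X x (extChartAt 𝓘(ℝ, Model n) x x) = X x := by
  rw [vectorInChart, chartFrame_self, extChartAt_to_inv, ContinuousLinearMap.inverse_id]
  rfl

theorem endFormInChart_apply (S : M → Model n →L[ℝ] EndT n) (x₀ : M) (y u v : Model n) :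
    endFormInChart S x₀ y u v = (chartFrame x₀ y).inverse
      (S ((extChartAt 𝓘(ℝ, Model n) x₀).symm y) (chartFrame x₀ y u) (chartFrame x₀ y v)) := rfl

theorem endFormInChart_self (S : M → Model n →L[ℝ] EndT n) (x : M) :
    endFormInChart S x (extChartAt 𝓘(ℝ, Model n) x x) = S x := by
  refine ContinuousLinearMap.ext fun u => ContinuousLinearMap.ext fun v => ?_
  rw [endFormInChart_apply, chartFrame_self, extChartAt_to_inv, ContinuousLinearMap.inverse_id]
  rfl

theorem SmoothTensorField.contDiffAt {ξ : M → Tensor n p q} (hξ : SmoothTensorField ξ) {x₀ : M}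
    {y : Model n} (hy : y ∈ (extChartAt 𝓘(ℝ, Model n) x₀).target) :
    ContDiffAt ℝ ∞ (tensorInChart ξ x₀) y :=
  (hξ x₀).contDiffAt (target_mem_nhds hy)

/-- `f` is a smooth map with invertible differential and `f^* g = κ g`. -/
structure IsHomothety (g : RiemMetric n M) (κ : ℝ) (f : M → M) : Prop where
  ne_zero : κ ≠ 0
  smooth : ContMDiff 𝓘(ℝ, Model n) 𝓘(ℝ, Model n) ∞ f
  inv : ∀ x, (dMap n f x).IsInvertible
  metric : ∀ (x : M) (u v : Model n),
    g.at (f x) ((dMap n f x) u)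
      ((dMap n f x) v) = κ * g.at x u v

theorem isHomothety_id (g : RiemMetric n M) : IsHomothety g 1 id where
  ne_zero := one_ne_zero
  smooth := contMDiff_id
  inv x := by
    rw [dMap_id]
    exact ContinuousLinearMap.isInvertible_equiv (f := ContinuousLinearEquiv.refl ℝ (Model n))
  metric x u v := by
    rw [dMap_id, one_mul]
    rfl

/-- Points of the chart at `x₀` that `f` maps to the chart at `x₁`. -/
structure ChartPair (f : M → M) (x₀ x₁ : M) (y : Model n) : Prop where
  mem : y ∈ (extChartAt 𝓘(ℝ, Model n) x₀).target
  map_mem : f ((extChartAt 𝓘(ℝ, Model n) x₀).symm y) ∈ (extChartAt 𝓘(ℝ, Model n) x₁).source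

theorem chartPair_self (f : M → M) (x : M) :
    ChartPair (n := n) f x (f x) (extChartAt 𝓘(ℝ, Model n) x x) where
  mem := mem_extChartAt_target x
  map_mem := by rw [extChartAt_to_inv]; exact mem_extChartAt_source (f x)

theorem chartPair_id {x₀ : M} {y : Model n} (hy : y ∈ (extChartAt 𝓘(ℝ, Model n) x₀).target) :
    ChartPair id x₀ ((extChartAt 𝓘(ℝ, Model n) x₀).symm y) y where
  mem := hy
  map_mem := mem_extChartAt_source _

theorem chartRep_self (f : M → M) (x : M) :
    chartRep (n := n) f x (f x) (extChartAt 𝓘(ℝ, Model n) x x) =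
      extChartAt 𝓘(ℝ, Model n) (f x) (f x) := by
  simp only [chartRep, Function.comp_apply, extChartAt_to_inv]

/-- Exhibits a change of chart as the case `f = id` of a map read in charts, so that independence of
the chart is an instance of naturality. -/
theorem fderiv_chartRep_id (x₀ : M) (y : Model n) :
    fderiv ℝ (chartRep id x₀ ((extChartAt 𝓘(ℝ, Model n) x₀).symm y)) y = chartFrame x₀ y := rfl

theorem chartRep_id (x₀ : M) (y : Model n) :
    chartRep id x₀ ((extChartAt 𝓘(ℝ, Model n) x₀).symm y) y =
      extChartAt 𝓘(ℝ, Model n) ((extChartAt 𝓘(ℝ, Model n) x₀).symm y)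
        ((extChartAt 𝓘(ℝ, Model n) x₀).symm y) := rfl

variable {f : M → M} {x₀ x₁ : M} {y : Model n}

theorem ChartPair.eventually (h : ChartPair f x₀ x₁ y)
    (hf : ContMDiff 𝓘(ℝ, Model n) 𝓘(ℝ, Model n) ∞ f) :
    ∀ᶠ z in 𝓝 y, ChartPair f x₀ x₁ z := by
  have hc : ContinuousAt (f ∘ (extChartAt 𝓘(ℝ, Model n) x₀).symm) y :=
    hf.continuous.continuousAt.comp (contMDiffAt_chart_symm h.mem).continuousAt
  filter_upwards [target_mem_nhds h.mem, hc.preimage_mem_nhds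
    ((isOpen_extChartAt_source (I := 𝓘(ℝ, Model n)) x₁).mem_nhds h.map_mem)] with z h1 h2
  exact ⟨h1, h2⟩

theorem ChartPair.target (h : ChartPair f x₀ x₁ y) :
    chartRep f x₀ x₁ y ∈ (extChartAt 𝓘(ℝ, Model n) x₁).target := chartRep_mem_target h.map_mem

theorem ChartPair.chain (h : ChartPair f x₀ x₁ y)
    (hf : ContMDiff 𝓘(ℝ, Model n) 𝓘(ℝ, Model n) ∞ f) :
    (chartFrame x₁ (chartRep f x₀ x₁ y)).comp (fderiv ℝ (chartRep f x₀ x₁) y) =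
      (dMap n f ((extChartAt 𝓘(ℝ, Model n) x₀).symm y)).comp (chartFrame x₀ y) :=
  chartFrame_comp_fderiv h.mem (hf _) h.map_mem

theorem ChartPair.chain_apply (h : ChartPair f x₀ x₁ y)
    (hf : ContMDiff 𝓘(ℝ, Model n) 𝓘(ℝ, Model n) ∞ f) (u : Model n) :
    chartFrame x₁ (chartRep f x₀ x₁ y) (fderiv ℝ (chartRep f x₀ x₁) y u) =
      (dMap n f ((extChartAt 𝓘(ℝ, Model n) x₀).symm y)) (chartFrame x₀ y u) :=
  congrArg (fun T : EndT n => T u) (h.chain hf)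

theorem fderiv_chartRep_self (hf : ContMDiff 𝓘(ℝ, Model n) 𝓘(ℝ, Model n) ∞ f) (x : M) :
    fderiv ℝ (chartRep f x (f x)) (extChartAt 𝓘(ℝ, Model n) x x) =
      dMap n f x := by
  have h := (chartPair_self f x).chain hf
  rw [chartRep_self, chartFrame_self, chartFrame_self, extChartAt_to_inv] at h
  exact h

theorem ChartPair.isInvertible (h : ChartPair f x₀ x₁ y)
    (hf : ContMDiff 𝓘(ℝ, Model n) 𝓘(ℝ, Model n) ∞ f)
    (hi : (dMap n f ((extChartAt 𝓘(ℝ, Model n) x₀).symm y)).IsInvertible) :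
    (fderiv ℝ (chartRep f x₀ x₁) y).IsInvertible := by
  have h1 := chartFrame_isInvertible h.mem
  have h2 := chartFrame_isInvertible h.target
  have h3 : fderiv ℝ (chartRep f x₀ x₁) y = (chartFrame x₁ (chartRep f x₀ x₁ y)).inverse.comp
      ((dMap n f ((extChartAt 𝓘(ℝ, Model n) x₀).symm y)).comp (chartFrame x₀ y)) := by
    rw [← h.chain hf]
    ext u
    simp [h2.inverse_apply_self]
  rw [h3]
  exact h2.inverse.comp (hi.comp h1)

theorem ChartPair.isHomothetyAt {g : RiemMetric n M} {κ : ℝ} (h : ChartPair f x₀ x₁ y)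
    (hf : IsHomothety g κ f) :
    IsHomothetyAt κ (metricInChart g x₀) (metricInChart g x₁) (chartRep f x₀ x₁) y where
  ne_zero := hf.ne_zero
  smooth := contDiffAt_chartRep h.mem (hf.smooth _) h.map_mem
  inv := h.isInvertible hf.smooth (hf.inv _)
  metric := by
    filter_upwards [h.eventually hf.smooth] with z hz a b
    rw [metricInChart_apply, metricInChart_apply, hz.chain_apply hf.smooth,
      hz.chain_apply hf.smooth, chart_symm_chartRep hz.map_mem, hf.metric]

theorem ChartPair.tensorInChart_pullbackField (h : ChartPair f x₀ x₁ y)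
    (hf : ContMDiff 𝓘(ℝ, Model n) 𝓘(ℝ, Model n) ∞ f)
    (hi : (dMap n f ((extChartAt 𝓘(ℝ, Model n) x₀).symm y)).IsInvertible) (ξ : M → Tensor n p q) :
    tensorInChart (pullbackField f ξ) x₀ y =
      Tensor.pullback (fderiv ℝ (chartRep f x₀ x₁) y)
        (tensorInChart ξ x₁ (chartRep f x₀ x₁ y)) := by
  rw [tensorInChart, tensorInChart, pullbackField_eq, chart_symm_chartRep h.map_mem,
    ← pullback_comp hi, ← pullback_comp (chartFrame_isInvertible h.target), h.chain hf]

theorem pullbackField_id (ξ : M → Tensor n p q) : pullbackField (n := n) id ξ = ξ := by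
  funext x
  rw [pullbackField_eq, dMap_id]
  exact pullback_id _

theorem covDeriv_eq (g : RiemMetric n M) (ξ : M → Tensor n p q) (x : M) (u : Model n) :
    covDeriv g ξ x u = fderiv ℝ (tensorInChart ξ x) (extChartAt 𝓘(ℝ, Model n) x x) u -
      diamond (christoffel g x (extChartAt 𝓘(ℝ, Model n) x x) u) (ξ x) := rfl

theorem ChartPair.covDeriv {g : RiemMetric n M} {κ : ℝ} (h : ChartPair f x₀ x₁ y)
    (hf : IsHomothety g κ f) {ξ : M → Tensor n p q} (hξ : SmoothTensorField ξ) (u : Model n) :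
    fderiv ℝ (tensorInChart (pullbackField f ξ) x₀) y u -
        diamond (christoffel g x₀ y u) (tensorInChart (pullbackField f ξ) x₀ y) =
      Tensor.pullback (fderiv ℝ (chartRep f x₀ x₁) y)
        (fderiv ℝ (tensorInChart ξ x₁) (chartRep f x₀ x₁ y) (fderiv ℝ (chartRep f x₀ x₁) y u) -
          diamond (christoffel g x₁ (chartRep f x₀ x₁ y) (fderiv ℝ (chartRep f x₀ x₁) y u))
            (tensorInChart ξ x₁ (chartRep f x₀ x₁ y))) := by
  refine (h.isHomothetyAt hf).covDeriv (isMetricAt_metricInChart g h.mem)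
    (isMetricAt_metricInChart g h.target) (hξ.contDiffAt h.target) ?_ u
  filter_upwards [h.eventually hf.smooth] with z hz
  exact hz.tensorInChart_pullbackField hf.smooth (hf.inv _) ξ

theorem covDeriv_pullbackField {g : RiemMetric n M} {κ : ℝ} (hf : IsHomothety g κ f)
    {ξ : M → Tensor n p q} (hξ : SmoothTensorField ξ) (x : M) (u : Model n) :
    covDeriv g (pullbackField f ξ) x u =
      Tensor.pullback (dMap n f x)
        (covDeriv g ξ (f x) ((dMap n f x) u)) := by
  have h := (chartPair_self f x).covDeriv hf hξ u
  rw [chartRep_self, fderiv_chartRep_self hf.smooth, tensorInChart_self, tensorInChart_self] at h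
  exact h

/-- `covDeriv` uses a different chart at each point. Naturality under the identity, a homothety with
factor `1`, shows that one fixed chart computes it at all of its points, as is needed to
differentiate the torsion. -/
theorem covDeriv_inChart {g : RiemMetric n M} {ξ : M → Tensor n p q} (hξ : SmoothTensorField ξ)
    (hy : y ∈ (extChartAt 𝓘(ℝ, Model n) x₀).target) (u : Model n) :
    fderiv ℝ (tensorInChart ξ x₀) y u -
        diamond (christoffel g x₀ y u) (tensorInChart ξ x₀ y) =
      Tensor.pullback (chartFrame x₀ y) (HarmonicSoliton.covDeriv g ξ
        ((extChartAt 𝓘(ℝ, Model n) x₀).symm y) (chartFrame x₀ y u)) := by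
  have h := (chartPair_id hy).covDeriv (isHomothety_id g) hξ u
  rw [pullbackField_id, chartRep_id, fderiv_chartRep_id, tensorInChart_self] at h
  exact h

theorem covDeriv_smul (g : RiemMetric n M) (l : ℝ) {ξ : M → Tensor n p q}
    (hξ : SmoothTensorField ξ) (x : M) (u : Model n) :
    covDeriv g (fun x => l • ξ x) x u = l • covDeriv g ξ x u := by
  have h1 : tensorInChart (fun x => l • ξ x) x = fun y => l • tensorInChart ξ x y := by
    funext y
    exact pullback_smul _ _ _
  have h2 := (hξ.contDiffAt (mem_extChartAt_target x)).differentiableAt (by simp)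
  have h3 : fderiv ℝ (fun y => l • tensorInChart ξ x y) (extChartAt 𝓘(ℝ, Model n) x x) u =
      l • fderiv ℝ (tensorInChart ξ x) (extChartAt 𝓘(ℝ, Model n) x x) u :=
    congrArg (fun T : Model n →L[ℝ] Tensor n p q => T u) (h2.hasFDerivAt.const_smul l).fderiv
  rw [covDeriv_eq, covDeriv_eq, h1, h3, diamond_smul_right]
  module

theorem nabla_comp {g : RiemMetric n M} {κ : ℝ} (hf : IsHomothety g κ f)
    {X : (x : M) → TangentSpace 𝓘(ℝ, Model n) x} (hX : SmoothVectorField X)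
    (hfX : ∀ x, (dMap n f x) (X x) = X (f x))
    (x : M) (u : Model n) :
    (dMap n f x) (nabla g X x u) =
      nabla g X (f x) ((dMap n f x) u) := by
  have hp := chartPair_self (n := n) f x
  have h := (hp.isHomothetyAt hf).nabla (isMetricAt_metricInChart g hp.mem)
    (isMetricAt_metricInChart g hp.target)
    ((contDiffAt_vectorInChart hX hp.mem).differentiableAt (by simp))
    ((contDiffAt_vectorInChart hX hp.target).differentiableAt (by simp)) ?_ u
  · rw [chartRep_self, fderiv_chartRep_self hf.smooth, vectorInChart_self,
      vectorInChart_self] at h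
    exact h
  · filter_upwards [hp.eventually hf.smooth] with z hz
    refine (chartFrame_isInvertible hz.target).injective ?_
    rw [hz.chain_apply hf.smooth, vectorInChart, vectorInChart]
    refine (congrArg _ ((chartFrame_isInvertible hz.mem).self_apply_inverse _)).trans ?_
    refine (hfX _).trans (Eq.trans ?_
      ((chartFrame_isInvertible hz.target).self_apply_inverse _).symm)
    rw [chart_symm_chartRep hz.map_mem]

theorem covDerivEndForm_comp {g : RiemMetric n M} {κ : ℝ} (hf : IsHomothety g κ f)
    {S S' : M → Model n →L[ℝ] EndT n}
    (hS : ∀ x, DifferentiableAt ℝ (endFormInChart S x) (extChartAt 𝓘(ℝ, Model n) x x))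
    (hS' : ∀ x, DifferentiableAt ℝ (endFormInChart S' x) (extChartAt 𝓘(ℝ, Model n) x x))
    (hSS' : ∀ (x : M) (v w : Model n),
      (dMap n f x) (S x v w) =
        S' (f x) ((dMap n f x) v)
          ((dMap n f x) w)) (x : M) (u v w : Model n) :
    (dMap n f x) (covDerivEndForm g S x u v w) =
      covDerivEndForm g S' (f x) ((dMap n f x) u)
        ((dMap n f x) v)
        ((dMap n f x) w) := by
  have hp := chartPair_self (n := n) f x
  have h := (hp.isHomothetyAt hf).covDerivEndForm (isMetricAt_metricInChart g hp.mem)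
    (isMetricAt_metricInChart g hp.target) (hS x) (by rw [chartRep_self]; exact hS' (f x)) ?_ u v w
  · rw [chartRep_self, fderiv_chartRep_self hf.smooth, endFormInChart_self,
      endFormInChart_self] at h
    exact h
  · filter_upwards [hp.eventually hf.smooth] with z hz v w
    refine (chartFrame_isInvertible hz.target).injective ?_
    rw [hz.chain_apply hf.smooth, endFormInChart_apply, endFormInChart_apply,
      (chartFrame_isInvertible hz.mem).self_apply_inverse,
      (chartFrame_isInvertible hz.target).self_apply_inverse, hz.chain_apply hf.smooth,
      hz.chain_apply hf.smooth, hSS', chart_symm_chartRep hz.map_mem]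

end Naturality

end HarmonicSoliton

end

noncomputable section

open scoped Manifold ContDiff Topology
set_option linter.unusedSectionVars false

namespace HarmonicSoliton

/-! ### Difference quotients along orbits of a linear action -/

section AbstractTangent

open Filter

variable {V : Type*} [NormedAddCommGroup V] [NormedSpace ℝ V]

/-- The error is relative to the approximating vector `w`, so it survives division by `s k`, and no
relation between `w` and `s k` has to be known. -/
theorem mem_of_tendsto_slope {W : Submodule ℝ V} (hW : IsClosed (W : Set V)) {d : ℕ → V}
    {s : ℕ → ℝ} {D : V} (h : Tendsto (fun k => (s k)⁻¹ • d k) atTop (𝓝 D))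
    (hd : ∀ ε > 0, ∀ᶠ k in atTop, ∃ w ∈ W, ‖d k - w‖ ≤ ε * ‖w‖) : D ∈ W := by
  rw [← SetLike.mem_coe, ← hW.closure_eq, Metric.mem_closure_iff]
  intro ε hε
  set N := ‖D‖ + 1 with hN
  have hNpos : 0 < N := by positivity
  -- The bound `1/2` gives `‖w'‖ ≤ 2 N`; then `ε' ‖w'‖ ≤ ε / 4`, to which the distance from `D` adds
  -- less than `ε / 2`.
  set ε' := min (1 / 2) (ε / (8 * N)) with hε'
  have hε'0 : 0 < ε' := by positivity
  have h1 : ε' ≤ 1 / 2 := min_le_left _ _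
  have h2 : ε' * N ≤ ε / 8 := by
    have := min_le_right (1 / 2) (ε / (8 * N))
    rw [le_div_iff₀ (by positivity)] at this
    linarith
  have hclose : ∀ᶠ k in atTop, ‖(s k)⁻¹ • d k - D‖ < min 1 (ε / 2) := by
    have := (Metric.tendsto_nhds.1 h) (min 1 (ε / 2)) (by positivity)
    simpa only [dist_eq_norm] using this
  obtain ⟨k, hk, w, hw, hkw⟩ := (hclose.and (hd ε' hε'0)).exists
  refine ⟨(s k)⁻¹ • w, W.smul_mem _ hw, ?_⟩
  set x := (s k)⁻¹ • d k
  set w' := (s k)⁻¹ • w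
  have h3 : ‖x - w'‖ ≤ ε' * ‖w'‖ := by
    rw [show x - w' = (s k)⁻¹ • (d k - w) by simp only [x, w', smul_sub], norm_smul,
      show ‖w'‖ = ‖(s k)⁻¹‖ * ‖w‖ from norm_smul _ _]
    nlinarith [norm_nonneg (s k)⁻¹]
  have h4 : ‖x‖ ≤ N := by
    have : ‖x‖ ≤ ‖x - D‖ + ‖D‖ := by simpa using norm_add_le (x - D) D
    have := lt_of_lt_of_le hk (min_le_left _ _)
    linarith
  have h5 : ‖w'‖ ≤ 2 * N := by
    have : ‖w'‖ ≤ ‖x‖ + ‖x - w'‖ := by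
      simpa [norm_sub_rev] using norm_sub_le x (x - w')
    nlinarith [norm_nonneg w']
  have h6 : ‖D - w'‖ ≤ ‖x - D‖ + ‖x - w'‖ := by
    have := norm_sub_le (x - w') (x - D)
    rw [show x - w' - (x - D) = D - w' by abel] at this
    linarith
  rw [dist_eq_norm]
  have h7 := lt_of_lt_of_le hk (min_le_right _ _)
  nlinarith [norm_nonneg w']

/-- Working in the product, with the range of `(w, w')`, yields one `A` for both limits. The range
is closed because `Z` has finite dimension. -/
theorem exists_eq_of_tendsto_slope {Z V' : Type*} [AddCommGroup Z] [Module ℝ Z]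
    [FiniteDimensional ℝ Z] [NormedAddCommGroup V'] [NormedSpace ℝ V'] (w : Z →ₗ[ℝ] V)
    (w' : Z →ₗ[ℝ] V') {d : ℕ → V} {d' : ℕ → V'} {s : ℕ → ℝ} {D : V} {D' : V'}
    (h : Tendsto (fun k => (s k)⁻¹ • d k) atTop (𝓝 D))
    (h' : Tendsto (fun k => (s k)⁻¹ • d' k) atTop (𝓝 D'))
    (hd : ∀ ε > 0, ∀ᶠ k in atTop, ∃ A, ‖d k - w A‖ ≤ ε * ‖w A‖ ∧ ‖d' k - w' A‖ ≤ ε * ‖w' A‖) :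
    ∃ A, D = w A ∧ D' = w' A := by
  have hmem : (D, D') ∈ LinearMap.range (w.prod w') := by
    refine mem_of_tendsto_slope (d := fun k => (d k, d' k)) (s := s)
      (Submodule.closed_of_finiteDimensional _) ?_ fun ε hε => ?_
    · exact h.prodMk_nhds h'
    · filter_upwards [hd ε hε] with k hk
      obtain ⟨A, h1, h2⟩ := hk
      refine ⟨(w A, w' A), ⟨A, rfl⟩, ?_⟩
      rw [Prod.mk_sub_mk, Prod.norm_mk, Prod.norm_mk, mul_max_of_nonneg _ _ hε.le]
      exact max_le_max h1 h2
  obtain ⟨A, hA⟩ := hmem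
  exact ⟨A, (congrArg Prod.fst hA).symm, (congrArg Prod.snd hA).symm⟩

/-- Differentiability at `(e, 0)` gives a Lipschitz bound nearby, and homogeneity in `w` spreads it
from the sphere of radius `r / 2` to all vectors. -/
theorem eventually_norm_action_sub_le {E : Type*} [NormedAddCommGroup E] [NormedSpace ℝ E]
    {P : E → V → V} {e : E} (hP : ContDiffAt ℝ 1 (fun z : E × V => P z.1 z.2) (e, 0))
    (hsmul : ∀ L (a : ℝ) w, P L (a • w) = a • P L w) (hone : ∀ w, P e w = w) {ε : ℝ}
    (hε : 0 < ε) : ∀ᶠ L in 𝓝 e, ∀ w, ‖P L w - w‖ ≤ ε * ‖w‖ := by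
  obtain ⟨K, t, ht, hK⟩ := hP.exists_lipschitzOnWith
  obtain ⟨r, hr, hrt⟩ := Metric.mem_nhds_iff.1 ht
  filter_upwards [Metric.ball_mem_nhds e (show 0 < min r (ε * r / (2 * (K + 1))) by positivity)]
    with L hL w
  rw [Metric.mem_ball] at hL
  rcases eq_or_ne w 0 with rfl | hw
  · have := hsmul L 0 0
    simp only [zero_smul] at this
    simp [this]
  have hwn : 0 < ‖w‖ := norm_pos_iff.2 hw
  set a := r / 2 / ‖w‖ with ha
  have hapos : 0 < a := by positivity
  have haw : ‖a • w‖ = r / 2 := by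
    rw [norm_smul, Real.norm_of_nonneg hapos.le, ha]
    field_simp
  have hmem : ∀ L', dist L' e < r → (L', a • w) ∈ t := fun L' hL' => hrt <| by
    rw [Metric.mem_ball, Prod.dist_eq, max_lt_iff]
    exact ⟨hL', by simp only [dist_zero_right, haw]; linarith⟩
  have h1 := hK.dist_le_mul _ (hmem L (hL.trans_le (min_le_left _ _))) _
    (hmem e (by simpa using hr))
  rw [Prod.dist_eq, dist_self, max_eq_left dist_nonneg] at h1
  simp only [hone, hsmul, dist_eq_norm] at h1
  rw [← smul_sub, norm_smul, Real.norm_of_nonneg hapos.le] at h1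
  have h2 : (K : ℝ) * ‖L - e‖ ≤ ε * r / 2 := by
    have h3 := (hL.trans_le (min_le_right _ _)).le
    rw [dist_eq_norm, le_div_iff₀ (by positivity)] at h3
    nlinarith [norm_nonneg (L - e), K.coe_nonneg]
  have h4 : a * ‖P L w - w‖ ≤ a * (ε * ‖w‖) := by
    refine h1.trans (h2.trans (le_of_eq ?_))
    rw [ha]
    field_simp
  exact le_of_mul_le_mul_left h4 hapos

/-- The curve `s ↦ P(e^{sA}) v - s w(A)` has derivative `P(e^{sA}) w(A) - w(A)`, which is small
relative to `w(A)`. A bound by `ε ‖A‖` would be too weak, since `A` may have a large component along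
the stabiliser of `v`. -/
theorem eventually_norm_exp_action_sub_le {n : ℕ} {P : EndT n → V → V} {w : EndT n → V} {v : V}
    (hP : ∀ ε > 0, ∀ᶠ L in 𝓝 (1 : EndT n), ∀ w, ‖P L w - w‖ ≤ ε * ‖w‖) (hone : P 1 v = v)
    (hder : ∀ (A : EndT n) (s : ℝ), HasDerivAt (fun s : ℝ => P (NormedSpace.exp (s • A)) v)
      (P (NormedSpace.exp (s • A)) (w A)) s) {ε : ℝ} (hε : 0 < ε) :
    ∀ᶠ A in 𝓝 (0 : EndT n), ‖P (NormedSpace.exp A) v - v - w A‖ ≤ ε * ‖w A‖ := by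
  have hexp : Tendsto (NormedSpace.exp : EndT n → EndT n) (𝓝 0) (𝓝 1) := by
    have := (hasStrictFDerivAt_exp_zero (𝕂 := ℝ) (𝔸 := EndT n)).continuousAt
    rw [ContinuousAt, NormedSpace.exp_zero] at this
    exact this
  obtain ⟨δ, hδ, hδP⟩ := Metric.mem_nhds_iff.1 (hexp.eventually (hP ε hε))
  filter_upwards [Metric.ball_mem_nhds 0 hδ] with A hA
  have hs : ∀ s ∈ Set.Ico (0 : ℝ) 1, ‖P (NormedSpace.exp (s • A)) (w A) - w A‖ ≤ ε * ‖w A‖ := by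
    intro s hs
    have hmem : s • A ∈ Metric.ball (0 : EndT n) δ := by
      rw [mem_ball_zero_iff] at hA ⊢
      rw [norm_smul, Real.norm_of_nonneg hs.1]
      nlinarith [norm_nonneg A, hs.2, hs.1]
    exact hδP hmem (w A)
  have hF : ∀ s : ℝ, HasDerivAt (fun s : ℝ => P (NormedSpace.exp (s • A)) v - s • w A)
      (P (NormedSpace.exp (s • A)) (w A) - w A) s := fun s => by
    have := (hder A s).sub ((hasDerivAt_id s).smul_const (w A))
    rw [one_smul] at this
    exact this
  have h1 := norm_image_sub_le_of_norm_deriv_le_segment_01'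
    (fun s _ => (hF s).hasDerivWithinAt) hs
  have h0 : P (NormedSpace.exp ((0 : ℝ) • A)) v - (0 : ℝ) • w A = v := by
    rw [show (0 : ℝ) • A = 0 from zero_smul ℝ A, NormedSpace.exp_zero, hone, zero_smul, sub_zero]
  rw [h0] at h1
  simp only [one_smul] at h1
  rwa [show P (NormedSpace.exp A) v - v - w A = P (NormedSpace.exp A) v - w A - v by abel]

theorem eventually_exists_exp_eq {n : ℕ} {s : Set (EndT n)} (hs : s ∈ 𝓝 (0 : EndT n)) :
    ∀ᶠ L in 𝓝 (1 : EndT n), ∃ A ∈ s, NormedSpace.exp A = L := by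
  have h := (hasStrictFDerivAt_exp_zero (𝕂 := ℝ) (𝔸 := EndT n)).map_nhds_eq_of_equiv
    (f' := ContinuousLinearEquiv.refl ℝ (EndT n))
  rw [NormedSpace.exp_zero] at h
  rw [← h, eventually_map]
  filter_upwards [hs] with A hA using ⟨A, hA, rfl⟩

end AbstractTangent

/-! ### The exponential action on tensors and bilinear forms -/

section Frames

open Filter

variable {n p q : ℕ}

theorem hasDerivAt_clm_of_apply {V W : Type*} [NormedAddCommGroup V] [NormedSpace ℝ V]
    [FiniteDimensional ℝ V] [NormedAddCommGroup W] [NormedSpace ℝ W] {f : ℝ → V →L[ℝ] W}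
    {f' : V →L[ℝ] W} {s : ℝ} (h : ∀ v, HasDerivAt (fun s => f s v) (f' v) s) :
    HasDerivAt f f' s := by
  have hb : ∀ B : V →L[ℝ] W, B = ∑ i, ContinuousLinearMap.smulRightL ℝ V W
      ((Module.finBasis ℝ V).coord i).toContinuousLinearMap (B (Module.finBasis ℝ V i)) := by
    intro B
    ext v
    conv_lhs => rw [← (Module.finBasis ℝ V).sum_repr v, map_sum]
    simp
  have h1 := HasDerivAt.fun_sum (u := Finset.univ) fun i _ =>
    (ContinuousLinearMap.smulRightL ℝ V W
      ((Module.finBasis ℝ V).coord i).toContinuousLinearMap).hasFDerivAt.comp_hasDerivAt s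
      (h (Module.finBasis ℝ V i))
  rw [hb f']
  refine h1.congr_of_eventuallyEq (Eventually.of_forall fun s => ?_)
  exact hb (f s)

theorem isInvertible_one : (1 : EndT n).IsInvertible :=
  ContinuousLinearMap.isInvertible_equiv (f := ContinuousLinearEquiv.refl ℝ (Model n))

theorem exp_mul_exp_neg {𝔸 : Type*} [NormedRing 𝔸] [NormedAlgebra ℝ 𝔸] [CompleteSpace 𝔸] (A : 𝔸) :
    NormedSpace.exp A * NormedSpace.exp (-A) = 1 := by
  let +nondep : NormedAlgebra ℚ 𝔸 := .restrictScalars ℚ ℝ 𝔸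
  rw [← NormedSpace.exp_add_of_commute (Commute.neg_right (Commute.refl A)), add_neg_cancel,
    NormedSpace.exp_zero]

theorem isInvertible_exp (A : EndT n) : (NormedSpace.exp A : EndT n).IsInvertible :=
  isInvertible_of_comp_eq_id (B := NormedSpace.exp (-A)) (exp_mul_exp_neg A)

theorem contDiffAt_bilinearComp {Z : Type*} [NormedAddCommGroup Z] [NormedSpace ℝ Z]
    {L : Z → EndT n} {G : Z → Bil n} {z : Z} (hL : ContDiffAt ℝ ∞ L z)
    (hG : ContDiffAt ℝ ∞ G z) : ContDiffAt ℝ ∞ (fun z => (G z).bilinearComp (L z) (L z)) z := by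
  refine contDiffAt_clm_of_apply fun a => contDiffAt_clm_of_apply fun b => ?_
  have ha := hL.clm_apply (contDiffAt_const (c := a))
  have hb := hL.clm_apply (contDiffAt_const (c := b))
  exact (hG.clm_apply ha).clm_apply hb

/-- The infinitesimal action of endomorphisms on bilinear forms. -/
def bilDiamond (A : EndT n) (G : Bil n) : Bil n :=
  G.bilinearComp A (ContinuousLinearMap.id ℝ (Model n)) +
    G.bilinearComp (ContinuousLinearMap.id ℝ (Model n)) A

theorem bilDiamond_apply (A : EndT n) (G : Bil n) (a b : Model n) :
    bilDiamond A G a b = G (A a) b + G a (A b) := rfl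

theorem hasDerivAt_exp_smul (A : EndT n) (s : ℝ) :
    HasDerivAt (fun s : ℝ => (NormedSpace.exp (s • A) : EndT n))
      (A.comp (NormedSpace.exp (s • A))) s := hasDerivAt_exp_smul_const' A s

theorem hasDerivAt_bilinearComp_exp (A : EndT n) (G : Bil n) (s : ℝ) :
    HasDerivAt (fun s : ℝ => G.bilinearComp (NormedSpace.exp (s • A)) (NormedSpace.exp (s • A)))
      ((bilDiamond A G).bilinearComp (NormedSpace.exp (s • A)) (NormedSpace.exp (s • A))) s := by
  have hLa : ∀ a, HasDerivAt (fun s : ℝ => (NormedSpace.exp (s • A) : EndT n) a)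
      (A ((NormedSpace.exp (s • A) : EndT n) a)) s := fun a => by
    have := (hasDerivAt_exp_smul A s).clm_apply (hasDerivAt_const s a)
    simpa using this
  refine hasDerivAt_clm_of_apply fun a => hasDerivAt_clm_of_apply fun b => ?_
  exact (G.hasFDerivAt.comp_hasDerivAt s (hLa a)).clm_apply (hLa b)

theorem contDiffAt_exp_smul {𝔸 : Type*} [NormedRing 𝔸] [NormedAlgebra ℝ 𝔸] [CompleteSpace 𝔸]
    (A : 𝔸) (s : ℝ) : ContDiffAt ℝ ∞ (fun s : ℝ => NormedSpace.exp (s • A)) s :=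
  ((NormedSpace.exp_analytic (𝕂 := ℝ) (s • A)).contDiffAt (n := ∞)).comp s
    (contDiffAt_id.smul contDiffAt_const)

theorem hasDerivAt_pullback_exp (A : EndT n) (ξ : Tensor n p q) (s : ℝ) :
    HasDerivAt (fun s : ℝ => Tensor.pullback (NormedSpace.exp (s • A)) ξ)
      (Tensor.pullback (NormedSpace.exp (s • A)) (diamond A ξ)) s := by
  have hi := isInvertible_exp (s • A)
  have h2 := hasDerivAt_pullback (hasDerivAt_exp_smul A s) hi (hasDerivAt_const s ξ)
    ((contDiffAt_pullback (contDiffAt_exp_smul A s) hi contDiffAt_const).differentiableAt (by simp))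
  have h3 : (0 : Tensor n p q) + diamond ((A.comp (NormedSpace.exp (s • A))).comp
      (NormedSpace.exp (s • A) : EndT n).inverse) ξ = diamond A ξ := by
    rw [ContinuousLinearMap.comp_assoc, hi.self_comp_inverse, ContinuousLinearMap.comp_id]
    abel
  rw [h3] at h2
  exact h2

theorem contDiffAt_pullback_one : ContDiffAt ℝ ∞
    (fun z : EndT n × Tensor n p q => Tensor.pullback z.1 z.2) (1, 0) :=
  contDiffAt_pullback contDiffAt_fst isInvertible_one contDiffAt_snd

theorem eventually_norm_pullback_sub_le {ε : ℝ} (hε : 0 < ε) :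
    ∀ᶠ L in 𝓝 (1 : EndT n), ∀ ξ : Tensor n p q, ‖Tensor.pullback L ξ - ξ‖ ≤ ε * ‖ξ‖ :=
  eventually_norm_action_sub_le (V := Tensor n p q) (P := Tensor.pullback)
    (contDiffAt_pullback_one.of_le (by simp)) pullback_smul pullback_id hε

theorem eventually_norm_pullback_exp_sub_le (ξ : Tensor n p q) {ε : ℝ} (hε : 0 < ε) :
    ∀ᶠ A in 𝓝 (0 : EndT n), ‖Tensor.pullback (NormedSpace.exp A) ξ - ξ - diamond A ξ‖ ≤
      ε * ‖diamond A ξ‖ :=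
  eventually_norm_exp_action_sub_le (V := Tensor n p q) (P := Tensor.pullback)
    (w := fun A => diamond A ξ) (fun _ hε => eventually_norm_pullback_sub_le hε) (pullback_id ξ)
    (fun A s => hasDerivAt_pullback_exp A ξ s) hε

theorem eventually_norm_bilinearComp_exp_sub_le (G : Bil n) {ε : ℝ} (hε : 0 < ε) :
    ∀ᶠ A in 𝓝 (0 : EndT n), ‖G.bilinearComp (NormedSpace.exp A) (NormedSpace.exp A) - G -
      bilDiamond A G‖ ≤ ε * ‖bilDiamond A G‖ := by
  refine eventually_norm_exp_action_sub_le (P := fun L (G : Bil n) => G.bilinearComp L L)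
    (w := fun A => bilDiamond A G) (fun ε hε => ?_) rfl
    (fun A s => hasDerivAt_bilinearComp_exp A G s) hε
  refine eventually_norm_action_sub_le (P := fun L (G : Bil n) => G.bilinearComp L L) ?_
    (fun L a w => rfl) (fun w => rfl) hε
  have h : ContDiffAt ℝ ∞ (fun z : EndT n × Bil n => z.2.bilinearComp z.1 z.1) (1, 0) :=
    contDiffAt_bilinearComp contDiffAt_fst contDiffAt_snd
  exact h.of_le (by simp)

end Frames

end HarmonicSoliton

end

noncomputable section

open scoped Manifold ContDiff Topology
set_option linter.unusedSectionVars false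

namespace HarmonicSoliton

/-! ### Adapted frames, compactness and the tangent space of the orbit -/

section FrameSequence

open Filter

variable {n p q : ℕ}

/-- `e` is an orthonormal frame of `b` in which `ξ` is `ξ₀`. -/
structure IsAdaptedFrame (ξ₀ : Tensor n p q) (b : Bil n) (ξ : Tensor n p q) (e : EndT n) :
    Prop where
  inv : e.IsInvertible
  orth : ∀ u v, b (e u) (e v) = inner ℝ u v
  pullback : Tensor.pullback e ξ = ξ₀

theorem IsAdaptedFrame.norm_sq_le {ξ₀ ξ : Tensor n p q} {b : Bil n} {e : EndT n}
    (h : IsAdaptedFrame ξ₀ b ξ e) (w : Model n) : ‖w‖ ^ 2 ≤ ‖e‖ ^ 2 * b w w := by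
  have h1 := h.orth (e.inverse w) (e.inverse w)
  rw [h.inv.self_apply_inverse, real_inner_self_eq_norm_sq] at h1
  have h2 := e.le_opNorm (e.inverse w)
  rw [h.inv.self_apply_inverse] at h2
  rw [h1, ← mul_pow]
  exact pow_le_pow_left₀ (norm_nonneg _) h2 2

theorem IsAdaptedFrame.norm_le {ξ₀ ξ : Tensor n p q} {b : Bil n} {e : EndT n}
    (h : IsAdaptedFrame ξ₀ b ξ e) {K : ℝ} (hK : 0 ≤ K) (hb : ∀ w, ‖w‖ ^ 2 ≤ K * b w w) :
    ‖e‖ ≤ √K := by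
  refine e.opNorm_le_bound (Real.sqrt_nonneg _) fun a => ?_
  have h1 := hb (e a)
  rw [h.orth, real_inner_self_eq_norm_sq] at h1
  refine le_of_sq_le_sq ?_ (by positivity)
  rw [mul_pow, Real.sq_sqrt hK]
  exact h1

theorem eventually_norm_sub_lt {Z V : Type*} [TopologicalSpace Z] [NormedAddCommGroup V]
    {f : Z → V} {y : Z} (hf : ContinuousAt f y) {δ : ℝ} (hδ : 0 < δ) :
    ∀ᶠ z in 𝓝 y, ‖f y - f z‖ < δ := by
  filter_upwards [hf.tendsto.eventually_mem (Metric.ball_mem_nhds (f y) hδ)] with z hz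
  rwa [mem_ball_iff_norm'] at hz

theorem eventually_norm_sq_le {Z : Type*} [TopologicalSpace Z] {G : Z → Bil n} {y : Z} {K : ℝ}
    (hK : 0 ≤ K) (hG : ContinuousAt G y) (hy : ∀ w, ‖w‖ ^ 2 ≤ K * G y w w) :
    ∀ᶠ z in 𝓝 y, ∀ w, ‖w‖ ^ 2 ≤ (2 * K) * G z w w := by
  have hδ : (0 : ℝ) < 1 / (2 * (K + 1)) := by positivity
  filter_upwards [eventually_norm_sub_lt (V := Bil n) hG hδ] with z hz w
  rw [lt_div_iff₀ (by positivity)] at hz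
  have h1 : G y w w - G z w w ≤ ‖G y - G z‖ * ‖w‖ * ‖w‖ :=
    (le_abs_self _).trans ((G y - G z).le_opNorm₂ w w)
  have h2 := hy w
  have h3 : K * (‖G y - G z‖ * ‖w‖ * ‖w‖) ≤ 1 / 2 * ‖w‖ ^ 2 := by
    have : K * ‖G y - G z‖ ≤ 1 / 2 := by nlinarith [norm_nonneg (G y - G z)]
    nlinarith [sq_nonneg ‖w‖]
  nlinarith

theorem isInvertible_of_orth {b : Bil n} {e : EndT n}
    (h : ∀ u v, b (e u) (e v) = inner ℝ u v) : e.IsInvertible := by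
  have hinj : Function.Injective e.toLinearMap := by
    refine (injective_iff_map_eq_zero _).2 fun u hu => ?_
    have h1 := h u u
    have h2 : e u = 0 := hu
    rw [h2, map_zero, real_inner_self_eq_norm_sq] at h1
    have h3 : ‖u‖ = 0 := by simpa using h1.symm
    exact norm_eq_zero.1 h3
  exact ⟨(LinearEquiv.ofInjectiveEndo e.toLinearMap hinj).toContinuousLinearEquiv, rfl⟩

/-- `A ↦ A ⋄ ξ` as a linear map. -/
def diamondLinear (ξ : Tensor n p q) : EndT n →ₗ[ℝ] Tensor n p q where
  toFun A := diamond A ξ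
  map_add' A B := diamond_add_left A B ξ
  map_smul' a A := diamond_smul_left a A ξ

/-- `A ↦ A ⋄ G` as a linear map. -/
def bilDiamondLinear (G : Bil n) : EndT n →ₗ[ℝ] Bil n where
  toFun A := bilDiamond A G
  map_add' A B := by
    ext a b
    simp only [bilDiamond_apply, add_apply, map_add]
    ring
  map_smul' c A := by
    ext a b
    simp only [bilDiamond_apply, smul_apply, map_smul, RingHom.id_apply, smul_eq_mul]
    ring

theorem tendsto_slope_of_hasDerivAt {V : Type*} [NormedAddCommGroup V] [NormedSpace ℝ V]
    {c : ℝ → V} {D : V} (hc : HasDerivAt c D 0) {s : ℕ → ℝ} (hs : Tendsto s atTop (𝓝[≠] 0)) :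
    Tendsto (fun k => (s k)⁻¹ • (c (s k) - c 0)) atTop (𝓝 D) := by
  have h := (hasDerivAt_iff_tendsto_slope_zero.1 hc).comp hs
  simpa [Function.comp_def] using h

/-- Invertibility is not a closed condition, but orthonormality is and implies it. Pull-back is
therefore continuous at the limit frame. -/
theorem tendsto_adaptedFrames {b : ℕ → Bil n} {ξ : ℕ → Tensor n p q} {e : ℕ → EndT n}
    {b₁ : Bil n} {ξ₀ ξ₁ : Tensor n p q} {e₁ : EndT n} (hb : Tendsto b atTop (𝓝 b₁))
    (hξ : Tendsto ξ atTop (𝓝 ξ₁)) (he : Tendsto e atTop (𝓝 e₁))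
    (h : ∀ᶠ k in atTop, IsAdaptedFrame ξ₀ (b k) (ξ k) (e k)) : IsAdaptedFrame ξ₀ b₁ ξ₁ e₁ := by
  have horth : ∀ u v, b₁ (e₁ u) (e₁ v) = inner ℝ u v := by
    intro u v
    have h1 : ∀ w, Tendsto (fun k => e k w) atTop (𝓝 (e₁ w)) := fun w =>
      ((ContinuousLinearMap.apply ℝ (Model n) w).continuous.tendsto e₁).comp he
    have h2 : Tendsto (fun k => b k (e k u) (e k v)) atTop (𝓝 (b₁ (e₁ u) (e₁ v))) :=
      (isBoundedBilinearMap_apply.continuous.tendsto _).comp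
        (((isBoundedBilinearMap_apply.continuous.tendsto _).comp
          (hb.prodMk_nhds (h1 u))).prodMk_nhds (h1 v))
    refine tendsto_nhds_unique h2 (tendsto_const_nhds.congr' ?_)
    filter_upwards [h] with k hk using (hk.orth u v).symm
  have hi := isInvertible_of_orth horth
  refine ⟨hi, horth, ?_⟩
  have hc : ContinuousAt (fun z : EndT n × Tensor n p q => Tensor.pullback z.1 z.2) (e₁, ξ₁) :=
    (contDiffAt_pullback (z := (e₁, ξ₁)) contDiffAt_fst hi contDiffAt_snd).continuousAt
  have h3 := hc.tendsto.comp (he.prodMk_nhds hξ)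
  refine tendsto_nhds_unique h3 (tendsto_const_nhds.congr' ?_)
  filter_upwards [h] with k hk using hk.pullback.symm

/-- The transition between two adapted frames. -/
theorem IsAdaptedFrame.transition {b b' : Bil n} {ξ₀ ξ ξ' : Tensor n p q} {e e' : EndT n}
    (h : IsAdaptedFrame ξ₀ b ξ e) (h' : IsAdaptedFrame ξ₀ b' ξ' e') :
    b.bilinearComp (e.comp e'.inverse) (e.comp e'.inverse) = b' ∧
      Tensor.pullback (e.comp e'.inverse) ξ = ξ' := by
  constructor
  · refine ContinuousLinearMap.ext fun u => ContinuousLinearMap.ext fun v => ?_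
    obtain ⟨u, rfl⟩ := h'.inv.surjective u
    obtain ⟨v, rfl⟩ := h'.inv.surjective v
    rw [h'.orth, ← h.orth]
    simp only [ContinuousLinearMap.bilinearComp_apply, ContinuousLinearMap.comp_apply,
      h'.inv.inverse_apply_self]
  · rw [pullback_comp h.inv, h.pullback, ← h'.pullback, pullback_inverse_pullback h'.inv]

/-- Metrics close to `b₁` are uniformly coercive, so their orthonormal frames stay bounded and a
subsequence converges to an adapted frame `e₂` of the limit. The transitions `e₂ ∘ e_k⁻¹` tend to
the identity and move the limit data to the data at `φ k`. Compactness thus replaces a local section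
of the orbit map. -/
theorem exists_subseq_adaptedFrames {b : ℕ → Bil n} {ξ : ℕ → Tensor n p q} {b₁ : Bil n}
    {ξ₀ ξ₁ : Tensor n p q} {e₁ : EndT n} (hb : Tendsto b atTop (𝓝 b₁))
    (hξ : Tendsto ξ atTop (𝓝 ξ₁)) (h₁ : IsAdaptedFrame ξ₀ b₁ ξ₁ e₁)
    (h : ∀ᶠ k in atTop, ∃ e, IsAdaptedFrame ξ₀ (b k) (ξ k) e) :
    ∃ (φ : ℕ → ℕ) (g : ℕ → EndT n), StrictMono φ ∧ Tendsto g atTop (𝓝 1) ∧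
      ∀ᶠ k in atTop, b₁.bilinearComp (g k) (g k) = b (φ k) ∧
        Tensor.pullback (g k) ξ₁ = ξ (φ k) := by
  obtain ⟨e, he⟩ := h.choice
  have hK : (0 : ℝ) ≤ ‖e₁‖ ^ 2 := by positivity
  have hbound := hb.eventually
    (eventually_norm_sq_le (G := fun z : Bil n => z) hK continuousAt_id h₁.norm_sq_le)
  have hball : ∀ᶠ k in atTop, e k ∈ Metric.closedBall (0 : EndT n) √(2 * ‖e₁‖ ^ 2) := by
    filter_upwards [he, hbound] with k hk hk'
    rw [mem_closedBall_zero_iff]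
    exact hk.norm_le (by positivity) hk'
  have : ProperSpace (EndT n) := FiniteDimensional.proper ℝ (EndT n)
  obtain ⟨e₂, -, φ, hφ, hlim⟩ := tendsto_subseq_of_frequently_bounded
    (Metric.isBounded_closedBall) hball.frequently
  have h₂ := tendsto_adaptedFrames (hb.comp hφ.tendsto_atTop) (hξ.comp hφ.tendsto_atTop) hlim
    (hφ.tendsto_atTop.eventually he)
  have hinv : Tendsto (fun k => (e (φ k)).inverse) atTop (𝓝 e₂.inverse) :=
    ((contDiffAt_inverse contDiffAt_id h₂.inv).continuousAt.tendsto).comp hlim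
  refine ⟨φ, fun k => e₂.comp (e (φ k)).inverse, hφ, ?_, ?_⟩
  · have h3 := ((ContinuousLinearMap.compL ℝ (Model n) (Model n) (Model n)
      e₂).continuous.tendsto _).comp hinv
    rw [ContinuousLinearMap.compL_apply] at h3
    rw [h₂.inv.self_comp_inverse] at h3
    exact h3
  · filter_upwards [hφ.tendsto_atTop.eventually he] with k hk
    exact h₂.transition hk

/-- The derivative of a metric and a tensor which together stay in one orbit of the general linear
group is tangent to the orbit. -/
theorem exists_fderiv_eq_diamond {G : Model n → Bil n} {ξ : Model n → Tensor n p q}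
    {ξ₀ : Tensor n p q} {y : Model n} (hG : DifferentiableAt ℝ G y)
    (hξ : DifferentiableAt ℝ ξ y)
    (hframe : ∀ᶠ z in 𝓝 y, ∃ e, IsAdaptedFrame ξ₀ (G z) (ξ z) e) (u : Model n) :
    ∃ A : EndT n, fderiv ℝ G y u = bilDiamond A (G y) ∧
      fderiv ℝ ξ y u = diamond A (ξ y) := by
  have hcurve : HasDerivAt (fun s : ℝ => y + s • u) u 0 := by
    simpa using ((hasDerivAt_id (0 : ℝ)).smul_const u).const_add y
  have hy : y + (0 : ℝ) • u = y := by simp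
  have hc : Tendsto (fun s : ℝ => y + s • u) (𝓝 0) (𝓝 y) := by
    have := hcurve.continuousAt.tendsto
    rwa [hy] at this
  have hG' := hasDerivAt_comp_curve (η := G) hy hG hcurve
  have hξ' := hasDerivAt_comp_curve (W := Tensor n p q) (η := ξ) hy hξ hcurve
  -- The derivatives are known to exist, so their values can be read off along a single sequence of
  -- times, even along a subsequence.
  have hs : Tendsto (fun k : ℕ => 1 / ((k : ℝ) + 1)) atTop (𝓝[≠] 0) := by
    refine tendsto_nhdsWithin_iff.2 ⟨tendsto_one_div_add_atTop_nhds_zero_nat, ?_⟩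
    exact Eventually.of_forall fun k => by
      simp only [Set.mem_compl_iff, Set.mem_singleton_iff]; positivity
  have hz := hc.comp (tendsto_nhdsWithin_iff.1 hs).1
  obtain ⟨e₁, he₁⟩ := hframe.self_of_nhds
  obtain ⟨φ, g, hφ, hg, hgk⟩ := exists_subseq_adaptedFrames
    (hG.continuousAt.tendsto.comp hz) (hξ.continuousAt.tendsto.comp hz) he₁ (hz.eventually hframe)
  have hsφ := hs.comp hφ.tendsto_atTop
  refine exists_eq_of_tendsto_slope (bilDiamondLinear (G y)) (diamondLinear (ξ y))
    (tendsto_slope_of_hasDerivAt hG' hsφ) (tendsto_slope_of_hasDerivAt hξ' hsφ) fun ε hε => ?_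
  -- The transitions tend to `1`, hence are eventually exponentials of small `A`, and the same `A`
  -- approximates the increments of both the metric and the tensor.
  have hev := (eventually_norm_bilinearComp_exp_sub_le (G y) hε).and
    (eventually_norm_pullback_exp_sub_le (ξ y) hε)
  filter_upwards [hgk, hg.eventually (eventually_exists_exp_eq hev)] with k hk hA
  obtain ⟨A, ⟨h1, h2⟩, hA⟩ := hA
  rw [hA, hk.1] at h1
  rw [hA, hk.2] at h2
  refine ⟨A, ?_, ?_⟩
  · rw [hy]; exact h1
  · rw [hy]; exact h2

end FrameSequence

end HarmonicSoliton

end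

noncomputable section

open scoped Manifold ContDiff Topology
set_option linter.unusedSectionVars false

namespace HarmonicSoliton

/-! ### Differentiable solutions of linear equations of constant rank -/

section ConstantRank

open Filter Module

variable {E Z Y W : Type*} [NormedAddCommGroup E] [NormedSpace ℝ E] [NormedAddCommGroup Z]
  [NormedSpace ℝ Z] [FiniteDimensional ℝ Z] [NormedAddCommGroup Y] [NormedSpace ℝ Y]
  [NormedAddCommGroup W] [NormedSpace ℝ W]

theorem differentiableAt_clm_of_apply {f : E → Z →L[ℝ] W} {y : E}
    (h : ∀ v, DifferentiableAt ℝ (fun z => f z v) y) : DifferentiableAt ℝ f y := by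
  have hb : f = fun z => ∑ i, ContinuousLinearMap.smulRightL ℝ Z W
      ((finBasis ℝ Z).coord i).toContinuousLinearMap (f z (finBasis ℝ Z i)) := by
    funext z
    ext v
    conv_lhs => rw [← (finBasis ℝ Z).sum_repr v, map_sum]
    simp
  rw [hb]
  refine DifferentiableAt.fun_sum fun i _ => ?_
  exact (ContinuousLinearMap.differentiableAt _).comp y (h _)

theorem isInvertible_of_injective_of_finrank [FiniteDimensional ℝ W] {B : Z →L[ℝ] W}
    (hB : Function.Injective B) (hd : finrank ℝ Z = finrank ℝ W) : B.IsInvertible :=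
  ⟨(LinearEquiv.ofInjectiveOfFinrankEq B.toLinearMap hB hd).toContinuousLinearEquiv, rfl⟩

theorem eventually_isInvertible [FiniteDimensional ℝ W] {B : E → Z →L[ℝ] W} {y : E}
    (hB : ContinuousAt B y) (hi : (B y).IsInvertible) : ∀ᶠ z in 𝓝 y, (B z).IsInvertible := by
  have := FiniteDimensional.complete ℝ Z
  obtain ⟨e, he⟩ := hi
  have h := hB.tendsto
  rw [← he] at h
  filter_upwards [h.eventually_mem (ContinuousLinearEquiv.nhds e)] with z hz using hz

theorem differentiableAt_inverse_apply [FiniteDimensional ℝ W] {B : E → Z →L[ℝ] W} {w : E → W}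
    {y : E} (hB : DifferentiableAt ℝ B y) (hi : (B y).IsInvertible)
    (hw : DifferentiableAt ℝ w y) : DifferentiableAt ℝ (fun z => (B z).inverse (w z)) y := by
  have := FiniteDimensional.complete ℝ Z
  have h1 : DifferentiableAt ℝ (ContinuousLinearMap.inverse : (Z →L[ℝ] W) → _) (B y) :=
    (hi.contDiffAt_map_inverse (n := 1)).differentiableAt (by simp)
  have h2 : DifferentiableAt ℝ (fun z => (B z).inverse) y := h1.comp y hB
  exact h2.clm_apply hw

/-- Solutions of a differentiable family of linear equations of constant rank, normalised by an
orthogonality condition, are differentiable. -/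
theorem differentiableAt_of_constant_rank {y : E} {D : E → Z →ₗ[ℝ] Y} {w : E → Y} {T : E → Z}
    {β : Z →ₗ[ℝ] Z →ₗ[ℝ] ℝ} (hD : ∀ A, DifferentiableAt ℝ (fun z => D z A) y)
    (hw : DifferentiableAt ℝ w y)
    (hβ : ∀ k ∈ LinearMap.ker (D y), (∀ k' ∈ LinearMap.ker (D y), β k k' = 0) → k = 0)
    (hdim : ∀ᶠ z in 𝓝 y, finrank ℝ (LinearMap.ker (D z)) = finrank ℝ (LinearMap.ker (D y)))
    (hT : ∀ᶠ z in 𝓝 y, D z (T z) = w z)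
    (hTβ : ∀ᶠ z in 𝓝 y, ∀ k ∈ LinearMap.ker (D z), β (T z) k = 0) :
    DifferentiableAt ℝ T y := by
  set K := LinearMap.ker (D y) with hK
  set R := LinearMap.range (D y) with hR
  obtain ⟨Q, hQ⟩ := Submodule.ClosedComplemented.of_finiteDimensional R
  obtain ⟨P, hP⟩ := LinearMap.exists_leftInverse_of_injective K.subtype K.ker_subtype
  have hPk : ∀ k : K, P k = k := fun k => congrArg (fun f : K →ₗ[ℝ] K => f k) hP
  have hQD : ∀ A, Q (D y A) = 0 → A ∈ K := fun A hA => by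
    have h := hQ ⟨D y A, A, rfl⟩
    rw [hA] at h
    rw [hK, LinearMap.mem_ker]
    exact (congrArg Subtype.val h).symm
  have hrank : finrank ℝ R + finrank ℝ K = finrank ℝ Z := (D y).finrank_range_add_finrank_ker
  -- `Q` projects onto the range of `D y` and `P` onto its kernel `K`, so `B y` is an isomorphism by
  -- rank and nullity, and so is `B z` nearby.
  set B : E → Z →L[ℝ] R × K := fun z =>
    LinearMap.toContinuousLinearMap ((Q.toLinearMap ∘ₗ D z).prod P) with hB
  have hBapp : ∀ z A, B z A = (Q (D z A), P A) := fun z A => rfl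
  have hQDd : ∀ A, DifferentiableAt ℝ (fun z => Q (D z A)) y := fun A =>
    Q.differentiableAt.comp y (hD A)
  have hBd : DifferentiableAt ℝ B y := differentiableAt_clm_of_apply fun A =>
    (hQDd A).prodMk (differentiableAt_const _)
  have hBi : (B y).IsInvertible := by
    refine isInvertible_of_injective_of_finrank ((injective_iff_map_eq_zero _).2 fun A hA => ?_)
      (by rw [finrank_prod, hrank])
    rw [hBapp, Prod.mk_eq_zero] at hA
    have h1 : (0 : K) = ⟨A, hQD A hA.1⟩ := hA.2.symm.trans (hPk ⟨A, hQD A hA.1⟩)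
    exact (congrArg Subtype.val h1).symm
  -- `P` embeds the kernel of `Q ∘ D z` in `K`, and that kernel contains `ker (D z)`, whose
  -- dimension is that of `K`. So the two kernels agree, and `(B z)⁻¹ (0, k)` gives a moving frame
  -- of `ker (D z)`, differentiable at `y`.
  have hker : ∀ᶠ z in 𝓝 y, ∀ k : K, (B z).inverse (0, k) ∈ LinearMap.ker (D z) := by
    filter_upwards [eventually_isInvertible hBd.continuousAt hBi, hdim] with z hz hdz k
    have hle : LinearMap.ker (D z) ≤ LinearMap.ker (Q.toLinearMap ∘ₗ D z) :=
      LinearMap.ker_le_ker_comp _ _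
    have hinj : Function.Injective ((P : Z →ₗ[ℝ] K).domRestrict
        (LinearMap.ker (Q.toLinearMap ∘ₗ D z))) := by
      refine (injective_iff_map_eq_zero _).2 fun A hA => ?_
      have h0 : B z A = B z 0 := by
        rw [map_zero, hBapp]
        exact Prod.ext A.2 hA
      exact Subtype.ext (hz.injective h0)
    have heq := Submodule.eq_of_le_of_finrank_le hle
      ((LinearMap.finrank_le_finrank_of_injective hinj).trans hdz.ge)
    rw [heq, LinearMap.mem_ker]
    have h1 := hz.self_apply_inverse (0, k)
    rw [hBapp] at h1
    exact congrArg Prod.fst h1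
  have hBy : ∀ k : K, (B y).inverse (0, k) = k := fun k => by
    refine hBi.injective ?_
    rw [hBi.self_apply_inverse, hBapp, hPk, LinearMap.mem_ker.1 k.2, map_zero]
  set κ := finBasis ℝ K with hκ
  -- The projection `P` is now replaced by the pairings with the moving frame of the kernel. The
  -- system for `T` becomes `C z (T z) = (Q (w z), 0)` with `C y` invertible.
  set C : E → Z →L[ℝ] R × (Fin (finrank ℝ K) → ℝ) := fun z => LinearMap.toContinuousLinearMap
    ((Q.toLinearMap ∘ₗ D z).prod (LinearMap.pi fun i => β.flip ((B z).inverse (0, κ i)))) with hC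
  have hCapp : ∀ z A, C z A = (Q (D z A), fun i => β A ((B z).inverse (0, κ i))) :=
    fun z A => rfl
  have hCd : DifferentiableAt ℝ C y := by
    refine differentiableAt_clm_of_apply (W := R × (Fin (finrank ℝ K) → ℝ)) fun A => ?_
    refine (hQDd A).prodMk (differentiableAt_pi.2 fun i => ?_)
    exact ((LinearMap.toContinuousLinearMap (β A)).differentiableAt).comp y
      (differentiableAt_inverse_apply hBd hBi (differentiableAt_const _))
  have hCi : (C y).IsInvertible := by
    refine isInvertible_of_injective_of_finrank (W := R × (Fin (finrank ℝ K) → ℝ))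
      ((injective_iff_map_eq_zero _).2 fun A hA => ?_) ?_
    · rw [hCapp, Prod.mk_eq_zero] at hA
      have h1 : A ∈ K := hQD A hA.1
      refine hβ A h1 fun k hk => ?_
      have h2 : (β A) ∘ₗ K.subtype = 0 := κ.ext fun i => by
        have h3 := congrFun hA.2 i
        rw [hBy] at h3
        exact h3
      exact congrArg (fun f : K →ₗ[ℝ] ℝ => f ⟨k, hk⟩) h2
    · rw [finrank_prod, finrank_fin_fun, hrank]
  have hTC : ∀ᶠ z in 𝓝 y, T z = (C z).inverse (Q (w z), 0) := by
    filter_upwards [eventually_isInvertible (W := R × (Fin (finrank ℝ K) → ℝ)) hCd.continuousAt hCi,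
      hker, hT, hTβ] with z hz hkz hTz hTβz
    refine hz.injective ?_
    rw [hz.self_apply_inverse, hCapp, hTz]
    refine Prod.ext rfl (funext fun i => ?_)
    exact hTβz _ (hkz _)
  refine DifferentiableAt.congr_of_eventuallyEq ?_ hTC
  exact differentiableAt_inverse_apply (W := R × (Fin (finrank ℝ K) → ℝ)) hCd hCi
    ((Q.differentiableAt.comp y hw).prodMk (differentiableAt_const _))

end ConstantRank

end HarmonicSoliton

end

noncomputable section

open scoped Manifold ContDiff Topology
set_option linter.unusedSectionVars false

namespace HarmonicSoliton

/-! ### Existence, uniqueness and differentiability of the torsion -/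

section Torsion

open Filter Module

variable {n p q : ℕ}

theorem differentiableAt_of_constant_rank₂ {E Z Y Y' : Type*} [NormedAddCommGroup E]
    [NormedSpace ℝ E] [NormedAddCommGroup Z] [NormedSpace ℝ Z] [FiniteDimensional ℝ Z]
    [NormedAddCommGroup Y] [NormedSpace ℝ Y] [NormedAddCommGroup Y'] [NormedSpace ℝ Y']
    {y : E} {D : E → Z →ₗ[ℝ] Y} {D' : E → Z →ₗ[ℝ] Y'} {w' : E → Y'} {T : E → Z}
    {H : E → Submodule ℝ Z} {β : Z →ₗ[ℝ] Z →ₗ[ℝ] ℝ}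
    (hH : ∀ z A, A ∈ H z ↔ D z A = 0 ∧ D' z A = 0)
    (hD : ∀ A, DifferentiableAt ℝ (fun z => D z A) y)
    (hD' : ∀ A, DifferentiableAt ℝ (fun z => D' z A) y) (hw : DifferentiableAt ℝ w' y)
    (hβ : ∀ k ∈ H y, β k k = 0 → k = 0)
    (hdim : ∀ᶠ z in 𝓝 y, finrank ℝ (H z) = finrank ℝ (H y))
    (hT : ∀ᶠ z in 𝓝 y, D z (T z) = 0) (hT' : ∀ᶠ z in 𝓝 y, D' z (T z) = w' z)
    (hTβ : ∀ᶠ z in 𝓝 y, ∀ k ∈ H z, β (T z) k = 0) :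
    DifferentiableAt ℝ T y := by
  have hker : ∀ z, LinearMap.ker ((D z).prod (D' z)) = H z := fun z => by
    ext A
    rw [hH, LinearMap.mem_ker, LinearMap.prod_apply]
    exact Prod.mk_eq_zero
  refine differentiableAt_of_constant_rank (D := fun z => (D z).prod (D' z))
    (w := fun z => (0, w' z)) (β := β) (fun A => (hD A).prodMk (hD' A))
    ((differentiableAt_const _).prodMk hw) ?_ ?_ ?_ ?_
  · intro k hk h
    rw [hker] at hk
    exact hβ k hk (h k (by rw [hker]; exact hk))
  · filter_upwards [hdim] with z hz
    rw [hker, hker, hz]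
  · filter_upwards [hT, hT'] with z h1 h2
    exact Prod.ext h1 h2
  · filter_upwards [hTβ] with z hz k hk
    rw [hker] at hk
    exact hz k hk

theorem bilDiamond_eq_zero_iff {A : EndT n} {b : Bil n} : bilDiamond A b = 0 ↔ IsSkew b A := by
  constructor
  · intro h u v
    have h1 : bilDiamond A b u v = 0 := by rw [h]; rfl
    rw [bilDiamond_apply] at h1
    linarith
  · intro h
    refine ContinuousLinearMap.ext fun u => ContinuousLinearMap.ext fun v => ?_
    rw [bilDiamond_apply, h u v, neg_add_cancel]
    rfl

theorem bilDiamond_sub_left (A B : EndT n) (b : Bil n) :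
    bilDiamond (A - B) b = bilDiamond A b - bilDiamond B b := by
  ext u v
  simp only [bilDiamond_apply, sub_apply, map_sub]
  ring

/-- Conjugation as a linear map. -/
def conjLinear (L : EndT n) : EndT n →ₗ[ℝ] EndT n where
  toFun A := conjEnd L A
  map_add' A B := by
    ext u
    simp [conjEnd]
  map_smul' a A := by
    ext u
    simp [conjEnd]

theorem conjEnd_injective {L : EndT n} (hL : L.IsInvertible) :
    Function.Injective (conjLinear L) := by
  refine (injective_iff_map_eq_zero _).2 fun A hA => ?_
  have h1 := comp_conjEnd hL A
  have h2 : conjEnd L A = 0 := hA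
  rw [h2] at h1
  ext1 u
  obtain ⟨u, rfl⟩ := hL.surjective u
  have h3 := congrArg (fun T : EndT n => T u) h1
  simpa using h3.symm

/-- Conjugation by the transition between two adapted frames embeds one stabiliser algebra in the
other. Used in both directions, this provides the constant rank. -/
theorem finrank_hSub_le {ξ₀ ξ ξ' : Tensor n p q} {b b' : Bil n} {e e' : EndT n}
    (h : IsAdaptedFrame ξ₀ b ξ e) (h' : IsAdaptedFrame ξ₀ b' ξ' e') :
    finrank ℝ (hSub b ξ) ≤ finrank ℝ (hSub b' ξ') := by
  obtain ⟨h1, h2⟩ := h.transition h'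
  have hL : (e.comp e'.inverse).IsInvertible := h.inv.comp h'.inv.inverse
  refine LinearMap.finrank_le_finrank_of_injective
    (f := ((conjLinear (e.comp e'.inverse)).restrict (p := hSub b ξ) (q := hSub b' ξ')
      fun A hA => ?_)) ?_
  · refine conjEnd_mem_hSpace (κ := 1) (l := 1) (ξ := ξ) hL one_ne_zero (fun u v => ?_) ?_ hA
    · rw [← h1, one_mul]
      rfl
    · rw [h2]; module
  · intro A B hAB
    exact Subtype.ext (conjEnd_injective hL (congrArg Subtype.val hAB))

theorem IsAdaptedFrame.exists_isOrthFrame {ξ₀ ξ : Tensor n p q} {b : Bil n} {e : EndT n}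
    (h : IsAdaptedFrame ξ₀ b ξ e) : ∃ e' : Model n ≃L[ℝ] Model n, IsOrthFrame b e' := by
  obtain ⟨e', rfl⟩ := h.inv
  exact ⟨e', h.orth⟩

theorem contDiffAt_fderiv_eval₂ {E V W Z : Type*} [NormedAddCommGroup E] [NormedSpace ℝ E]
    [NormedAddCommGroup V] [NormedSpace ℝ V] [NormedAddCommGroup W] [NormedSpace ℝ W]
    [NormedAddCommGroup Z] [NormedSpace ℝ Z] {G : E → V →L[ℝ] W →L[ℝ] Z} {y : E}
    (hG : ContDiffAt ℝ ∞ G y) (a : E) (b : V) (c : W) :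
    ContDiffAt ℝ ∞ (fun z => fderiv ℝ G z a b c) y :=
  (((hG.fderiv_right (m := ∞) (by simp)).clm_apply contDiffAt_const).clm_apply
    contDiffAt_const).clm_apply contDiffAt_const

theorem contDiffAt_christoffelOf {G : Model n → Bil n} {y : Model n} (hG : IsMetricAt G y)
    (u : Model n) : ContDiffAt ℝ ∞ (fun z => christoffelOf G z u) y := by
  have hinv : ContDiffAt ℝ ∞ (fun z => (G z).inverse) y :=
    ContDiffAt.comp y hG.inv.contDiffAt_map_inverse hG.smooth
  have happ : ∀ a b c : Model n, ContDiffAt ℝ ∞ (fun z => fderiv ℝ G z a b c) y := fun a b c =>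
    contDiffAt_fderiv_eval₂ hG.smooth a b c
  have hform : ContDiffAt ℝ ∞ (fun z => (fderiv ℝ G z u + (fderiv ℝ G z).flip u -
      ((fderiv ℝ G z).flip u).flip : Bil n)) y :=
    contDiffAt_clm_of_apply fun v => contDiffAt_clm_of_apply fun w =>
      ((happ u v w).add (happ v u w)).sub (happ w u v)
  refine contDiffAt_clm_of_apply fun v => ?_
  exact (hinv.clm_apply (hform.clm_apply contDiffAt_const)).const_smul (1 / 2 : ℝ)

theorem christoffelOf_add (G : Model n → Bil n) (y u v : Model n) :
    christoffelOf G y (u + v) = christoffelOf G y u + christoffelOf G y v := by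
  ext1 w
  simp only [christoffelOf, map_add, smul_apply, ContinuousLinearMap.comp_apply, add_apply,
    sub_apply, map_sub, ContinuousLinearMap.flip_apply]
  have h : ((fderiv ℝ G y).flip u + (fderiv ℝ G y).flip v).flip w =
      ((fderiv ℝ G y).flip u).flip w + ((fderiv ℝ G y).flip v).flip w := rfl
  rw [h, map_add]
  module

theorem christoffelOf_smul (G : Model n → Bil n) (y : Model n) (a : ℝ) (u : Model n) :
    christoffelOf G y (a • u) = a • christoffelOf G y u := by
  ext1 w
  simp only [christoffelOf, map_smul, smul_apply, ContinuousLinearMap.comp_apply, add_apply,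
    sub_apply, map_sub, map_add, ContinuousLinearMap.flip_apply]
  have h : (a • (fderiv ℝ G y).flip u).flip w = a • ((fderiv ℝ G y).flip u).flip w := rfl
  rw [h, map_smul]
  module

/-- The Levi-Civita connection is metric. -/
theorem fderiv_eq_bilDiamond_christoffelOf {G : Model n → Bil n} {y : Model n}
    (hG : IsMetricAt G y) (u : Model n) :
    fderiv ℝ G y u = bilDiamond (christoffelOf G y u) (G y) := by
  refine ContinuousLinearMap.ext fun v => ContinuousLinearMap.ext fun w => ?_
  rw [bilDiamond_apply, christoffelOf_spec hG.inv, hG.symm.self_of_nhds v,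
    christoffelOf_spec hG.inv]
  linear_combination (1 / 2) * hG.fderiv_symm u v w

variable {M : Type*} [TopologicalSpace M] [ChartedSpace (Model n) M]
  [IsManifold 𝓘(ℝ, Model n) ∞ M] {g : RiemMetric n M} {ξ₀ : Tensor n p q} {ξ : M → Tensor n p q}

theorem christoffel_add (g : RiemMetric n M) (x : M) (y u v : Model n) :
    christoffel g x y (u + v) = christoffel g x y u + christoffel g x y v :=
  christoffelOf_add _ y u v

theorem christoffel_smul (g : RiemMetric n M) (x : M) (y : Model n) (a : ℝ) (u : Model n) :
    christoffel g x y (a • u) = a • christoffel g x y u :=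
  christoffelOf_smul _ y a u

theorem covDeriv_add_right (g : RiemMetric n M) (ξ : M → Tensor n p q) (x : M) (u v : Model n) :
    covDeriv g ξ x (u + v) = covDeriv g ξ x u + covDeriv g ξ x v := by
  rw [covDeriv_eq, covDeriv_eq, covDeriv_eq, christoffel_add, diamond_add_left,
    ContinuousLinearMap.map_add]
  abel

theorem covDeriv_smul_right (g : RiemMetric n M) (ξ : M → Tensor n p q) (x : M) (a : ℝ)
    (u : Model n) : covDeriv g ξ x (a • u) = a • covDeriv g ξ x u := by
  rw [covDeriv_eq, covDeriv_eq, christoffel_smul, diamond_smul_left,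
    ContinuousLinearMap.map_smul]
  module

/-- `ξ` is smooth and has an adapted orthonormal frame at every point. -/
structure IsAdaptedField (ξ₀ : Tensor n p q) (g : RiemMetric n M) (ξ : M → Tensor n p q) :
    Prop where
  smooth : SmoothTensorField ξ
  frame : ∀ x, ∃ e, IsAdaptedFrame ξ₀ (g.at x) (ξ x) e

theorem IsHStructure.isAdaptedField {o : ManifoldOrientation n M} (h : IsHStructure ξ₀ g o ξ) :
    IsAdaptedField ξ₀ g ξ where
  smooth := h.smooth
  frame x := by
    obtain ⟨e, h1, -, h2⟩ := h.frame x
    exact ⟨e, ContinuousLinearMap.isInvertible_equiv, h1, h2⟩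

theorem IsAdaptedField.exists_isOrthFrame (h : IsAdaptedField ξ₀ g ξ) (x : M) :
    ∃ e : Model n ≃L[ℝ] Model n, IsOrthFrame (g.at x) e := by
  obtain ⟨e, he⟩ := h.frame x
  exact he.exists_isOrthFrame

theorem IsAdaptedField.frame_inChart (h : IsAdaptedField ξ₀ g ξ) {x₀ : M} {y : Model n}
    (hy : y ∈ (extChartAt 𝓘(ℝ, Model n) x₀).target) :
    ∃ e, IsAdaptedFrame ξ₀ (metricInChart g x₀ y) (tensorInChart ξ x₀ y) e := by
  obtain ⟨e, he⟩ := h.frame ((extChartAt 𝓘(ℝ, Model n) x₀).symm y)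
  have hi := chartFrame_isInvertible hy
  refine ⟨(chartFrame x₀ y).inverse.comp e, hi.inverse.comp he.inv, fun u v => ?_, ?_⟩
  · rw [metricInChart_apply, ContinuousLinearMap.comp_apply, ContinuousLinearMap.comp_apply,
      hi.self_apply_inverse, hi.self_apply_inverse, he.orth]
  · rw [tensorInChart, ← pullback_comp hi, ← ContinuousLinearMap.comp_assoc,
      hi.self_comp_inverse, ContinuousLinearMap.id_comp, he.pullback]

/-- In the chart the pair (metric, tensor) stays in one orbit, so one `A` gives both derivatives in
the direction `u`. The connection being metric, `A - Γ_u` is skew, and `∇_u ξ` is its action on `ξ`.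
Removing the part in `𝔥` does not change this action. -/
theorem IsAdaptedField.exists_torsion_apply (h : IsAdaptedField ξ₀ g ξ) (x : M) (u : Model n) :
    ∃ A ∈ mSpace (g.at x) (ξ x), covDeriv g ξ x u = diamond A (ξ x) := by
  have hy := mem_extChartAt_target (I := 𝓘(ℝ, Model n)) x
  have hG := isMetricAt_metricInChart g hy
  obtain ⟨A, hA1, hA2⟩ := exists_fderiv_eq_diamond (ξ₀ := ξ₀) hG.differentiableAt
    ((h.smooth.contDiffAt hy).differentiableAt (by simp))
    (by filter_upwards [target_mem_nhds hy] with z hz using h.frame_inChart hz) u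
  rw [fderiv_eq_bilDiamond_christoffelOf hG, metricInChart_self] at hA1
  rw [tensorInChart_self] at hA2
  have hskew : IsSkew (g.at x) (A - christoffel g x (extChartAt 𝓘(ℝ, Model n) x x) u) := by
    rw [← bilDiamond_eq_zero_iff]
    rw [bilDiamond_sub_left]
    exact sub_eq_zero.2 hA1.symm
  obtain ⟨e, he⟩ := h.exists_isOrthFrame x
  obtain ⟨B, hB, hBA⟩ := exists_mSpace_of_isSkew he (ξ x) hskew
  refine ⟨B, hB, ?_⟩
  have h2 := hBA.2
  rw [diamond_sub_left, diamond_sub_left] at h2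
  rw [covDeriv_eq, hA2]
  exact sub_eq_zero.1 h2

/-- Uniqueness in `𝔪` makes the pointwise choices linear in `u`; so the map sought in the definition
of `torsion` exists, and the choice operator returns it. -/
theorem IsAdaptedField.torsion_spec (h : IsAdaptedField ξ₀ g ξ) (x : M) (u : Model n) :
    torsion g ξ x u ∈ mSpace (g.at x) (ξ x) ∧ covDeriv g ξ x u = diamond (torsion g ξ x u) (ξ x) := by
  choose A hA hA' using h.exists_torsion_apply x
  obtain ⟨e, he⟩ := h.exists_isOrthFrame x
  have hadd : ∀ u v, A (u + v) = A u + A v := fun u v => by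
    refine eq_of_diamond_eq he (hA _) (add_mem_mSpace (hA u) (hA v)) ?_
    rw [← hA', covDeriv_add_right, hA', hA', diamond_add_left]
  have hsmul : ∀ (a : ℝ) u, A (a • u) = a • A u := fun a u => by
    refine eq_of_diamond_eq he (hA _) (smul_mem_mSpace a (hA u)) ?_
    rw [← hA', covDeriv_smul_right, hA', diamond_smul_left]
  have hex : ∃ T : Model n →L[ℝ] EndT n,
      ∀ u, T u ∈ mSpace (g.at x) (ξ x) ∧ covDeriv g ξ x u = diamond (T u) (ξ x) :=
    ⟨LinearMap.toContinuousLinearMap ⟨⟨A, hadd⟩, hsmul⟩, fun u => ⟨hA u, hA' u⟩⟩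
  exact Classical.epsilon_spec hex u

theorem IsAdaptedField.torsion_eq (h : IsAdaptedField ξ₀ g ξ) {x : M} {u : Model n} {A : EndT n}
    (hA : A ∈ mSpace (g.at x) (ξ x)) (hA' : covDeriv g ξ x u = diamond A (ξ x)) :
    torsion g ξ x u = A := by
  obtain ⟨e, he⟩ := h.exists_isOrthFrame x
  have hT := h.torsion_spec x u
  exact eq_of_diamond_eq he hT.1 hA (hT.2.symm.trans hA')

theorem endFormInChart_eq_conjEnd (S : M → Model n →L[ℝ] EndT n) (x₀ : M) (y u : Model n) :
    endFormInChart S x₀ y u = conjEnd (chartFrame x₀ y)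
      (S ((extChartAt 𝓘(ℝ, Model n) x₀).symm y) (chartFrame x₀ y u)) := rfl

theorem IsAdaptedField.torsion_inChart (h : IsAdaptedField ξ₀ g ξ) {x₀ : M} {y : Model n}
    (hy : y ∈ (extChartAt 𝓘(ℝ, Model n) x₀).target) (u : Model n) :
    endFormInChart (torsion g ξ) x₀ y u ∈ mSpace (metricInChart g x₀ y) (tensorInChart ξ x₀ y) ∧
      diamond (endFormInChart (torsion g ξ) x₀ y u) (tensorInChart ξ x₀ y) =
        fderiv ℝ (tensorInChart ξ x₀) y u -
          diamond (christoffel g x₀ y u) (tensorInChart ξ x₀ y) := by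
  have hi := chartFrame_isInvertible hy
  have hT := h.torsion_spec ((extChartAt 𝓘(ℝ, Model n) x₀).symm y) (chartFrame x₀ y u)
  rw [endFormInChart_eq_conjEnd]
  constructor
  · refine conjEnd_mem_mSpace (κ := 1) (l := 1) hi one_ne_zero one_ne_zero (fun u v => ?_) ?_ hT.1
    · rw [one_mul]; rfl
    · rw [tensorInChart]; module
  · rw [covDeriv_inChart h.smooth hy, hT.2, pullback_diamond hi (comp_conjEnd hi _)]
    rfl

/-- In coordinates `T(u)` is determined by linear equations, skewness and `T(u) ⋄ ξ = ∇_u ξ`,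
together with orthogonality to their common kernel `𝔥`. The dimension of `𝔥` is constant. Without
differentiability, `fderiv` in the divergence would take a default value and naturality would have
no meaning. -/
theorem IsAdaptedField.differentiableAt_torsion (h : IsAdaptedField ξ₀ g ξ) (x : M) :
    DifferentiableAt ℝ (endFormInChart (torsion g ξ) x) (extChartAt 𝓘(ℝ, Model n) x x) := by
  have hy := mem_extChartAt_target (I := 𝓘(ℝ, Model n)) x
  have hG := isMetricAt_metricInChart g hy
  have hξ := h.smooth.contDiffAt hy
  refine differentiableAt_clm_of_apply (W := EndT n) fun u => ?_
  have hw : ContDiffAt ℝ ∞ (fun z => fderiv ℝ (tensorInChart ξ x) z u -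
      diamond (christoffel g x z u) (tensorInChart ξ x z)) (extChartAt 𝓘(ℝ, Model n) x x) := by
    have h1 : ContDiffAt ℝ ∞ (fun z => fderiv ℝ (tensorInChart ξ x) z u)
        (extChartAt 𝓘(ℝ, Model n) x x) :=
      (hξ.fderiv_right (m := ∞) (by simp)).clm_apply contDiffAt_const
    exact h1.sub (contDiffAt_diamond (contDiffAt_christoffelOf hG u) hξ)
  refine differentiableAt_of_constant_rank₂ (Z := EndT n) (Y := Bil n)
    (Y' := Tensor n p q) (D := fun z => bilDiamondLinear (metricInChart g x z))
    (D' := fun z => diamondLinear (tensorInChart ξ x z))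
    (H := fun z => hSub (metricInChart g x z) (tensorInChart ξ x z)) (β := trForm n)
    (fun z A => ?_) (fun A => ?_) (fun A => ?_) (hw.differentiableAt (by simp)) ?_ ?_ ?_ ?_ ?_
  · exact and_congr bilDiamond_eq_zero_iff.symm Iff.rfl
  · refine differentiableAt_clm_of_apply fun a => differentiableAt_clm_of_apply fun b => ?_
    have h2 : ∀ a b, DifferentiableAt ℝ (fun z => metricInChart g x z a b)
        (extChartAt 𝓘(ℝ, Model n) x x) :=
      fun a b => (hasFDerivAt_eval₂ hG.differentiableAt a b).differentiableAt
    exact (h2 (A a) b).add (h2 a (A b))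
  · exact (contDiffAt_diamond (contDiffAt_const (c := A)) hξ).differentiableAt (by simp)
  · intro k hk h0
    obtain ⟨e, he⟩ := h.frame_inChart hy
    obtain ⟨e', he'⟩ := he.exists_isOrthFrame
    exact he'.trPair_self hk.1 h0
  · obtain ⟨e, he⟩ := h.frame_inChart hy
    filter_upwards [target_mem_nhds hy] with z hz
    obtain ⟨e', he'⟩ := h.frame_inChart hz
    exact le_antisymm (finrank_hSub_le he' he) (finrank_hSub_le he he')
  · filter_upwards [target_mem_nhds hy] with z hz
    exact bilDiamond_eq_zero_iff.2 (h.torsion_inChart hz u).1.1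
  · filter_upwards [target_mem_nhds hy] with z hz
    exact (h.torsion_inChart hz u).2
  · filter_upwards [target_mem_nhds hy] with z hz k hk
    exact (h.torsion_inChart hz u).1.2 k hk

end Torsion

end HarmonicSoliton

end

noncomputable section

open scoped Manifold ContDiff Topology
set_option linter.unusedSectionVars false

namespace HarmonicSoliton

/-! ### Naturality of the divergence, the torsion and the projected derivative -/

section NaturalityTorsion

open Module

variable {n p q : ℕ}

theorem conjEnd_eq_of_comp {L A B : EndT n} (hL : L.IsInvertible) (h : ∀ u, L (B u) = A (L u)) :
    B = conjEnd L A := by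
  ext1 u
  refine hL.injective ?_
  rw [h, apply_conjEnd hL]

theorem conjEnd_add (L A B : EndT n) : conjEnd L (A + B) = conjEnd L A + conjEnd L B :=
  (conjLinear L).map_add A B

theorem conjEnd_sub (L A B : EndT n) : conjEnd L (A - B) = conjEnd L A - conjEnd L B := by
  ext u
  simp [conjEnd]

theorem conjEnd_smul (L : EndT n) (a : ℝ) (A : EndT n) : conjEnd L (a • A) = a • conjEnd L A :=
  (conjLinear L).map_smul a A

theorem conjEnd_sum {ι : Type*} (s : Finset ι) (L : EndT n) (A : ι → EndT n) :
    conjEnd L (∑ i ∈ s, A i) = ∑ i ∈ s, conjEnd L (A i) :=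
  map_sum (conjLinear L) A s

theorem sum_proj_smul_single (u : Model n) :
    u = ∑ j, (EuclideanSpace.proj j : Model n →L[ℝ] ℝ) u • EuclideanSpace.single j (1 : ℝ) := by
  have h := (EuclideanSpace.basisFun (Fin n) ℝ).sum_repr u
  simpa using h.symm

/-- The contraction of a vector with a covector does not depend on the basis. -/
theorem sum_contraction_comp {V : Type*} [AddCommGroup V] [Module ℝ V]
    (B : Model n →ₗ[ℝ] (Model n →L[ℝ] ℝ) →ₗ[ℝ] V) {L : EndT n} (hL : L.IsInvertible) :
    ∑ i, B (L (EuclideanSpace.single i 1))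
        ((EuclideanSpace.proj i : Model n →L[ℝ] ℝ).comp L.inverse) =
      ∑ i, B (EuclideanSpace.single i 1) (EuclideanSpace.proj i : Model n →L[ℝ] ℝ) := by
  have h1 : ∀ i, B (L (EuclideanSpace.single i 1))
      ((EuclideanSpace.proj i : Model n →L[ℝ] ℝ).comp L.inverse) =
      ∑ j, (EuclideanSpace.proj j : Model n →L[ℝ] ℝ) (L (EuclideanSpace.single i 1)) •
        B (EuclideanSpace.single j 1)
          ((EuclideanSpace.proj i : Model n →L[ℝ] ℝ).comp L.inverse) := by
    intro i
    conv_lhs => rw [sum_proj_smul_single (L (EuclideanSpace.single i 1))]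
    simp only [map_sum, map_smul, LinearMap.sum_apply, LinearMap.smul_apply]
  have h2 : ∀ j, (EuclideanSpace.proj j : Model n →L[ℝ] ℝ) =
      ∑ i, (EuclideanSpace.proj j : Model n →L[ℝ] ℝ) (L (EuclideanSpace.single i 1)) •
        (EuclideanSpace.proj i : Model n →L[ℝ] ℝ).comp L.inverse := by
    intro j
    ext1 u
    obtain ⟨u, rfl⟩ := hL.surjective u
    conv_lhs => rw [sum_proj_smul_single u]
    simp only [map_sum, map_smul, sum_apply, smul_apply,
      ContinuousLinearMap.comp_apply, hL.inverse_apply_self, smul_eq_mul]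
    exact Finset.sum_congr rfl fun i _ => mul_comm _ _
  simp only [h1]
  rw [Finset.sum_comm]
  refine Finset.sum_congr rfl fun j _ => ?_
  conv_rhs => rw [h2 j]
  simp only [map_sum, map_smul]

variable {M : Type*} [TopologicalSpace M] [ChartedSpace (Model n) M]
  [IsManifold 𝓘(ℝ, Model n) ∞ M] {g : RiemMetric n M} {ξ₀ ξ₀' : Tensor n p q}
  {ξ ξ' : M → Tensor n p q} {f : M → M} {κ l : ℝ}

theorem covDerivEndForm_eq (g : RiemMetric n M) (S : M → Model n →L[ℝ] EndT n) (x : M)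
    (u v : Model n) : covDerivEndForm g S x u v =
      fderiv ℝ (endFormInChart S x) (extChartAt 𝓘(ℝ, Model n) x x) u v +
        (christoffel g x (extChartAt 𝓘(ℝ, Model n) x x) u).comp (S x v) -
        (S x v).comp (christoffel g x (extChartAt 𝓘(ℝ, Model n) x x) u) -
        S x (christoffel g x (extChartAt 𝓘(ℝ, Model n) x x) u v) := rfl

/-- `(u, v) ↦ (∇_u S)(v)` as a bilinear map. -/
def covDerivEndFormLinear (g : RiemMetric n M) (S : M → Model n →L[ℝ] EndT n) (x : M) :
    Model n →ₗ[ℝ] Model n →ₗ[ℝ] EndT n :=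
  LinearMap.mk₂ ℝ (covDerivEndForm g S x)
    (fun u u' v => by
      ext1 w
      simp only [covDerivEndForm_eq, christoffel_add, map_add, add_apply, sub_apply,
        ContinuousLinearMap.comp_apply]
      module)
    (fun a u v => by
      ext1 w
      simp only [covDerivEndForm_eq, christoffel_smul, map_smul, add_apply, sub_apply, smul_apply,
        ContinuousLinearMap.comp_apply]
      module)
    (fun u v v' => by
      ext1 w
      simp only [covDerivEndForm_eq, map_add, add_apply, sub_apply,
        ContinuousLinearMap.comp_apply]
      module)
    (fun a u v => by
      ext1 w
      simp only [covDerivEndForm_eq, map_smul, add_apply, sub_apply, smul_apply,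
        ContinuousLinearMap.comp_apply]
      module)

theorem covDerivEndFormLinear_apply (g : RiemMetric n M) (S : M → Model n →L[ℝ] EndT n) (x : M)
    (u v : Model n) : covDerivEndFormLinear g S x u v = covDerivEndForm g S x u v := rfl

/-- The covariant derivative is natural without a factor; the single `κ` comes from the inverse
metric in the contraction. -/
theorem divergence_pullback (hf : IsHomothety g κ f) {S S' : M → Model n →L[ℝ] EndT n}
    (hS : ∀ x, DifferentiableAt ℝ (endFormInChart S x) (extChartAt 𝓘(ℝ, Model n) x x))
    (hS' : ∀ x, DifferentiableAt ℝ (endFormInChart S' x) (extChartAt 𝓘(ℝ, Model n) x x))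
    (hSS' : ∀ x u, S' x u = conjEnd (dMap n f x) (S (f x) (dMap n f x u))) (x : M) :
    divergence g S' x = κ • conjEnd (dMap n f x) (divergence g S (f x)) := by
  have hi := hf.inv x
  have h1 : ∀ u v, covDerivEndForm g S' x u v =
      conjEnd (dMap n f x) (covDerivEndForm g S (f x) (dMap n f x u) (dMap n f x v)) :=
    fun u v => conjEnd_eq_of_comp hi fun w => covDerivEndForm_comp hf hS' hS
      (fun x v w => by rw [hSS', apply_conjEnd (hf.inv x)]) x u v w
  -- Dual form of `f^* g = κ g`: the metric dual of a covector is mapped to `κ` times the dual of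
  -- its push-forward. The resulting sum runs over a transported basis, which `sum_contraction_comp`
  -- changes back to the standard one.
  have h2 : ∀ i, dMap n f x ((g.at x).inverse (EuclideanSpace.proj i)) =
      κ • (g.at (f x)).inverse
        ((EuclideanSpace.proj i : Model n →L[ℝ] ℝ).comp (dMap n f x).inverse) := by
    intro i
    refine (g.at_isInvertible (f x)).injective (ContinuousLinearMap.ext fun w => ?_)
    obtain ⟨w, rfl⟩ := hi.surjective w
    rw [hf.metric, (g.at_isInvertible x).self_apply_inverse, map_smul, smul_apply,
      (g.at_isInvertible (f x)).self_apply_inverse, ContinuousLinearMap.comp_apply,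
      hi.inverse_apply_self, smul_eq_mul]
  have h3 := sum_contraction_comp ((covDerivEndFormLinear g S (f x)).compl₂
    ((g.at (f x)).inverse.toLinearMap)) hi
  simp only [LinearMap.compl₂_apply, covDerivEndFormLinear_apply] at h3
  have h4 : divergence g S (f x) = ∑ i, covDerivEndForm g S (f x) (EuclideanSpace.single i 1)
      ((g.at (f x)).inverse (EuclideanSpace.proj i)) := rfl
  rw [h4]
  refine Eq.trans ?_ (congrArg (fun A => κ • conjEnd (dMap n f x) A) h3)
  rw [← conjEnd_smul, Finset.smul_sum, conjEnd_sum]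
  refine Finset.sum_congr rfl fun i _ => ?_
  rw [h1, h2]
  refine congrArg (conjEnd (dMap n f x)) ?_
  exact (covDerivEndFormLinear g S (f x) (dMap n f x (EuclideanSpace.single i 1))).map_smul κ _

/-- The conjugated torsion lies in the new `𝔪` and satisfies the defining equation. That equation is
linear in the tensor, so the factor `l` drops out. -/
theorem torsion_pullback (hf : IsHomothety g κ f) (h : IsAdaptedField ξ₀ g ξ)
    (h' : IsAdaptedField ξ₀' g ξ') (hl : l ≠ 0) (hξ' : ∀ x, ξ' x = l • pullbackField f ξ x)
    (hs : SmoothTensorField (pullbackField f ξ)) (x : M) (u : Model n) :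
    torsion g ξ' x u = conjEnd (dMap n f x) (torsion g ξ (f x) (dMap n f x u)) := by
  have hT := h.torsion_spec (f x) (dMap n f x u)
  refine h'.torsion_eq ?_ ?_
  · exact conjEnd_mem_mSpace (hf.inv x) hf.ne_zero hl (hf.metric x) (hξ' x) hT.1
  · rw [funext hξ', covDeriv_smul g l hs, covDeriv_pullbackField hf h.smooth]
    have h1 : covDeriv g ξ (f x) (dMap n f x u) =
        diamond (torsion g ξ (f x) (dMap n f x u)) (ξ (f x)) := hT.2
    rw [h1, pullback_diamond (hf.inv x) (comp_conjEnd (hf.inv x) _), diamond_smul_right]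
    rfl

theorem nablaM_pullback (hf : IsHomothety g κ f) (h : IsAdaptedField ξ₀ g ξ)
    (h' : IsAdaptedField ξ₀' g ξ') (hl : l ≠ 0) (hξ' : ∀ x, ξ' x = l • pullbackField f ξ x)
    {X : (x : M) → TangentSpace 𝓘(ℝ, Model n) x} (hX : SmoothVectorField X)
    (hfX : ∀ x, dMap n f x (X x) = X (f x)) (x : M) :
    nablaM g ξ' X x = conjEnd (dMap n f x) (nablaM g ξ X (f x)) := by
  obtain ⟨e, he⟩ := h.exists_isOrthFrame (f x)
  obtain ⟨e', he'⟩ := h'.exists_isOrthFrame x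
  have hi := hf.inv x
  have hsp := mProj_spec he (ξ (f x)) (nabla g X (f x))
  have hn : nabla g X x = conjEnd (dMap n f x) (nabla g X (f x)) :=
    conjEnd_eq_of_comp hi fun u => nabla_comp hf hX hfX x u
  refine mProj_eq he' ?_ fun C hC => ?_
  · exact conjEnd_mem_mSpace hi hf.ne_zero hl (hf.metric x) (hξ' x) hsp.1
  -- Orthogonality is tested after carrying `C` back to `f x`, with the inverse scaling factors.
  · have hC' : conjEnd (dMap n f x).inverse C ∈ mSpace (g.at (f x)) (ξ (f x)) := by
      refine conjEnd_mem_mSpace (κ := κ⁻¹) (l := l⁻¹) hi.inverse (inv_ne_zero hf.ne_zero)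
        (inv_ne_zero hl) (fun u v => ?_) ?_ hC
      · obtain ⟨u, rfl⟩ := hi.surjective u
        obtain ⟨v, rfl⟩ := hi.surjective v
        rw [hi.inverse_apply_self, hi.inverse_apply_self, hf.metric, inv_mul_cancel_left₀ hf.ne_zero]
      · rw [hξ', pullback_smul, pullbackField_eq, pullback_inverse_pullback hi, smul_smul,
          inv_mul_cancel₀ hl, one_smul]
    have h1 := hsp.2 _ hC'
    rw [← trPair_conjEnd hi, conjEnd_conjEnd_inverse hi, conjEnd_sub, ← hn] at h1
    exact h1

end NaturalityTorsion

end HarmonicSoliton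

end

noncomputable section

open scoped Manifold ContDiff Topology
set_option linter.unusedSectionVars false

namespace HarmonicSoliton

/-! ### The local flow of a smooth vector field -/

section LocalFlow

open Filter

variable {n : ℕ}

/-- Makes the coordinate expression of a vector field globally smooth, as the theorem on parameters
requires, without changing it near `y`: the bump function is supported where `V` is smooth. -/
theorem exists_contDiff_cutoff {E : Type*} [NormedAddCommGroup E] [NormedSpace ℝ E]
    [HasContDiffBump E] {V : E → E} {U : Set E} {y : E} (hU : U ∈ 𝓝 y)
    (hV : ∀ z ∈ U, ContDiffAt ℝ ∞ V z) :
    ∃ v : E → E, ContDiff ℝ ∞ v ∧ ∃ r > 0, Metric.ball y r ⊆ U ∧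
      ∀ z ∈ Metric.ball y r, v z = V z := by
  obtain ⟨ε, hε, hεU⟩ := Metric.nhds_basis_closedBall.mem_iff.1 hU
  let f : ContDiffBump y := ⟨ε / 2, ε, by positivity, by linarith⟩
  refine ⟨fun z => f z • V z, ?_, ε / 2, by positivity, ?_, ?_⟩
  · rw [contDiff_iff_contDiffAt]
    intro z
    by_cases hz : z ∈ tsupport f
    · rw [f.tsupport_eq] at hz
      exact f.contDiffAt.smul (hV z (hεU hz))
    · have h0 : f =ᶠ[𝓝 z] 0 := notMem_tsupport_iff_eventuallyEq.1 hz
      refine (contDiffAt_const (c := (0 : E))).congr_of_eventuallyEq ?_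
      filter_upwards [h0] with w hw
      rw [hw]
      simp
  · exact (Metric.ball_subset_ball (by linarith)).trans (Metric.ball_subset_closedBall.trans hεU)
  · intro z hz
    change f z • V z = V z
    rw [f.one_of_mem_closedBall (Metric.ball_subset_closedBall hz), one_smul]

variable {M : Type*} [TopologicalSpace M] [ChartedSpace (Model n) M]
  [IsManifold 𝓘(ℝ, Model n) ∞ M] {X : (x : M) → TangentSpace 𝓘(ℝ, Model n) x}

theorem chartFrame_vectorInChart {x₀ : M} {y : Model n}
    (hy : y ∈ (extChartAt 𝓘(ℝ, Model n) x₀).target) :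
    chartFrame x₀ y (vectorInChart X x₀ y) = X ((extChartAt 𝓘(ℝ, Model n) x₀).symm y) :=
  (chartFrame_isInvertible hy).self_apply_inverse _

/-- A solution of the equation in a chart is a solution on the manifold. -/
theorem hasMFDerivAt_chart_symm {x₀ : M} {γ : ℝ → Model n} {s a : ℝ}
    (hs : γ s ∈ (extChartAt 𝓘(ℝ, Model n) x₀).target)
    (hγ : HasDerivAt γ (a • vectorInChart X x₀ (γ s)) s) :
    HasMFDerivAt 𝓘(ℝ, ℝ) 𝓘(ℝ, Model n) (fun s => (extChartAt 𝓘(ℝ, Model n) x₀).symm (γ s)) s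
      ((1 : ℝ →L[ℝ] ℝ).smulRight (a • X ((extChartAt 𝓘(ℝ, Model n) x₀).symm (γ s)))) := by
  have h1 := ((contMDiffAt_chart_symm hs).mdifferentiableAt (by simp)).hasMFDerivAt
  have h2 : HasMFDerivAt 𝓘(ℝ, ℝ) 𝓘(ℝ, Model n) γ s
      ((1 : ℝ →L[ℝ] ℝ).smulRight (a • vectorInChart X x₀ (γ s))) := hγ.hasFDerivAt.hasMFDerivAt
  have h3 := h1.comp s h2
  have h4 : ContinuousLinearMap.comp (chartFrame x₀ (γ s))
      ((1 : ℝ →L[ℝ] ℝ).smulRight (a • vectorInChart X x₀ (γ s))) =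
      ((1 : ℝ →L[ℝ] ℝ).smulRight (a • chartFrame x₀ (γ s) (vectorInChart X x₀ (γ s)))) := by
    ext1
    simp
  rw [chartFrame_vectorInChart hs, chartFrame_eq_mfderiv hs] at h4
  exact h3.congr_mfderiv h4

/-- The time-one value of the integral curve of `ε X` is the time-`ε` value of that of `X`. So
smoothness of `ψ z 1` in `z = (ε, x)` is joint smoothness of the flow near time zero. The interval
`(-2, 2)` has the time `1` in its interior. -/
theorem exists_local_flow (hX : SmoothVectorField X) (x₀ : M) :
    ∃ ψ : ℝ × M → ℝ → M,
      ContMDiffAt (𝓘(ℝ, ℝ).prod 𝓘(ℝ, Model n)) 𝓘(ℝ, Model n) ∞ (fun z => ψ z 1) (0, x₀) ∧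
      ∀ᶠ z in 𝓝 ((0 : ℝ), x₀), ψ z 0 = z.2 ∧
        IsMIntegralCurveOn (ψ z) (z.1 • X) (Set.Ioo (-2) 2) := by
  set c := extChartAt 𝓘(ℝ, Model n) x₀ with hc
  have hy := mem_extChartAt_target (I := 𝓘(ℝ, Model n)) x₀
  obtain ⟨v, hv, r, hr, hrU, hvV⟩ := exists_contDiff_cutoff (target_mem_nhds hy)
    fun z hz => contDiffAt_vectorInChart hX hz
  obtain ⟨Γ, hΓ, hΓ0, hΓz⟩ := exists_smooth_rescaled_curves hv (c x₀)
  have hprod : ContMDiffAt (𝓘(ℝ, ℝ).prod 𝓘(ℝ, Model n)) 𝓘(ℝ, ℝ × Model n) ∞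
      (fun z : ℝ × M => (z.1, c z.2)) (0, x₀) :=
    contMDiffAt_fst.prodMk_space
      ((contMDiffAt_chart (mem_extChartAt_source x₀)).comp (0, x₀) contMDiffAt_snd)
  have hΓc : ContMDiffAt (𝓘(ℝ, ℝ).prod 𝓘(ℝ, Model n)) 𝓘(ℝ, C(CurveTime, Model n)) ∞
      (fun z : ℝ × M => Γ (z.1, c z.2)) (0, x₀) :=
    ContMDiffAt.comp (0, x₀) (g := Γ) (f := fun z : ℝ × M => (z.1, c z.2)) hΓ.contMDiffAt hprod
  have h1mem : (1 : ℝ) ∈ Set.Icc (-2 : ℝ) 2 := by constructor <;> norm_num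
  have hev : ∀ z, curveExtend (Γ z) 1 = ContinuousMap.evalCLM ℝ (⟨1, h1mem⟩ : CurveTime) (Γ z) :=
    fun z => Set.IccExtend_of_mem _ _ h1mem
  refine ⟨fun z s => c.symm (curveExtend (Γ (z.1, c z.2)) s), ?_, ?_⟩
  · have h2 : ContMDiffAt (𝓘(ℝ, ℝ).prod 𝓘(ℝ, Model n)) 𝓘(ℝ, Model n) ∞
        (fun z : ℝ × M => curveExtend (Γ (z.1, c z.2)) 1) (0, x₀) := by
      simp only [hev]
      exact (ContinuousLinearMap.contMDiffAt _).comp (0, x₀) hΓc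
    refine ContMDiffAt.comp (0, x₀) (g := c.symm) ?_ h2
    refine contMDiffAt_chart_symm ?_
    rw [hev, hΓ0]
    exact hy
  · have hcont : Tendsto (fun z : ℝ × M => (z.1, c z.2)) (𝓝 (0, x₀)) (𝓝 (0, c x₀)) :=
      hprod.continuousAt
    have hnear : ∀ᶠ z in 𝓝 ((0 : ℝ), c x₀), dist (Γ z) (ContinuousMap.const _ (c x₀)) < r := by
      have := hΓ.continuousAt.tendsto
      rw [hΓ0] at this
      exact this.eventually_mem (Metric.ball_mem_nhds _ hr)
    have hsrc : ∀ᶠ z : ℝ × M in 𝓝 ((0 : ℝ), x₀), z.2 ∈ c.source :=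
      continuousAt_snd.preimage_mem_nhds
        ((isOpen_extChartAt_source (I := 𝓘(ℝ, Model n)) x₀).mem_nhds (mem_extChartAt_source x₀))
    filter_upwards [hcont.eventually hΓz, hcont.eventually hnear, hsrc] with z h1 h2 h3
    refine ⟨?_, fun s hs => ?_⟩
    · rw [h1.1]
      exact c.left_inv h3
    -- The whole curve is uniformly close to the constant curve at `c x₀`, so it never leaves the
    -- ball where the cut-off field agrees with the original one.
    · have hball : curveExtend (Γ (z.1, c z.2)) s ∈ Metric.ball (c x₀) r :=
        lt_of_le_of_lt (ContinuousMap.dist_apply_le_dist (f := Γ (z.1, c z.2))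
          (g := ContinuousMap.const _ (c x₀)) _) h2
      have hd := h1.2 s hs
      rw [hvV _ hball] at hd
      exact (hasMFDerivAt_chart_symm (hrU hball) hd).hasMFDerivWithinAt

end LocalFlow

end HarmonicSoliton

end

noncomputable section

open scoped Manifold ContDiff Topology
set_option linter.unusedSectionVars false

namespace HarmonicSoliton

/-! ### Completeness, the global flow and its change of time -/

section GlobalFlow

open Filter

variable {n : ℕ} {M : Type*} [TopologicalSpace M] [ChartedSpace (Model n) M]
  [IsManifold 𝓘(ℝ, Model n) ∞ M] {X : (x : M) → TangentSpace 𝓘(ℝ, Model n) x}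

/-- `φ` is the global flow of the vector field `X`. -/
structure IsGlobalFlow (X : (x : M) → TangentSpace 𝓘(ℝ, Model n) x) (φ : ℝ → M → M) : Prop where
  zero : ∀ x, φ 0 x = x
  add : ∀ s h x, φ (s + h) x = φ h (φ s x)
  curve : ∀ x, IsMIntegralCurve (fun s => φ s x) X
  smooth : ContMDiff (𝓘(ℝ, ℝ).prod 𝓘(ℝ, Model n)) 𝓘(ℝ, Model n) ∞ (fun z : ℝ × M => φ z.1 z.2)

theorem SmoothVectorField.contMDiff_one (hX : SmoothVectorField X) :
    ContMDiff 𝓘(ℝ, Model n) (𝓘(ℝ, Model n)).tangent 1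
      (fun x => (⟨x, X x⟩ : TangentBundle 𝓘(ℝ, Model n) M)) :=
  ContMDiff.of_le hX (by simp)

theorem SmoothVectorField.const_smul (hX : SmoothVectorField X) (a : ℝ) :
    SmoothVectorField (a • X) :=
  ContMDiff.const_smul_section (I := 𝓘(ℝ, Model n)) (F := Model n)
    (V := fun x : M => TangentSpace 𝓘(ℝ, Model n) x) (a := a) hX

theorem smulRight_one_comp_smulRight_one {E : Type*} [NormedAddCommGroup E] [NormedSpace ℝ E]
    (v : E) (a : ℝ) : ((1 : ℝ →L[ℝ] ℝ).smulRight v).comp ((1 : ℝ →L[ℝ] ℝ).smulRight a) =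
      (1 : ℝ →L[ℝ] ℝ).smulRight (a • v) := by
  ext1
  simp

section

variable [T2Space M]

/-- On a compact manifold every smooth vector field is complete. -/
theorem SmoothVectorField.isComplete_of_compactSpace [CompactSpace M] (hX : SmoothVectorField X) :
    IsCompleteVectorField X := by
  have hloc : ∀ x₀ : M, ∃ U ∈ 𝓝 x₀, ∃ ε > 0, ∀ x ∈ U, ∃ γ : ℝ → M, γ 0 = x ∧
      IsMIntegralCurveOn γ X (Set.Ioo (-ε) ε) := by
    intro x₀
    obtain ⟨ψ, -, hψ⟩ := exists_local_flow hX x₀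
    rw [nhds_prod_eq, eventually_prod_iff] at hψ
    obtain ⟨pa, ha, pb, hb, hψ⟩ := hψ
    have hpos : ∀ᶠ s : ℝ in 𝓝[>] 0, pa s ∧ 0 < s :=
      (ha.filter_mono nhdsWithin_le_nhds).and self_mem_nhdsWithin
    obtain ⟨s, hs, hs0⟩ := hpos.exists
    -- For a fixed small `s > 0`, slowing down the integral curve of `s X` gives one of `X` on
    -- `(-2s, 2s)`, for all `x` near `x₀`. Compactness then yields an existence time common to all
    -- points.
    refine ⟨{x | pb x}, hb, s, hs0, fun x hx => ⟨ψ (s, x) ∘ (· * s⁻¹), ?_, ?_⟩⟩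
    · simpa using (hψ hs hx).1
    · have h1 := (hψ hs hx).2.comp_mul s⁻¹
      have h2 : s⁻¹ • s • X = X := by rw [smul_smul, inv_mul_cancel₀ hs0.ne', one_smul]
      simp only [h2] at h1
      refine h1.mono fun t ht => ?_
      have h3 : s * s⁻¹ = 1 := mul_inv_cancel₀ hs0.ne'
      have h4 : 0 < s⁻¹ := inv_pos.2 hs0
      constructor <;> nlinarith [ht.1, ht.2]
  choose U hU ε hε hγ using hloc
  obtain ⟨F, hF⟩ := finite_cover_nhds hU
  obtain ⟨δ, hδ, hδF⟩ : ∃ δ > 0, ∀ x ∈ F, δ ≤ ε x := by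
    rcases F.eq_empty_or_nonempty with h | h
    · exact ⟨1, one_pos, by simp [h]⟩
    · exact ⟨F.inf' h ε, (Finset.lt_inf'_iff _).2 fun x _ => hε x, fun x hx => F.inf'_le _ hx⟩
  refine fun x => exists_isMIntegralCurve_of_isMIntegralCurveOn hX.contMDiff_one hδ (fun y => ?_) x
  have hy : y ∈ ⋃ x ∈ F, U x := hF ▸ Set.mem_univ y
  simp only [Set.mem_iUnion] at hy
  obtain ⟨x, hx, hyx⟩ := hy
  obtain ⟨γ, h0, h1⟩ := hγ x y hyx
  exact ⟨γ, h0, h1.mono (Set.Ioo_subset_Ioo (neg_le_neg (hδF x hx)) (hδF x hx))⟩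

/-- Uniqueness of integral curves gives the group law and identifies the flow near time zero with
the smooth local one. An open-and-closed argument along each integral curve makes every time slice
smooth. Joint smoothness follows from `φ_r = φ_{r-s} ∘ φ_s`, with `r - s` near zero. -/
theorem exists_isGlobalFlow (hX : SmoothVectorField X) (hc : IsCompleteVectorField X) :
    ∃ φ : ℝ → M → M, IsGlobalFlow X φ := by
  choose γ hγ0 hγ using hc
  have hadd : ∀ s h x, γ x (s + h) = γ (γ x s) h := by
    intro s h x
    have h1 := (hγ x).comp_add s
    have h2 := isMIntegralCurve_Ioo_eq_of_contMDiff_boundaryless (t₀ := 0) hX.contMDiff_one h1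
      (hγ (γ x s)) (by simp [hγ0])
    rw [add_comm]
    exact congrFun h2 h
  have hsm0 : ∀ x₀, ContMDiffAt (𝓘(ℝ, ℝ).prod 𝓘(ℝ, Model n)) 𝓘(ℝ, Model n) ∞
      (fun z : ℝ × M => γ z.2 z.1) (0, x₀) := by
    intro x₀
    obtain ⟨ψ, hψs, hψ⟩ := exists_local_flow hX x₀
    refine hψs.congr_of_eventuallyEq ?_
    filter_upwards [hψ] with z hz
    have h1 := (((hγ z.2).comp_mul z.1).isMIntegralCurveOn (Set.Ioo (-2) 2))
    have h2 := isMIntegralCurveOn_Ioo_eqOn_of_contMDiff_boundaryless (t₀ := 0)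
      (by constructor <;> norm_num) (hX.const_smul z.1).contMDiff_one h1 hz.2
      (by simp [hγ0, hz.1])
    simpa using h2 (show (1 : ℝ) ∈ Set.Ioo (-2 : ℝ) 2 by constructor <;> norm_num)
  have hslice : ∀ s x, ContMDiffAt 𝓘(ℝ, Model n) 𝓘(ℝ, Model n) ∞ (fun x => γ x s) x := by
    intro s x
    -- The argument runs at each finite order `m`, because being `C^m` at a point is an open
    -- condition only for finite `m`.
    rw [contMDiffAt_infty]
    intro m
    -- For `s` near `s₁` each of the two slices is the other followed by a flow map of short time,
    -- which is `C^m` at the relevant point. The equivalence makes the set of good times both open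
    -- and closed.
    have hdich : ∀ s₁, ∀ᶠ s in 𝓝 s₁,
        (ContMDiffAt 𝓘(ℝ, Model n) 𝓘(ℝ, Model n) m (fun x => γ x s₁) x ↔
          ContMDiffAt 𝓘(ℝ, Model n) 𝓘(ℝ, Model n) m (fun x => γ x s) x) := by
      intro s₁
      have h1 := (contMDiffAt_iff_contMDiffAt_nhds (by simp)).1
        ((hsm0 (γ x s₁)).of_le (m := (m : WithTop ℕ∞)) (by exact_mod_cast le_top))
      have hcont := (hγ x).continuous.continuousAt (x := s₁)
      have ht1 : Tendsto (fun s => (s - s₁, γ x s₁)) (𝓝 s₁) (𝓝 (0, γ x s₁)) := by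
        refine Tendsto.prodMk_nhds ?_ tendsto_const_nhds
        exact Continuous.tendsto' (by fun_prop) _ _ (sub_self s₁)
      have ht2 : Tendsto (fun s => (s₁ - s, γ x s)) (𝓝 s₁) (𝓝 (0, γ x s₁)) := by
        refine Tendsto.prodMk_nhds ?_ hcont
        exact Continuous.tendsto' (by fun_prop) _ _ (sub_self s₁)
      have key : ∀ a b, ContMDiffAt (𝓘(ℝ, ℝ).prod 𝓘(ℝ, Model n)) 𝓘(ℝ, Model n) m
          (fun z : ℝ × M => γ z.2 z.1) (b - a, γ x a) →
          ContMDiffAt 𝓘(ℝ, Model n) 𝓘(ℝ, Model n) m (fun x => γ x a) x →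
          ContMDiffAt 𝓘(ℝ, Model n) 𝓘(ℝ, Model n) m (fun x => γ x b) x := by
        intro a b hb ha
        have h3 := ContMDiffAt.comp x (g := fun z : ℝ × M => γ z.2 z.1)
          (f := fun x => (b - a, γ x a)) hb (contMDiffAt_const.prodMk ha)
        refine h3.congr_of_eventuallyEq (Eventually.of_forall fun y => ?_)
        change γ y b = γ (γ y a) (b - a)
        rw [← hadd]
        congr 1
        ring
      filter_upwards [ht1.eventually h1, ht2.eventually h1] with s hs1 hs2
      exact ⟨key _ _ hs1, key _ _ hs2⟩
    have hclopen : IsClopen {s | ContMDiffAt 𝓘(ℝ, Model n) 𝓘(ℝ, Model n) m (fun x => γ x s) x} := by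
      refine ⟨⟨?_⟩, ?_⟩ <;> rw [isOpen_iff_mem_nhds] <;> intro s₁ hs₁ <;>
        filter_upwards [hdich s₁] with s hs
      · exact fun h => hs₁ (hs.2 h)
      · exact hs.1 hs₁
    have h0 : (0 : ℝ) ∈ {s | ContMDiffAt 𝓘(ℝ, Model n) 𝓘(ℝ, Model n) m (fun x => γ x s) x} := by
      simp only [Set.mem_ofPred_eq, hγ0]
      exact contMDiffAt_id
    exact (Set.ext_iff.1 (hclopen.eq_univ ⟨0, h0⟩) s).2 (Set.mem_univ s)
  refine ⟨fun s x => γ x s, hγ0, hadd, hγ, fun z => ?_⟩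
  obtain ⟨s, x⟩ := z
  have h0 : s - s = 0 := sub_self s
  have h3 := ContMDiffAt.comp (s, x) (g := fun z : ℝ × M => γ z.2 z.1)
    (f := fun z : ℝ × M => (z.1 - s, γ z.2 s)) (by simpa only [h0] using hsm0 (γ x s))
    ((contMDiffAt_fst.sub contMDiffAt_const).prodMk
      ((hslice s x).comp (s, x) contMDiffAt_snd))
  refine h3.congr_of_eventuallyEq (Eventually.of_forall fun y => ?_)
  change γ y.2 y.1 = γ (γ y.2 s) (y.1 - s)
  rw [← hadd]
  congr 1
  ring

end

namespace IsGlobalFlow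

variable {φ : ℝ → M → M} (hφ : IsGlobalFlow X φ)
include hφ

theorem neg_apply (s : ℝ) (x : M) : φ (-s) (φ s x) = x := by
  rw [← hφ.add, add_neg_cancel, hφ.zero]

theorem apply_neg (s : ℝ) (x : M) : φ s (φ (-s) x) = x := by
  rw [← hφ.add, neg_add_cancel, hφ.zero]

theorem contMDiff (s : ℝ) : ContMDiff 𝓘(ℝ, Model n) 𝓘(ℝ, Model n) ∞ (φ s) :=
  hφ.smooth.comp (contMDiff_const.prodMk contMDiff_id)

theorem mdifferentiableAt (s : ℝ) (x : M) :
    MDifferentiableAt 𝓘(ℝ, Model n) 𝓘(ℝ, Model n) (φ s) x :=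
  (hφ.contMDiff s x).mdifferentiableAt (by simp)

omit hφ in
/-- The flow at time `s`, as a diffeomorphism. -/
def toDiffeo (hφ : IsGlobalFlow X φ) (s : ℝ) : M ≃ₘ^∞⟮𝓘(ℝ, Model n), 𝓘(ℝ, Model n)⟯ M where
  toFun := φ s
  invFun := φ (-s)
  left_inv := hφ.neg_apply s
  right_inv := hφ.apply_neg s
  contMDiff_toFun := hφ.contMDiff s
  contMDiff_invFun := hφ.contMDiff (-s)

theorem dMap_add (s h : ℝ) (x : M) :
    dMap n (φ (s + h)) x = (dMap n (φ h) (φ s x)).comp (dMap n (φ s) x) := by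
  have h1 : φ (s + h) = φ h ∘ φ s := funext fun x => hφ.add s h x
  rw [h1]
  exact mfderiv_comp x (hφ.mdifferentiableAt h _) (hφ.mdifferentiableAt s x)

theorem dMap_zero (x : M) : dMap n (φ 0) x = ContinuousLinearMap.id ℝ (Model n) := by
  have h1 : φ 0 = id := funext hφ.zero
  rw [h1]
  exact dMap_id x

theorem isInvertible_dMap (s : ℝ) (x : M) : (dMap n (φ s) x).IsInvertible := by
  have h := hφ.dMap_add (-s) s (φ s x)
  rw [neg_add_cancel, hφ.dMap_zero, hφ.neg_apply] at h
  exact isInvertible_of_comp_eq_id h.symm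

/-- A vector field is invariant under its flow. -/
theorem dMap_apply (s : ℝ) (x : M) : dMap n (φ s) x (X x) = X (φ s x) := by
  have h1 := hφ.curve x 0
  have h2 := (hφ.curve (φ s x)) 0
  have h3 : HasMFDerivAt 𝓘(ℝ, Model n) 𝓘(ℝ, Model n) (φ s) (φ 0 x)
      (mfderiv 𝓘(ℝ, Model n) 𝓘(ℝ, Model n) (φ s) (φ 0 x)) := (hφ.mdifferentiableAt s _).hasMFDerivAt
  have h4 := h3.comp (0 : ℝ) h1
  have h5 : φ s ∘ (fun h => φ h x) = fun h => φ h (φ s x) := by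
    funext h
    rw [Function.comp_apply, ← hφ.add, ← hφ.add, add_comm]
  rw [h5] at h4
  have h6 := hasMFDerivAt_unique h4 h2
  have h7 := DFunLike.congr_fun h6 (1 : ℝ)
  have h8 : dMap n (φ s) (φ 0 x) ((1 : ℝ) • X (φ 0 x)) = (1 : ℝ) • X (φ 0 (φ s x)) := h7
  rw [one_smul, one_smul, hφ.zero, hφ.zero] at h8
  exact h8

theorem isFlowOfScaledField (c t₀ : ℝ) :
    IsFlowOfScaledField X (solitonRate c t₀) (solitonInterval c t₀) t₀
      (fun t => φ (solitonTime c t₀ t)) := by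
  refine ⟨fun x => ?_, fun t ht x => ?_⟩
  · simp only [solitonTime_self, hφ.zero]
  · have h1 : HasMFDerivAt 𝓘(ℝ, ℝ) 𝓘(ℝ, ℝ) (solitonTime c t₀) t
        ((1 : ℝ →L[ℝ] ℝ).smulRight (solitonRate c t₀ t)) :=
      (hasDerivAt_solitonTime ht).hasFDerivAt.hasMFDerivAt
    refine ((hφ.curve x (solitonTime c t₀ t)).comp t h1).congr_mfderiv ?_
    exact smulRight_one_comp_smulRight_one (E := Model n) (X (φ (solitonTime c t₀ t) x)) _

/-- Undoing the change of time turns `f` into integral curves of `X` on all of `ℝ`, which are unique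
on a Hausdorff manifold. -/
theorem eq_of_isFlowOfScaledField [T2Space M] (hX : SmoothVectorField X) {c t₀ : ℝ}
    {f : ℝ → M → M}
    (hf : IsFlowOfScaledField X (solitonRate c t₀) (solitonInterval c t₀) t₀ f) {t : ℝ}
    (ht : t ∈ solitonInterval c t₀) : f t = φ (solitonTime c t₀ t) := by
  funext x
  have hcurve : IsMIntegralCurve (fun s => f (solitonTimeInv c t₀ s) x) X := by
    intro s
    have h1 : HasMFDerivAt 𝓘(ℝ, ℝ) 𝓘(ℝ, ℝ) (solitonTimeInv c t₀) s
        ((1 : ℝ →L[ℝ] ℝ).smulRight (Real.exp (-(c * s)))) :=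
      (hasDerivAt_solitonTimeInv c t₀ s).hasFDerivAt.hasMFDerivAt
    have h2 : solitonRate c t₀ (solitonTimeInv c t₀ s) = Real.exp (c * s) := by
      rw [solitonRate, one_sub_mul_solitonTimeInv, Real.exp_neg, one_div, inv_inv]
    have h3 := hf.2 _ (solitonTimeInv_mem c t₀ s) x
    rw [h2] at h3
    refine (h3.comp s h1).congr_mfderiv ?_
    refine (smulRight_one_comp_smulRight_one (E := Model n) _ _).trans ?_
    have h4 : ∀ v : Model n, Real.exp (-(c * s)) • Real.exp (c * s) • v = v := fun v => by
      rw [smul_smul, ← Real.exp_add, neg_add_cancel, Real.exp_zero, one_smul]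
    exact congrArg (fun v : Model n => (1 : ℝ →L[ℝ] ℝ).smulRight v) (h4 _)
  have h := isMIntegralCurve_Ioo_eq_of_contMDiff_boundaryless (t₀ := 0) hX.contMDiff_one hcurve
    (hφ.curve x) (by rw [solitonTimeInv_zero, hf.1, hφ.zero])
  have h' := congrFun h (solitonTime c t₀ t)
  rwa [solitonTimeInv_solitonTime ht] at h'

theorem contMDiffOn_rescaled (c t₀ : ℝ) :
    ContMDiffOn (𝓘(ℝ, ℝ).prod 𝓘(ℝ, Model n)) 𝓘(ℝ, Model n) ∞
      (fun z : ℝ × M => φ (solitonTime c t₀ z.1) z.2) (solitonInterval c t₀ ×ˢ Set.univ) := by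
  have h1 : ContMDiffOn (𝓘(ℝ, ℝ).prod 𝓘(ℝ, Model n)) 𝓘(ℝ, ℝ) ∞
      (fun z : ℝ × M => solitonTime c t₀ z.1) (solitonInterval c t₀ ×ˢ Set.univ) :=
    (contDiffOn_solitonTime c t₀).contMDiffOn.comp contMDiffOn_fst fun z hz => hz.1
  exact hφ.smooth.comp_contMDiffOn (h1.prodMk contMDiffOn_snd)

end IsGlobalFlow

end GlobalFlow

end HarmonicSoliton

end

noncomputable section

open scoped Manifold ContDiff Topology
set_option linter.unusedSectionVars false

namespace HarmonicSoliton

/-! ### Derivatives of pull-backs along the flow -/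

section Evolution

open Filter

/-- The derivative in time of the spatial derivative of a flow is the derivative of its initial
velocity. -/
theorem hasDerivAt_fderiv_of_velocity {E : Type*} [NormedAddCommGroup E] [NormedSpace ℝ E]
    {F : ℝ × E → E} {V : E → E} {y : E} (hF : ContDiffAt ℝ ∞ F (0, y))
    (hV : ∀ᶠ z in 𝓝 y, HasDerivAt (fun r => F (r, z)) (V z) 0) :
    HasDerivAt (fun r => fderiv ℝ (fun z => F (r, z)) y) (fderiv ℝ V y) 0 := by
  have hF2 : ContDiffAt ℝ 2 F (0, y) := hF.of_le two_le_infty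
  have hev : ∀ᶠ w in 𝓝 ((0 : ℝ), y), DifferentiableAt ℝ F w :=
    (hF2.eventually (by simp)).mono fun w hw => hw.differentiableAt (by simp)
  have hslice : ∀ r z, DifferentiableAt ℝ F (r, z) →
      fderiv ℝ (fun z => F (r, z)) z = (fderiv ℝ F (r, z)).comp (.inr ℝ ℝ E) := fun r z h =>
    (h.hasFDerivAt.comp z (hasFDerivAt_prodMk_right r z)).fderiv
  have hvel : V =ᶠ[𝓝 y] fun z => fderiv ℝ F (0, z) (1, 0) := by
    have ht : Tendsto (fun z => ((0 : ℝ), z)) (𝓝 y) (𝓝 (0, y)) :=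
      Continuous.tendsto (by fun_prop) y
    filter_upwards [hV, ht.eventually hev] with z h1 h2
    have h3 := (h2.hasFDerivAt.comp (0 : ℝ) (hasFDerivAt_prodMk_left (0 : ℝ) z)).hasDerivAt
    exact (h1.unique h3).trans (by simp)
  have hD : DifferentiableAt ℝ (fderiv ℝ F) (0, y) :=
    (hF2.fderiv_right (m := 1) (by norm_num)).differentiableAt (by simp)
  have hsymm : IsSymmSndFDerivAt ℝ F (0, y) := hF2.isSymmSndFDerivAt (by simp)
  have hVd : fderiv ℝ V y = (((fderiv ℝ (fderiv ℝ F) (0, y)).flip (1, 0))).comp (.inr ℝ ℝ E) := by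
    rw [hvel.fderiv_eq]
    have h1 : HasFDerivAt (fun z => fderiv ℝ F (0, z))
        ((fderiv ℝ (fderiv ℝ F) (0, y)).comp (.inr ℝ ℝ E)) y :=
      hD.hasFDerivAt.comp y (hasFDerivAt_prodMk_right (0 : ℝ) y)
    refine ((h1.clm_apply (hasFDerivAt_const ((1 : ℝ), (0 : E)) y)).fderiv).trans ?_
    ext u
    simp
  have h1 : HasDerivAt (fun r : ℝ => fderiv ℝ F (r, y))
      (fderiv ℝ (fderiv ℝ F) (0, y) (1, 0)) 0 := by
    have h := (hD.hasFDerivAt.comp (0 : ℝ) (hasFDerivAt_prodMk_left (0 : ℝ) y)).hasDerivAt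
    simpa using! h
  have h2 := h1.clm_comp (hasDerivAt_const (0 : ℝ) (ContinuousLinearMap.inr ℝ ℝ E))
  have h3 : fderiv ℝ V y = (fderiv ℝ (fderiv ℝ F) (0, y) (1, 0)).comp (.inr ℝ ℝ E) +
      (fderiv ℝ F (0, y)).comp (0 : E →L[ℝ] ℝ × E) := by
    -- The equality of the mixed second derivatives in time and space.
    rw [hVd]
    ext u
    simpa using hsymm (0, u) (1, 0)
  rw [h3]
  refine h2.congr_of_eventuallyEq ?_
  have ht : Tendsto (fun r : ℝ => (r, y)) (𝓝 0) (𝓝 (0, y)) :=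
    Continuous.tendsto (by fun_prop) (0 : ℝ)
  filter_upwards [ht.eventually hev] with r hr
  exact hslice r y hr

theorem hasDerivAt_bilinear_comp {E V W : Type*} [NormedAddCommGroup E] [NormedSpace ℝ E]
    [NormedAddCommGroup V] [NormedSpace ℝ V] [NormedAddCommGroup W] [NormedSpace ℝ W]
    {G : E → V →L[ℝ] V →L[ℝ] W} {γ : ℝ → E} {γ' : E} {a b : ℝ → V} {a' b' : V} {s : ℝ}
    (hG : DifferentiableAt ℝ G (γ s)) (hγ : HasDerivAt γ γ' s) (ha : HasDerivAt a a' s)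
    (hb : HasDerivAt b b' s) :
    HasDerivAt (fun s => G (γ s) (a s) (b s))
      (fderiv ℝ G (γ s) γ' (a s) (b s) + G (γ s) a' (b s) + G (γ s) (a s) b') s := by
  have h1 : HasDerivAt (fun s => G (γ s)) (fderiv ℝ G (γ s) γ') s :=
    hasDerivAt_comp_curve (W := V →L[ℝ] V →L[ℝ] W) (η := G) rfl hG hγ
  refine ((h1.clm_apply ha).clm_apply hb).congr_deriv ?_
  simp

variable {n p q : ℕ}

theorem hasDerivAt_shift {V : Type*} [NormedAddCommGroup V] [NormedSpace ℝ V] {k : ℝ → V} {k' : V}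
    (s : ℝ) (hk : HasDerivAt k k' 0) : HasDerivAt (fun r => k (r - s)) k' s :=
  HasDerivAt.comp_sub_const (x := s) (a := s) (by rwa [sub_self])

theorem hasDerivAt_congr {V : Type*} [NormedAddCommGroup V] [NormedSpace ℝ V]
    {k k₁ : ℝ → V} {k' k₁' : V} {s : ℝ} (hk : HasDerivAt k k' s) (h : ∀ᶠ r in 𝓝 s, k₁ r = k r)
    (h' : k₁' = k') : HasDerivAt k₁ k₁' s :=
  h' ▸ hk.congr_of_eventuallyEq h

theorem differentiableAt_comp_curve {E W : Type*} [NormedAddCommGroup E] [NormedSpace ℝ E]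
    [NormedAddCommGroup W] [NormedSpace ℝ W] {η : E → W} {γ : ℝ → E} {s : ℝ}
    (hη : ContDiffAt ℝ ∞ η (γ s)) (hγ : DifferentiableAt ℝ γ s) :
    DifferentiableAt ℝ (fun s => η (γ s)) s :=
  (hη.differentiableAt (by simp)).comp s hγ

theorem contDiffAt_comp {Z E W : Type*} [NormedAddCommGroup Z] [NormedSpace ℝ Z]
    [NormedAddCommGroup E] [NormedSpace ℝ E] [NormedAddCommGroup W] [NormedSpace ℝ W] {η : E → W}
    {γ : Z → E} {z : Z} {y : E} (hy : γ z = y) (hη : ContDiffAt ℝ ∞ η y)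
    (hγ : ContDiffAt ℝ ∞ γ z) : ContDiffAt ℝ ∞ (fun z => η (γ z)) z := by
  subst hy
  exact hη.comp z hγ

theorem hasDerivAt_pullback_const {L : EndT n} {ξ : ℝ → Tensor n p q} {ξ' : Tensor n p q} {s : ℝ}
    (hL : L.IsInvertible) (hξ : HasDerivAt ξ ξ' s) :
    HasDerivAt (fun s => Tensor.pullback L (ξ s)) (Tensor.pullback L ξ') s := by
  have h1 : ContDiffAt ℝ ∞ (fun η : Tensor n p q => Tensor.pullback L η) (ξ s) :=
    contDiffAt_pullback contDiffAt_const hL contDiffAt_id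
  have h2 := differentiableAt_comp_curve (E := Tensor n p q) (W := Tensor n p q)
    (η := fun η : Tensor n p q => Tensor.pullback L η) h1 hξ.differentiableAt
  have h3 : HasDerivAt (fun s => Tensor.pullback L (ξ s))
      (Tensor.pullback L (ξ' + diamond ((0 : EndT n).comp L.inverse) (ξ s))) s :=
    hasDerivAt_pullback (hasDerivAt_const s L) hL hξ h2
  have h4 : Tensor.pullback L (ξ' + diamond ((0 : EndT n).comp L.inverse) (ξ s)) =
      Tensor.pullback L ξ' := by
    rw [ContinuousLinearMap.zero_comp, diamond_zero_left]
    exact congrArg (Tensor.pullback L) (add_zero ξ')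
  rw [h4] at h3
  exact h3

variable {M : Type*} [TopologicalSpace M] [ChartedSpace (Model n) M]
  [IsManifold 𝓘(ℝ, Model n) ∞ M] {X : (x : M) → TangentSpace 𝓘(ℝ, Model n) x} {φ : ℝ → M → M}

/-- With `u = X` and `A = DX`, the Christoffel terms of `∇_X ξ` and of `∇X ⋄ ξ` cancel, leaving the
coordinate formula for the Lie derivative. -/
theorem covDeriv_add_diamond (g : RiemMetric n M) (ξ : M → Tensor n p q) (x : M) (u : Model n)
    (A : EndT n) :
    covDeriv g ξ x u + diamond (A + christoffel g x (extChartAt 𝓘(ℝ, Model n) x x) u) (ξ x) =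
      fderiv ℝ (tensorInChart ξ x) (extChartAt 𝓘(ℝ, Model n) x x) u + diamond A (ξ x) := by
  rw [covDeriv_eq, diamond_add_left]
  abel

namespace IsGlobalFlow

variable (hφ : IsGlobalFlow X φ)
include hφ

theorem contDiffAt_chartRep {s : ℝ} {x₀ x₁ : M} {y : Model n} (h : ChartPair (φ s) x₀ x₁ y) :
    ContDiffAt ℝ ∞ (fun w : ℝ × Model n => chartRep (φ w.1) x₀ x₁ w.2) (s, y) := by
  have h1 : ContMDiffAt 𝓘(ℝ, ℝ × Model n) 𝓘(ℝ, ℝ) ∞ (fun w : ℝ × Model n => w.1) (s, y) :=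
    contDiffAt_fst.contMDiffAt
  have h2 : ContMDiffAt 𝓘(ℝ, ℝ × Model n) 𝓘(ℝ, Model n) ∞ (fun w : ℝ × Model n => w.2) (s, y) :=
    contDiffAt_snd.contMDiffAt
  have h3 : ContMDiffAt 𝓘(ℝ, ℝ × Model n) 𝓘(ℝ, Model n) ∞
      (fun w : ℝ × Model n => (extChartAt 𝓘(ℝ, Model n) x₀).symm w.2) (s, y) :=
    ContMDiffAt.comp (s, y) (g := (extChartAt 𝓘(ℝ, Model n) x₀).symm)
      (f := fun w : ℝ × Model n => w.2) (contMDiffAt_chart_symm h.mem) h2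
  have h4 : ContMDiffAt 𝓘(ℝ, ℝ × Model n) 𝓘(ℝ, Model n) ∞
      (fun w : ℝ × Model n => φ w.1 ((extChartAt 𝓘(ℝ, Model n) x₀).symm w.2)) (s, y) :=
    ContMDiffAt.comp (s, y) (g := fun z : ℝ × M => φ z.1 z.2)
      (f := fun w : ℝ × Model n => (w.1, (extChartAt 𝓘(ℝ, Model n) x₀).symm w.2))
      (hφ.smooth _) (h1.prodMk h3)
  exact contMDiffAt_iff_contDiffAt.1 (ContMDiffAt.comp (s, y) (g := extChartAt 𝓘(ℝ, Model n) x₁)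
    (contMDiffAt_chart h.map_mem) h4)

theorem eventually_chartPair {s : ℝ} {x₀ x₁ : M} {y : Model n} (h : ChartPair (φ s) x₀ x₁ y) :
    ∀ᶠ w : ℝ × Model n in 𝓝 (s, y), ChartPair (φ w.1) x₀ x₁ w.2 := by
  have h1 : ContinuousAt
      (fun w : ℝ × Model n => φ w.1 ((extChartAt 𝓘(ℝ, Model n) x₀).symm w.2)) (s, y) := by
    refine ContinuousAt.comp (g := fun z : ℝ × M => φ z.1 z.2)
      (f := fun w : ℝ × Model n => (w.1, (extChartAt 𝓘(ℝ, Model n) x₀).symm w.2))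
      hφ.smooth.continuous.continuousAt (continuousAt_fst.prodMk ?_)
    exact ContinuousAt.comp (g := (extChartAt 𝓘(ℝ, Model n) x₀).symm)
      (f := fun w : ℝ × Model n => w.2) (contMDiffAt_chart_symm h.mem).continuousAt continuousAt_snd
  filter_upwards [continuousAt_snd.preimage_mem_nhds (target_mem_nhds h.mem),
    h1.preimage_mem_nhds
      ((isOpen_extChartAt_source (I := 𝓘(ℝ, Model n)) x₁).mem_nhds h.map_mem)] with w hw1 hw2
  exact ⟨hw1, hw2⟩

theorem chartPair_zero {x₀ : M} {y : Model n} (hy : y ∈ (extChartAt 𝓘(ℝ, Model n) x₀).target) :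
    ChartPair (φ 0) x₀ x₀ y where
  mem := hy
  map_mem := by
    rw [hφ.zero]
    exact (extChartAt 𝓘(ℝ, Model n) x₀).map_target hy

theorem chartRep_zero {x₀ : M} {y : Model n} (hy : y ∈ (extChartAt 𝓘(ℝ, Model n) x₀).target) :
    chartRep (φ 0) x₀ x₀ y = y := by
  simp only [chartRep, Function.comp_apply, hφ.zero]
  exact (extChartAt 𝓘(ℝ, Model n) x₀).right_inv hy

theorem hasDerivAt_chartRep_zero {x₀ : M} {y : Model n}
    (hy : y ∈ (extChartAt 𝓘(ℝ, Model n) x₀).target) :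
    HasDerivAt (fun r => chartRep (φ r) x₀ x₀ y) (vectorInChart X x₀ y) 0 := by
  set x := (extChartAt 𝓘(ℝ, Model n) x₀).symm y with hx
  have hc := (hφ.chartPair_zero hy)
  have hmem : φ 0 x ∈ (extChartAt 𝓘(ℝ, Model n) x₀).source := hc.map_mem
  have hsm := hφ.contDiffAt_chartRep hc
  have hd : DifferentiableAt ℝ (fun r => chartRep (φ r) x₀ x₀ y) 0 :=
    DifferentiableAt.comp (0 : ℝ) (g := fun w : ℝ × Model n => chartRep (φ w.1) x₀ x₀ w.2)
      (f := fun r : ℝ => (r, y)) (hsm.differentiableAt (by simp)) (by fun_prop)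
  set v := deriv (fun r => chartRep (φ r) x₀ x₀ y) 0
  have h1 : HasMFDerivAt 𝓘(ℝ, ℝ) 𝓘(ℝ, Model n) (fun r => chartRep (φ r) x₀ x₀ y) 0
      ((1 : ℝ →L[ℝ] ℝ).smulRight v) := hd.hasDerivAt.hasFDerivAt.hasMFDerivAt
  have ht : chartRep (φ 0) x₀ x₀ y ∈ (extChartAt 𝓘(ℝ, Model n) x₀).target := hc.target
  have h2 := ((contMDiffAt_chart_symm ht).mdifferentiableAt (by simp)).hasMFDerivAt
  have h3 := h2.comp (0 : ℝ) h1
  have h4 : HasMFDerivAt 𝓘(ℝ, ℝ) 𝓘(ℝ, Model n) (fun r => φ r x) 0 (_ : ℝ →L[ℝ] Model n) :=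
    h3.congr_of_eventuallyEq (by
      have hcont : ContinuousAt (fun r => φ r x) 0 := (hφ.curve x).continuous.continuousAt
      filter_upwards [hcont.preimage_mem_nhds
        ((isOpen_extChartAt_source (I := 𝓘(ℝ, Model n)) x₀).mem_nhds hmem)] with r hr
      exact ((extChartAt 𝓘(ℝ, Model n) x₀).left_inv hr).symm)
  have h5 := DFunLike.congr_fun (hasMFDerivAt_unique h4 (hφ.curve x 0)) (1 : ℝ)
  have h6 : (mfderiv 𝓘(ℝ, Model n) 𝓘(ℝ, Model n) (extChartAt 𝓘(ℝ, Model n) x₀).symm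
      (chartRep (φ 0) x₀ x₀ y) : EndT n) ((1 : ℝ) • v) = (1 : ℝ) • X (φ 0 x) := h5
  have h7 : chartFrame x₀ (chartRep (φ 0) x₀ x₀ y) v = X (φ 0 x) := by
    rw [one_smul, one_smul, ← chartFrame_eq_mfderiv ht] at h6
    exact h6
  rw [hφ.chartRep_zero hy, hφ.zero] at h7
  have h8 : v = vectorInChart X x₀ y := by
    rw [vectorInChart, ← hx, ← h7]
    exact ((chartFrame_isInvertible hy).inverse_apply_self v).symm
  rw [← h8]
  exact hd.hasDerivAt

theorem hasDerivAt_fderiv_chartRep_zero {x₀ : M} {y : Model n}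
    (hy : y ∈ (extChartAt 𝓘(ℝ, Model n) x₀).target) :
    HasDerivAt (fun r => fderiv ℝ (chartRep (φ r) x₀ x₀) y)
      (fderiv ℝ (vectorInChart X x₀) y) 0 := by
  refine hasDerivAt_fderiv_of_velocity
    (F := fun w : ℝ × Model n => chartRep (φ w.1) x₀ x₀ w.2)
    (hφ.contDiffAt_chartRep (hφ.chartPair_zero hy)) ?_
  filter_upwards [target_mem_nhds hy] with z hz
  exact hφ.hasDerivAt_chartRep_zero hz

theorem fderiv_chartRep_zero {x₀ : M} {y : Model n}
    (hy : y ∈ (extChartAt 𝓘(ℝ, Model n) x₀).target) :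
    fderiv ℝ (chartRep (φ 0) x₀ x₀) y = ContinuousLinearMap.id ℝ (Model n) := by
  have h : chartRep (φ 0) x₀ x₀ =ᶠ[𝓝 y] id := by
    filter_upwards [target_mem_nhds hy] with z hz
    exact hφ.chartRep_zero hz
  rw [h.fderiv_eq]
  exact fderiv_id

theorem eventually_chartPair_zero (x : M) :
    ∀ᶠ r in 𝓝 (0 : ℝ), ChartPair (φ r) x x (extChartAt 𝓘(ℝ, Model n) x x) := by
  have ht : Tendsto (fun r : ℝ => (r, extChartAt 𝓘(ℝ, Model n) x x)) (𝓝 0)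
      (𝓝 (0, extChartAt 𝓘(ℝ, Model n) x x)) := Continuous.tendsto (by fun_prop) (0 : ℝ)
  exact ht.eventually (hφ.eventually_chartPair (hφ.chartPair_zero (mem_extChartAt_target x)))

theorem hasDerivAt_metric_zero (g : RiemMetric n M) (x : M) (u v : Model n) :
    HasDerivAt (fun r => g.at (φ r x) (dMap n (φ r) x u) (dMap n (φ r) x v))
      (lieDerivMetric g X x u v) 0 := by
  set y := extChartAt 𝓘(ℝ, Model n) x x with hy
  have hyt : y ∈ (extChartAt 𝓘(ℝ, Model n) x).target := mem_extChartAt_target x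
  have h0 := hφ.chartRep_zero hyt
  have h1 := hφ.hasDerivAt_chartRep_zero hyt
  have h2 := hφ.hasDerivAt_fderiv_chartRep_zero hyt
  have hG : DifferentiableAt ℝ (metricInChart g x) (chartRep (φ 0) x x y) := by
    rw [h0]
    exact (contDiffAt_metricInChart g hyt).differentiableAt (by simp)
  have h3 : ∀ w : Model n, HasDerivAt (fun r => fderiv ℝ (chartRep (φ r) x x) y w)
      (fderiv ℝ (vectorInChart X x) y w) 0 := fun w => by
    simpa using h2.clm_apply (hasDerivAt_const (0 : ℝ) w)
  have h4 := hasDerivAt_bilinear_comp (G := metricInChart g x) hG h1 (h3 u) (h3 v)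
  rw [h0, hφ.fderiv_chartRep_zero hyt, vectorInChart_self, hy, metricInChart_self] at h4
  refine (h4.congr_of_eventuallyEq ?_)
  filter_upwards [hφ.eventually_chartPair_zero x] with r hr
  rw [metricInChart_apply, hr.chain_apply (hφ.contMDiff r), hr.chain_apply (hφ.contMDiff r),
    chart_symm_chartRep hr.map_mem, chartFrame_self, extChartAt_to_inv]
  rfl

theorem contDiffAt_pullback_chartRep {ξ : M → Tensor n p q} (hξ : SmoothTensorField ξ) {s : ℝ}
    {x₀ x₁ : M} {y : Model n} (h : ChartPair (φ s) x₀ x₁ y) :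
    ContDiffAt ℝ ∞ (fun w : ℝ × Model n =>
      Tensor.pullback (fderiv ℝ (chartRep (φ w.1) x₀ x₁) w.2)
        (tensorInChart ξ x₁ (chartRep (φ w.1) x₀ x₁ w.2))) (s, y) := by
  have hsm := hφ.contDiffAt_chartRep h
  refine contDiffAt_pullback ?_ (h.isInvertible (hφ.contMDiff s) (hφ.isInvertible_dMap s _)) ?_
  · have h1 : ContDiffAt ℝ ∞
        (Function.uncurry fun (w : ℝ × Model n) z => chartRep (φ w.1) x₀ x₁ z) ((s, y), y) :=
      contDiffAt_comp (z := ((s, y), y)) (y := (s, y))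
        (η := fun w : ℝ × Model n => chartRep (φ w.1) x₀ x₁ w.2) (γ := fun v : (ℝ × Model n) × Model n => (v.1.1, v.2)) rfl hsm
        (contDiffAt_fst.fst.prodMk contDiffAt_snd)
    exact ContDiffAt.fderiv (f := fun (w : ℝ × Model n) z => chartRep (φ w.1) x₀ x₁ z)
      (n := ∞) (m := ∞) (g := fun w => w.2) h1 contDiffAt_snd (by simp)
  · exact contDiffAt_comp (W := Tensor n p q) rfl (hξ.contDiffAt h.target) hsm

/-- The Lie derivative as `∇_X ξ + ∇X ⋄ ξ`. In the chart at `x` the flow starts at the identity with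
velocity `X`, and its differential has time derivative `DX`. -/
theorem hasDerivAt_pullbackField_zero {ξ : M → Tensor n p q} (g : RiemMetric n M)
    (hξ : SmoothTensorField ξ) (x : M) :
    HasDerivAt (fun r => pullbackField (φ r) ξ x)
      (covDeriv g ξ x (X x) + diamond (nabla g X x) (ξ x)) 0 := by
  set y := extChartAt 𝓘(ℝ, Model n) x x with hy
  have hyt : y ∈ (extChartAt 𝓘(ℝ, Model n) x).target := mem_extChartAt_target x
  have h0 := hφ.chartRep_zero hyt
  have h0' := hφ.fderiv_chartRep_zero hyt
  have h1 := hφ.hasDerivAt_chartRep_zero hyt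
  have h2 := hφ.hasDerivAt_fderiv_chartRep_zero hyt
  have hi : (fderiv ℝ (chartRep (φ 0) x x) y).IsInvertible := by
    rw [h0']
    exact isInvertible_one
  have hξy : ContDiffAt ℝ ∞ (tensorInChart ξ x) y := hξ.contDiffAt hyt
  have h3 : HasDerivAt (fun r => tensorInChart ξ x (chartRep (φ r) x x y))
      (fderiv ℝ (tensorInChart ξ x) y (vectorInChart X x y)) 0 :=
    hasDerivAt_comp_curve (W := Tensor n p q) h0 (hξy.differentiableAt (by simp)) h1
  have hd : DifferentiableAt ℝ (fun r : ℝ => Tensor.pullback (fderiv ℝ (chartRep (φ r) x x) y)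
      (tensorInChart ξ x (chartRep (φ r) x x y))) 0 :=
    differentiableAt_comp_curve (E := ℝ × Model n) (W := Tensor n p q) (γ := fun r : ℝ => (r, y))
      (η := fun w : ℝ × Model n => Tensor.pullback (fderiv ℝ (chartRep (φ w.1) x x) w.2)
        (tensorInChart ξ x (chartRep (φ w.1) x x w.2)))
      (hφ.contDiffAt_pullback_chartRep hξ (hφ.chartPair_zero hyt)) (by fun_prop)
  have h4 : HasDerivAt (fun r : ℝ => Tensor.pullback (fderiv ℝ (chartRep (φ r) x x) y)
      (tensorInChart ξ x (chartRep (φ r) x x y)))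
      (Tensor.pullback (fderiv ℝ (chartRep (φ 0) x x) y)
        (fderiv ℝ (tensorInChart ξ x) y (vectorInChart X x y) +
          diamond ((fderiv ℝ (vectorInChart X x) y).comp
            (fderiv ℝ (chartRep (φ 0) x x) y).inverse)
            (tensorInChart ξ x (chartRep (φ 0) x x y)))) 0 :=
    hasDerivAt_pullback h2 hi h3 hd
  rw [h0', h0, ContinuousLinearMap.inverse_id, pullback_id, hy, tensorInChart_self,
    vectorInChart_self, ContinuousLinearMap.comp_id] at h4
  have h5 : covDeriv g ξ x (X x) + diamond (nabla g X x) (ξ x) =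
      fderiv ℝ (tensorInChart ξ x) y (X x) + diamond (fderiv ℝ (vectorInChart X x) y) (ξ x) :=
    covDeriv_add_diamond g ξ x (X x) _
  refine hasDerivAt_congr (V := Tensor n p q) h4 ?_ h5
  filter_upwards [hφ.eventually_chartPair_zero x] with r hr
  have hir : (dMap n (φ r) ((extChartAt 𝓘(ℝ, Model n) x).symm y)).IsInvertible :=
    hφ.isInvertible_dMap r _
  rw [← hr.tensorInChart_pullbackField (hφ.contMDiff r) hir, tensorInChart_self]

theorem hasDerivAt_metric (g : RiemMetric n M) (s : ℝ) (x : M) (u v : Model n) :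
    HasDerivAt (fun r => g.at (φ r x) (dMap n (φ r) x u) (dMap n (φ r) x v))
      (lieDerivMetric g X (φ s x) (dMap n (φ s) x u) (dMap n (φ s) x v)) s := by
  have h := hφ.hasDerivAt_metric_zero g (φ s x) (dMap n (φ s) x u) (dMap n (φ s) x v)
  have h' := hasDerivAt_shift s h
  refine h'.congr_of_eventuallyEq (Eventually.of_forall fun r => ?_)
  have h1 : r = s + (r - s) := by ring
  have h2 := hφ.dMap_add s (r - s) x
  have h3 := hφ.add s (r - s) x
  rw [← h1] at h2 h3
  change g.at (φ r x) (dMap n (φ r) x u) (dMap n (φ r) x v) = _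
  rw [h2, h3]
  rfl

theorem pullbackField_add {ξ : M → Tensor n p q} (s h : ℝ) (x : M) :
    pullbackField (φ (s + h)) ξ x =
      Tensor.pullback (dMap n (φ s) x) (pullbackField (φ h) ξ (φ s x)) := by
  rw [pullbackField_eq, hφ.dMap_add, hφ.add, pullback_comp (hφ.isInvertible_dMap h _)]
  rfl

theorem hasDerivAt_pullbackField {ξ : M → Tensor n p q} (g : RiemMetric n M)
    (hξ : SmoothTensorField ξ) (s : ℝ) (x : M) :
    HasDerivAt (fun r => pullbackField (φ r) ξ x)
      (Tensor.pullback (dMap n (φ s) x) (covDeriv g ξ (φ s x) (X (φ s x)) +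
        diamond (nabla g X (φ s x)) (ξ (φ s x)))) s := by
  have h := hφ.hasDerivAt_pullbackField_zero g hξ (φ s x)
  have h' := hasDerivAt_pullback_const (hφ.isInvertible_dMap s x) h
  have h'' := hasDerivAt_shift (V := Tensor n p q) s h'
  refine hasDerivAt_congr (V := Tensor n p q) h'' (Eventually.of_forall fun r => ?_) rfl
  have h1 := hφ.pullbackField_add (ξ := ξ) s (r - s) x
  rw [add_sub_cancel] at h1
  exact h1

/-- The flow of a homothetic vector field consists of homotheties. -/
theorem isHomothety {g : RiemMetric n M} {c : ℝ}
    (hg : ∀ x u v, lieDerivMetric g X x u v = c * g.at x u v) (s : ℝ) :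
    IsHomothety g (Real.exp (c * s)) (φ s) where
  ne_zero := (Real.exp_pos _).ne'
  smooth := hφ.contMDiff s
  inv := hφ.isInvertible_dMap s
  metric x u v := by
    set k : ℝ → ℝ := fun r => g.at (φ r x) (dMap n (φ r) x u) (dMap n (φ r) x v) with hk
    have hk' : ∀ r, HasDerivAt k (c * k r) r := fun r => by
      have := hφ.hasDerivAt_metric g r x u v
      rwa [hg] at this
    -- The integrating factor for the equation `k' = c k`, which the group property provides at
    -- every time.
    have hE : ∀ r, HasDerivAt (fun r => Real.exp (-(c * r)) * k r) 0 r := fun r => by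
      have h1 : HasDerivAt (fun r : ℝ => -(c * r)) (-c) r := by
        exact (((hasDerivAt_id r).const_mul c).neg).congr_deriv (by simp)
      refine (h1.exp.mul (hk' r)).congr_deriv ?_
      ring
    have hconst := is_const_of_deriv_eq_zero (fun r => (hE r).differentiableAt)
      (fun r => (hE r).deriv) s 0
    have hk0 : k 0 = g.at x u v := by
      simp only [hk, hφ.dMap_zero, hφ.zero]
      rfl
    simp only [mul_zero, neg_zero, Real.exp_zero, one_mul, hk0] at hconst
    change k s = _
    rw [← hconst, ← mul_assoc, ← Real.exp_add, add_neg_cancel, Real.exp_zero, one_mul]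

end IsGlobalFlow

/-- The symmetric part of `∇X` is half of `L_X g = c g`, since the connection is metric. -/
theorem isSkew_nabla_sub {g : RiemMetric n M} {c : ℝ} {x : M}
    (hg : ∀ u v, lieDerivMetric g X x u v = c * g.at x u v) :
    IsSkew (g.at x) (nabla g X x - (c / 2) • ContinuousLinearMap.id ℝ (Model n)) := by
  intro u v
  set y := extChartAt 𝓘(ℝ, Model n) x x with hy
  have h1 := fderiv_eq_bilDiamond_christoffelOf
    (isMetricAt_metricInChart g (mem_extChartAt_target (I := 𝓘(ℝ, Model n)) x)) (X x)
  have h2 : fderiv ℝ (metricInChart g x) y (X x) u v =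
      g.at x (christoffel g x y (X x) u) v + g.at x u (christoffel g x y (X x) v) := by
    have h3 := congrArg (fun B : Bil n => B u v) h1
    rw [metricInChart_self] at h3
    exact h3
  have h4 := hg u v
  have h5 : lieDerivMetric g X x u v = fderiv ℝ (metricInChart g x) y (X x) u v +
      g.at x (fderiv ℝ (vectorInChart X x) y u) v +
      g.at x u (fderiv ℝ (vectorInChart X x) y v) := rfl
  have h6 : ∀ w, nabla g X x w = fderiv ℝ (vectorInChart X x) y w + christoffel g x y (X x) w :=
    fun w => rfl
  rw [h5, h2] at h4
  simp only [sub_apply, smul_apply, ContinuousLinearMap.id_apply, h6, map_sub, map_add, map_smul,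
    add_apply, smul_eq_mul]
  linarith

end Evolution

end HarmonicSoliton

end

noncomputable section

open scoped Manifold ContDiff Topology
set_option linter.unusedSectionVars false

namespace HarmonicSoliton

/-! ### Effect of scaling, orientation along the flow and smoothness of pull-backs -/

section Scaling

open Filter

variable {n p q : ℕ}

theorem contDiffAt_zpow {Z : Type*} [NormedAddCommGroup Z] [NormedSpace ℝ Z] {r : Z → ℝ} {z : Z}
    (hr : ContDiffAt ℝ ∞ r z) (h0 : r z ≠ 0) (m : ℤ) : ContDiffAt ℝ ∞ (fun z => r z ^ m) z := by
  cases m with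
  | ofNat k => simpa using hr.pow k
  | negSucc k =>
    simp only [zpow_negSucc]
    exact (hr.pow (k + 1)).inv (pow_ne_zero _ h0)

theorem hasDerivAt_solitonScale_zpow {c t₀ t : ℝ} (ht : t ∈ solitonInterval c t₀) (m : ℤ) :
    HasDerivAt (fun s => solitonScale c t₀ s ^ m)
      (-(c / 2 * m) * solitonRate c t₀ t * solitonScale c t₀ t ^ m) t := by
  have h0 := (solitonScale_pos ht).ne'
  refine ((hasDerivAt_zpow m _ (Or.inl h0)).comp t (hasDerivAt_solitonScale ht)).congr_deriv ?_
  rw [zpow_sub_one₀ h0]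
  field_simp

theorem mProj_smul {b : Bil n} {e : Model n ≃L[ℝ] Model n} (he : IsOrthFrame b e)
    (ξ : Tensor n p q) (a : ℝ) (A : EndT n) : mProj b ξ (a • A) = a • mProj b ξ A := by
  obtain ⟨h1, h2⟩ := mProj_spec he ξ A
  refine mProj_eq he (smul_mem_mSpace a h1) fun C hC => ?_
  have h3 := h2 C hC
  rw [trPair_sub_left] at h3 ⊢
  rw [trPair_smul_left, trPair_smul_left, ← mul_sub, h3, mul_zero]

variable {M : Type*} [TopologicalSpace M] [ChartedSpace (Model n) M]
  [IsManifold 𝓘(ℝ, Model n) ∞ M] {X : (x : M) → TangentSpace 𝓘(ℝ, Model n) x} {φ : ℝ → M → M}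
  {g : RiemMetric n M}

theorem vectorInChart_smul (a : ℝ) (x : M) :
    vectorInChart (fun x => a • X x) x = fun y => a • vectorInChart X x y :=
  funext fun y => (chartFrame x y).inverse.map_smul a _

theorem nabla_smul (hX : SmoothVectorField X) (a : ℝ) (x : M) :
    nabla g (fun x => a • X x) x = a • nabla g X x := by
  have h1 : fderiv ℝ (vectorInChart (fun x => a • X x) x) (extChartAt 𝓘(ℝ, Model n) x x) =
      a • fderiv ℝ (vectorInChart X x) (extChartAt 𝓘(ℝ, Model n) x x) := by
    rw [vectorInChart_smul]
    exact fderiv_fun_const_smul ((contDiffAt_vectorInChart hX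
      (mem_extChartAt_target (I := 𝓘(ℝ, Model n)) x)).differentiableAt (by simp)) a
  have h2 := christoffel_smul g x (extChartAt 𝓘(ℝ, Model n) x x) a (X x)
  exact (congrArg₂ (· + ·) h1 h2).trans (smul_add a _ _).symm

theorem tensorInChart_smul (a : ℝ) (ξ : M → Tensor n p q) (x : M) (y : Model n) :
    tensorInChart (fun x => a • ξ x) x y = a • tensorInChart ξ x y := pullback_smul _ _ _

theorem alternating_ne_zero {η : (Model n) [⋀^Fin n]→L[ℝ] ℝ} (hη : η ≠ 0) {L : EndT n}
    (hL : L.IsInvertible) : η (fun i => L (EuclideanSpace.single i 1)) ≠ 0 := by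
  obtain ⟨e, rfl⟩ := hL
  have h := (η.toAlternatingMap.map_basis_ne_zero_iff
    ((EuclideanSpace.basisFun (Fin n) ℝ).toBasis.map e.toLinearEquiv)).2 fun h => hη (by
      ext v
      exact congrArg (fun f : (Model n) [⋀^Fin n]→ₗ[ℝ] ℝ => f v) h)
  convert h using 1
  change _ = η _
  congr 1
  funext i
  simp

/-- A continuous nowhere vanishing real function has constant sign. -/
theorem pos_of_continuous_of_ne_zero {k : ℝ → ℝ} (hk : Continuous k) (h0 : ∀ s, k s ≠ 0) {a b : ℝ}
    (ha : 0 < k a) : 0 < k b := by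
  by_contra hb
  obtain ⟨s, hs⟩ := mem_range_of_exists_le_of_exists_ge hk ⟨b, not_lt.1 hb⟩ ⟨a, ha.le⟩
  exact h0 s hs

namespace IsGlobalFlow

variable (hφ : IsGlobalFlow X φ)
include hφ

theorem continuousAt_vol_zero (o : ManifoldOrientation n M) (x : M) (w : Fin n → Model n) :
    ContinuousAt (fun r => o.vol (φ r x) (fun i => dMap n (φ r) x (w i))) 0 := by
  set y := extChartAt 𝓘(ℝ, Model n) x x with hy
  have hyt : y ∈ (extChartAt 𝓘(ℝ, Model n) x).target := mem_extChartAt_target x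
  have h0 := hφ.chartRep_zero hyt
  have h1 : ContinuousAt (fun r => chartRep (φ r) x x y) 0 :=
    (hφ.hasDerivAt_chartRep_zero hyt).continuousAt
  have h2 : ContinuousAt (fun r => fderiv ℝ (chartRep (φ r) x x) y) 0 :=
    (hφ.hasDerivAt_fderiv_chartRep_zero hyt).continuousAt
  have h3 : ContinuousAt (fun z => (o.vol ((extChartAt 𝓘(ℝ, Model n) x).symm z)
      ).compContinuousLinearMap (chartFrame x z)) (chartRep (φ 0) x x y) := by
    rw [h0]
    exact (o.continuousOn x).continuousAt (target_mem_nhds hyt)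
  have h4 : ContinuousAt (fun r => (o.vol ((extChartAt 𝓘(ℝ, Model n) x).symm
      (chartRep (φ r) x x y))).compContinuousLinearMap (chartFrame x (chartRep (φ r) x x y))) 0 :=
    ContinuousAt.comp (f := fun r => chartRep (φ r) x x y) h3 h1
  have h5 : ContinuousAt (fun r => fun i => fderiv ℝ (chartRep (φ r) x x) y (w i)) 0 :=
    continuousAt_pi.2 fun i => h2.clm_apply continuousAt_const
  refine (h4.eval h5).congr ?_
  filter_upwards [hφ.eventually_chartPair_zero x] with r hr
  rw [ContinuousAlternatingMap.compContinuousLinearMap_apply, chart_symm_chartRep hr.map_mem]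
  have h6 : ∀ i, chartFrame x (chartRep (φ r) x x y) (fderiv ℝ (chartRep (φ r) x x) y (w i)) =
      dMap n (φ r) x (w i) := fun i => by
    rw [hr.chain_apply (hφ.contMDiff r), chartFrame_self, extChartAt_to_inv]
    rfl
  rw [extChartAt_to_inv]
  exact congrArg _ (funext h6)

/-- For a basis `w` this function never vanishes, so its sign is constant in time: the flow
preserves the orientation. -/
theorem continuous_vol (o : ManifoldOrientation n M) (x : M) (w : Fin n → Model n) :
    Continuous (fun r => o.vol (φ r x) (fun i => dMap n (φ r) x (w i))) := by
  rw [continuous_iff_continuousAt]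
  intro s
  have h := hφ.continuousAt_vol_zero o (φ s x) (fun i => dMap n (φ s) x (w i))
  have h' : ContinuousAt (fun r => o.vol (φ (r - s) (φ s x))
      (fun i => dMap n (φ (r - s)) (φ s x) (dMap n (φ s) x (w i)))) s :=
    ContinuousAt.comp (f := fun r : ℝ => r - s) (g := fun r => o.vol (φ r (φ s x))
      (fun i => dMap n (φ r) (φ s x) (dMap n (φ s) x (w i)))) (by simpa only [sub_self] using h)
      (by fun_prop)
  refine h'.congr (Eventually.of_forall fun r => ?_)
  have h1 : s + (r - s) = r := by ring
  have h2 := hφ.dMap_add s (r - s) x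
  have h3 := hφ.add s (r - s) x
  rw [h1] at h2 h3
  simp only [h2, h3]
  rfl

theorem contDiffAt_tensorInChart {ξ : M → Tensor n p q} (hξ : SmoothTensorField ξ) (s : ℝ) {x₀ : M}
    {y : Model n} (hy : y ∈ (extChartAt 𝓘(ℝ, Model n) x₀).target) :
    ContDiffAt ℝ ∞ (fun w : ℝ × Model n => tensorInChart (pullbackField (φ w.1) ξ) x₀ w.2)
      (s, y) := by
  have h : ChartPair (φ s) x₀ (φ s ((extChartAt 𝓘(ℝ, Model n) x₀).symm y)) y :=
    ⟨hy, mem_extChartAt_source _⟩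
  refine (hφ.contDiffAt_pullback_chartRep hξ h).congr_of_eventuallyEq ?_
  filter_upwards [hφ.eventually_chartPair h] with w hw
  exact hw.tensorInChart_pullbackField (hφ.contMDiff _) (hφ.isInvertible_dMap _ _) ξ

theorem smoothTensorField_pullbackField {ξ : M → Tensor n p q} (hξ : SmoothTensorField ξ) (s : ℝ) :
    SmoothTensorField (pullbackField (φ s) ξ) := fun _ _ hy =>
  (contDiffAt_comp (W := Tensor n p q) rfl (hφ.contDiffAt_tensorInChart hξ s hy)
    (contDiffAt_const.prodMk contDiffAt_id)).contDiffWithinAt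

end IsGlobalFlow

end Scaling

end HarmonicSoliton

end

noncomputable section

open scoped Manifold ContDiff Topology
set_option linter.unusedSectionVars false

namespace HarmonicSoliton

/-! ### The self-similar solution generated by a soliton -/

section SolitonFlow

open Filter

variable {n p q : ℕ} {M : Type*} [TopologicalSpace M] [ChartedSpace (Model n) M]
  [IsManifold 𝓘(ℝ, Model n) ∞ M] {X : (x : M) → TangentSpace 𝓘(ℝ, Model n) x} {φ : ℝ → M → M}
  {g : RiemMetric n M} {o : ManifoldOrientation n M} {ξ₀ : Tensor n p q} {ξ : M → Tensor n p q}
  {c t₀ t : ℝ}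

theorem hasDerivAt_smul_comp {V : Type*} [NormedAddCommGroup V] [NormedSpace ℝ V] {a τ : ℝ → ℝ}
    {k : ℝ → V} {a' τ' : ℝ} {k' : V} (ha : HasDerivAt a a' t) (hτ : HasDerivAt τ τ' t)
    (hk : HasDerivAt k k' (τ t)) :
    HasDerivAt (fun s => a s • k (τ s)) (a t • τ' • k' + a' • k (τ t)) t :=
  ha.smul (hk.scomp t hτ)

/-- The family `ρ(t)^ℓ f_t^* ξ`, where `f_t` is the flow at time `τ(t)`. -/
def solitonFamily (φ : ℝ → M → M) (ξ : M → Tensor n p q) (c t₀ t : ℝ) (x : M) : Tensor n p q :=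
  solitonScale c t₀ t ^ ((q : ℤ) - (p : ℤ)) • pullbackField (φ (solitonTime c t₀ t)) ξ x

/-- The left side is `L_X ξ`. This is the only use of the soliton equation in the evolution: `T(X) +
∇_𝔪 X` is replaced by `Div T`, and the trace part of `∇X` leaves a multiple of `ξ`. -/
theorem covDeriv_add_diamond_nabla (h : IsHarmonicHSoliton ξ₀ g o ξ X c) (x : M) :
    covDeriv g ξ x (X x) + diamond (nabla g X x) (ξ x) =
      diamond (divergence g (torsion g ξ) x) (ξ x) +
        (c / 2 * ((q : ℝ) - (p : ℝ))) • ξ x := by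
  have hs := h.isHStructure.isAdaptedField
  obtain ⟨e, he⟩ := hs.exists_isOrthFrame x
  have h1 := (hs.torsion_spec x (X x)).2
  have h2 := diamond_mProj he (ξ x) (isSkew_nabla_sub (h.lie x))
  have h3 : diamond (divergence g (torsion g ξ) x) (ξ x) =
      diamond (torsion g ξ x (X x)) (ξ x) + diamond (nablaM g ξ X x) (ξ x) := by
    rw [h.equation x]
    exact diamond_add_left _ _ _
  refine (congrArg₂ (· + ·) h1 h2).trans ?_
  rw [h3]
  exact (add_assoc (diamond (torsion g ξ x (X x)) (ξ x)) (diamond (nablaM g ξ X x) (ξ x)) _).symm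

namespace IsGlobalFlow

variable (hφ : IsGlobalFlow X φ)
include hφ

theorem smoothTensorFamilyOn_solitonFamily (hξ : SmoothTensorField ξ) :
    SmoothTensorFamilyOn (solitonInterval c t₀) (solitonFamily φ ξ c t₀) := by
  rintro x₀ ⟨t, y⟩ ⟨ht, hy⟩
  have hI := (isOpen_solitonInterval c t₀).mem_nhds ht
  have h1 : ContDiffAt ℝ ∞ (fun z : ℝ × Model n => solitonScale c t₀ z.1) (t, y) :=
    contDiffAt_comp (y := t) rfl ((contDiffOn_solitonScale c t₀).contDiffAt hI) contDiffAt_fst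
  have h2 : ContDiffAt ℝ ∞ (fun z : ℝ × Model n => solitonTime c t₀ z.1) (t, y) :=
    contDiffAt_comp (y := t) rfl ((contDiffOn_solitonTime c t₀).contDiffAt hI) contDiffAt_fst
  have h3 : ContDiffAt ℝ ∞ (fun z : ℝ × Model n =>
      tensorInChart (pullbackField (φ (solitonTime c t₀ z.1)) ξ) x₀ z.2) (t, y) :=
    contDiffAt_comp (W := Tensor n p q) (y := (solitonTime c t₀ t, y))
      (η := fun w : ℝ × Model n => tensorInChart (pullbackField (φ w.1) ξ) x₀ w.2)
      (γ := fun z : ℝ × Model n => (solitonTime c t₀ z.1, z.2)) rfl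
      (hφ.contDiffAt_tensorInChart hξ _ hy) (h2.prodMk contDiffAt_snd)
  have h4 := (contDiffAt_zpow h1 (solitonScale_pos ht).ne' ((q : ℤ) - (p : ℤ))).smul h3
  have h5 : ∀ z : ℝ × Model n, tensorInChart (solitonFamily φ ξ c t₀ z.1) x₀ z.2 =
      solitonScale c t₀ z.1 ^ ((q : ℤ) - (p : ℤ)) •
        tensorInChart (pullbackField (φ (solitonTime c t₀ z.1)) ξ) x₀ z.2 := fun z =>
    tensorInChart_smul _ _ _ _
  simp only [h5]
  exact h4.contDiffWithinAt

theorem isHomothety_solitonTime (hg : ∀ x u v, lieDerivMetric g X x u v = c * g.at x u v)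
    (ht : t ∈ solitonInterval c t₀) :
    IsHomothety g (solitonRate c t₀ t) (φ (solitonTime c t₀ t)) := by
  rw [← exp_solitonTime ht]
  exact hφ.isHomothety hg _

theorem isHStructure_solitonFamily (h : IsHStructure ξ₀ g o ξ)
    (hg : ∀ x u v, lieDerivMetric g X x u v = c * g.at x u v) (ht : t ∈ solitonInterval c t₀) :
    IsHStructure ξ₀ g o (solitonFamily φ ξ c t₀ t) where
  smooth x₀ y hy :=
    (contDiffAt_comp (W := Tensor n p q) (y := (t, y))
      (η := fun z : ℝ × Model n => tensorInChart (solitonFamily φ ξ c t₀ z.1) x₀ z.2)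
      (γ := fun y : Model n => (t, y)) rfl
      ((hφ.smoothTensorFamilyOn_solitonFamily h.smooth x₀).contDiffAt
        (prod_mem_nhds ((isOpen_solitonInterval c t₀).mem_nhds ht) (target_mem_nhds hy)))
      (contDiffAt_const.prodMk contDiffAt_id)).contDiffWithinAt
  frame x := by
    set s := solitonTime c t₀ t with hs
    have hf := hφ.isHomothety_solitonTime hg ht
    obtain ⟨e, he1, he2, he3⟩ := h.frame (φ s x)
    obtain ⟨D, hD⟩ := hφ.isInvertible_dMap s x
    have hρ := solitonScale_pos ht
    set ρ := solitonScale c t₀ t with hρdef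
    -- `e' = ρ⁻¹ (df_t)⁻¹ e`. It is orthonormal because `f_t^* g = α g` and `ρ² α = 1`. Pulling back
    -- by the scalar `ρ⁻¹` multiplies by `ρ^{-ℓ}`, which removes the factor `ρ^ℓ` of the family.
    let e' : Model n ≃L[ℝ] Model n :=
      (e.trans D.symm).trans (ContinuousLinearEquiv.smulLeft (Units.mk0 ρ⁻¹ (inv_ne_zero hρ.ne')))
    have hDe : ∀ u, dMap n (φ s) x (e' u) = ρ⁻¹ • e u := fun u => by
      rw [← hD]
      change D (ρ⁻¹ • D.symm (e u)) = _
      rw [map_smul, D.apply_symm_apply]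
    refine ⟨e', fun u v => ?_, ?_, ?_⟩
    · have h1 := hf.metric x (e' u) (e' v)
      rw [← hs, hDe, hDe, map_smul, map_smul, smul_apply, he1, smul_eq_mul, smul_eq_mul] at h1
      have h2 := solitonScale_sq_mul_solitonRate ht
      rw [← hρdef] at h2
      have h3 : ρ * ρ⁻¹ = 1 := mul_inv_cancel₀ hρ.ne'
      have h4 : g.at x (e' u) (e' v) = (ρ ^ 2 * solitonRate c t₀ t) * g.at x (e' u) (e' v) := by
        rw [h2, one_mul]
      rw [h4, mul_assoc, ← h1]
      linear_combination (ρ * ρ⁻¹ + 1) * inner ℝ u v * h3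
    -- At time `τ(t)` the flow maps `e'` to a positive multiple of the oriented frame `e`, so the
    -- volume is positive there. Constancy of its sign brings this back to time zero.
    · have hk := hφ.continuous_vol o x (fun i => e' (EuclideanSpace.single i 1))
      have h0 : ∀ r, o.vol (φ r x) (fun i => dMap n (φ r) x (e' (EuclideanSpace.single i 1))) ≠ 0 :=
        fun r => alternating_ne_zero (o.ne_zero _) (L := (dMap n (φ r) x).comp (e' : EndT n))
          ((hφ.isInvertible_dMap r x).comp ContinuousLinearMap.isInvertible_equiv)
      have hpos : 0 < o.vol (φ s x)
          (fun i => dMap n (φ s) x (e' (EuclideanSpace.single i 1))) := by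
        simp only [hDe]
        rw [ContinuousAlternatingMap.map_smul_univ]
        exact smul_pos (Finset.prod_pos fun _ _ => inv_pos.2 hρ) he2
      have h1 := pos_of_continuous_of_ne_zero hk h0 (b := 0) hpos
      simpa only [hφ.zero, hφ.dMap_zero, ContinuousLinearMap.id_apply] using h1
    · have h1 : (dMap n (φ s) x).comp (e' : EndT n) =
          (e : EndT n).comp (ρ⁻¹ • ContinuousLinearMap.id ℝ (Model n)) := by
        ext1 u
        simp only [ContinuousLinearMap.comp_apply, smul_apply, ContinuousLinearMap.id_apply,
          map_smul]
        exact hDe u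
      rw [solitonFamily, pullback_smul, pullbackField_eq, ← hs,
        ← pullback_comp (hφ.isInvertible_dMap s x), h1,
        pullback_comp ContinuousLinearMap.isInvertible_equiv, he3,
        pullback_smul_id (inv_ne_zero hρ.ne'), inv_zpow, ← hρdef]
      exact smul_inv_smul₀ (zpow_ne_zero _ hρ.ne') ξ₀

theorem divergence_solitonFamily (h : IsHarmonicHSoliton ξ₀ g o ξ X c)
    (ht : t ∈ solitonInterval c t₀) (x : M) :
    divergence g (torsion g (solitonFamily φ ξ c t₀ t)) x = solitonRate c t₀ t •
      conjEnd (dMap n (φ (solitonTime c t₀ t)) x)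
        (divergence g (torsion g ξ) (φ (solitonTime c t₀ t) x)) := by
  have hs := h.isHStructure.isAdaptedField
  have hs' := (hφ.isHStructure_solitonFamily h.isHStructure h.lie ht).isAdaptedField
  have hf := hφ.isHomothety_solitonTime h.lie ht
  exact divergence_pullback hf hs.differentiableAt_torsion hs'.differentiableAt_torsion
    (torsion_pullback hf hs hs' (zpow_ne_zero _ (solitonScale_pos ht).ne') (fun _ => rfl)
      (hφ.smoothTensorField_pullbackField hs.smooth _)) x

theorem solitonEquation_solitonFamily (h : IsHarmonicHSoliton ξ₀ g o ξ X c)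
    (ht : t ∈ solitonInterval c t₀) :
    SolitonEquation g (solitonFamily φ ξ c t₀ t) (fun x => solitonRate c t₀ t • X x) := by
  intro x
  have hs := h.isHStructure.isAdaptedField
  have hs' := (hφ.isHStructure_solitonFamily h.isHStructure h.lie ht).isAdaptedField
  have hf := hφ.isHomothety_solitonTime h.lie ht
  obtain ⟨e, he⟩ := hs'.exists_isOrthFrame x
  set f := φ (solitonTime c t₀ t) with hfdef
  have hfX : ∀ x, dMap n f x (X x) = X (f x) := hφ.dMap_apply _
  have hT := torsion_pullback hf hs hs' (zpow_ne_zero _ (solitonScale_pos ht).ne')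
    (fun _ => rfl) (hφ.smoothTensorField_pullbackField hs.smooth _) x (X x)
  have hN := nablaM_pullback hf hs hs' (zpow_ne_zero _ (solitonScale_pos ht).ne')
    (fun _ => rfl) h.smooth hfX x
  have hN' : nablaM g (solitonFamily φ ξ c t₀ t) (fun x => solitonRate c t₀ t • X x) x =
      solitonRate c t₀ t • nablaM g (solitonFamily φ ξ c t₀ t) X x := by
    rw [nablaM, nabla_smul h.smooth]
    exact mProj_smul he _ _ _
  have hT' : torsion g (solitonFamily φ ξ c t₀ t) x (solitonRate c t₀ t • X x) =
      solitonRate c t₀ t • torsion g (solitonFamily φ ξ c t₀ t) x (X x) :=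
    (torsion g (solitonFamily φ ξ c t₀ t) x).map_smul _ _
  rw [hφ.divergence_solitonFamily h ht, hN', hN, ← hfdef, h.equation (f x), conjEnd_add, smul_add]
  refine congrArg (· + _) (Eq.symm (hT'.trans ?_))
  rw [hT, hfX]

/-- The product rule gives `ρ^ℓ α f_t^* (L_X ξ)` plus the derivative of `ρ^ℓ`, which is `-(cℓ/2) α
ρ^ℓ`. The latter cancels the scalar term of `L_X ξ`, and what remains is `α f_t^* (Div T)` acting on
`ξ_t`, that is `Div T_t ⋄ ξ_t`. -/
theorem hasDerivAt_solitonFamily (h : IsHarmonicHSoliton ξ₀ g o ξ X c)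
    (ht : t ∈ solitonInterval c t₀) (x : M) :
    HasDerivAt (fun s => solitonFamily φ ξ c t₀ s x)
      (diamond (divergence g (torsion g (solitonFamily φ ξ c t₀ t)) x)
        (solitonFamily φ ξ c t₀ t x)) t := by
  set f := φ (solitonTime c t₀ t) with hf
  set L := dMap n f x with hL
  have hLi : L.IsInvertible := hφ.isInvertible_dMap _ x
  have h1 := hφ.hasDerivAt_pullbackField g h.isHStructure.smooth (solitonTime c t₀ t) x
  rw [covDeriv_add_diamond_nabla h] at h1
  have h2 := hasDerivAt_smul_comp (V := Tensor n p q)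
    (hasDerivAt_solitonScale_zpow ht ((q : ℤ) - (p : ℤ))) (hasDerivAt_solitonTime ht) h1
  refine hasDerivAt_congr (V := Tensor n p q) h2 (Eventually.of_forall fun _ => rfl) ?_
  rw [hφ.divergence_solitonFamily h ht, ← hf, ← hL, pullback_add, pullback_smul,
    pullback_diamond hLi (comp_conjEnd hLi _), diamond_smul_left, solitonFamily,
    diamond_smul_right, pullbackField_eq, ← hf, ← hL]
  push_cast
  module

theorem isHarmonicHFlow_solitonFamily (h : IsHarmonicHSoliton ξ₀ g o ξ X c) :
    IsHarmonicHFlow ξ₀ g o (solitonInterval c t₀) (solitonFamily φ ξ c t₀) where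
  isHStructure _ ht := hφ.isHStructure_solitonFamily h.isHStructure h.lie ht
  smooth := hφ.smoothTensorFamilyOn_solitonFamily h.isHStructure.smooth
  equation _ ht x := hφ.hasDerivAt_solitonFamily h ht x

end IsGlobalFlow

/-- A harmonic `H`-soliton with complete vector field generates a self-similar solution of the
harmonic flow. -/
theorem exists_selfSimilar_solution [T2Space M] (h : IsHarmonicHSoliton ξ₀ g o ξ X c)
    (hX : CompactSpace M ∨ IsCompleteVectorField X) (t₀ : ℝ) :
    ∃ f : ℝ → (M ≃ₘ^∞⟮𝓘(ℝ, Model n), 𝓘(ℝ, Model n)⟯ M),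
      IsFlowOfScaledField X (solitonRate c t₀) (solitonInterval c t₀) t₀ (fun t => f t) ∧
      (∀ f' : ℝ → M → M,
        IsFlowOfScaledField X (solitonRate c t₀) (solitonInterval c t₀) t₀ f' →
        ∀ t ∈ solitonInterval c t₀, f' t = f t) ∧
      ContMDiffOn (𝓘(ℝ, ℝ).prod 𝓘(ℝ, Model n)) 𝓘(ℝ, Model n) ∞
        (fun z : ℝ × M => f z.1 z.2) (solitonInterval c t₀ ×ˢ Set.univ) ∧
      IsSelfSimilarHSolution ξ₀ g o (solitonInterval c t₀) t₀
        (fun t x => solitonScale c t₀ t ^ ((q : ℤ) - (p : ℤ)) • pullbackField (f t) ξ x) ∧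
      ∀ t ∈ solitonInterval c t₀, SolitonEquation g
        (fun x => solitonScale c t₀ t ^ ((q : ℤ) - (p : ℤ)) • pullbackField (f t) ξ x)
        (fun x => solitonRate c t₀ t • X x) := by
  have hcomplete : IsCompleteVectorField X := hX.elim
    (fun _ => h.smooth.isComplete_of_compactSpace) id
  obtain ⟨φ, hφ⟩ := exists_isGlobalFlow h.smooth hcomplete
  exact ⟨fun t => hφ.toDiffeo (solitonTime c t₀ t), hφ.isFlowOfScaledField c t₀,
    fun f' hf' t ht => hφ.eq_of_isFlowOfScaledField h.smooth hf' ht, hφ.contMDiffOn_rescaled c t₀,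
    ⟨hφ.isHarmonicHFlow_solitonFamily h, self_mem_solitonInterval c t₀, solitonScale c t₀, ξ,
      fun t => hφ.toDiffeo (solitonTime c t₀ t), solitonScale_self c t₀,
      fun t ht => solitonScale_pos ht, h.isHStructure, fun t _ => rfl⟩,
    fun t ht => hφ.solitonEquation_solitonFamily h ht⟩

end SolitonFlow

end HarmonicSoliton

end

theorem theoremB (c t₀ : ℝ) (hc : c = -1 ∨ c = 0 ∨ c = 1) :
    -- the explicit scaling, rate and interval
    (solitonScale c t₀ t₀ = 1 ∧ solitonRate c t₀ t₀ = 1 ∧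
      IsOpen (solitonInterval c t₀) ∧ (solitonInterval c t₀).OrdConnected ∧
      t₀ ∈ solitonInterval c t₀ ∧
      (0 ≤ c → Set.Iic t₀ ⊆ solitonInterval c t₀) ∧
      (c ≤ 0 → Set.Ici t₀ ⊆ solitonInterval c t₀) ∧
      (∀ t ∈ solitonInterval c t₀, 0 < solitonScale c t₀ t) ∧
      ContDiffOn ℝ ∞ (solitonScale c t₀) (solitonInterval c t₀) ∧
      ContDiffOn ℝ ∞ (solitonRate c t₀) (solitonInterval c t₀) ∧
      (∀ t ∈ solitonInterval c t₀,
        c * solitonRate c t₀ t = -2 * deriv (fun s => Real.log (solitonScale c t₀ s)) t) ∧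
      (∀ δ : ℝ, 0 < δ → ∃ r : ℝ → ℝ, ContDiff ℝ ∞ r ∧ (∀ t, 0 < r t) ∧
        ∀ t, δ ≤ 1 - c * (t - t₀) → r t = solitonScale c t₀ t)) ∧
    -- `Spin(7)`-structures
    (∀ (M : Type u) [TopologicalSpace M] [T2Space M] [ChartedSpace (Model 8) M]
      [IsManifold 𝓘(ℝ, Model 8) ∞ M]
      (g : RiemMetric 8 M) (o : ManifoldOrientation 8 M) (Φ : M → Tensor 8 0 4)
      (X : (x : M) → TangentSpace 𝓘(ℝ, Model 8) x),
      IsHarmonicSpin7Soliton g o Φ X c →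
      (CompactSpace M ∨ IsCompleteVectorField X) →
      ∃ f : ℝ → (M ≃ₘ^∞⟮𝓘(ℝ, Model 8), 𝓘(ℝ, Model 8)⟯ M),
        IsFlowOfScaledField X (solitonRate c t₀) (solitonInterval c t₀) t₀ (fun t => f t) ∧
        (∀ f' : ℝ → M → M,
          IsFlowOfScaledField X (solitonRate c t₀) (solitonInterval c t₀) t₀ f' →
          ∀ t ∈ solitonInterval c t₀, f' t = f t) ∧
        ContMDiffOn (𝓘(ℝ, ℝ).prod 𝓘(ℝ, Model 8)) 𝓘(ℝ, Model 8) ∞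
          (fun z : ℝ × M => f z.1 z.2) (solitonInterval c t₀ ×ˢ Set.univ) ∧
        IsSelfSimilarSpin7Solution g o (solitonInterval c t₀) t₀
          (fun t x => solitonScale c t₀ t ^ 4 • pullbackField (f t) Φ x) ∧
        ∀ t ∈ solitonInterval c t₀, Spin7SolitonEquation g
          (fun x => solitonScale c t₀ t ^ 4 • pullbackField (f t) Φ x)
          (fun x => solitonRate c t₀ t • X x)) ∧
    -- general `H`-structures, `H` the stabiliser in `SO(n)` of a model tensor `ξ₀`
    (∀ (n p q : ℕ) (ξ₀ : Tensor n p q)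
      (M : Type u) [TopologicalSpace M] [T2Space M] [ChartedSpace (Model n) M]
      [IsManifold 𝓘(ℝ, Model n) ∞ M]
      (g : RiemMetric n M) (o : ManifoldOrientation n M) (ξ : M → Tensor n p q)
      (X : (x : M) → TangentSpace 𝓘(ℝ, Model n) x),
      IsHarmonicHSoliton ξ₀ g o ξ X c →
      (CompactSpace M ∨ IsCompleteVectorField X) →
      ∃ f : ℝ → (M ≃ₘ^∞⟮𝓘(ℝ, Model n), 𝓘(ℝ, Model n)⟯ M),
        IsFlowOfScaledField X (solitonRate c t₀) (solitonInterval c t₀) t₀ (fun t => f t) ∧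
        (∀ f' : ℝ → M → M,
          IsFlowOfScaledField X (solitonRate c t₀) (solitonInterval c t₀) t₀ f' →
          ∀ t ∈ solitonInterval c t₀, f' t = f t) ∧
        ContMDiffOn (𝓘(ℝ, ℝ).prod 𝓘(ℝ, Model n)) 𝓘(ℝ, Model n) ∞
          (fun z : ℝ × M => f z.1 z.2) (solitonInterval c t₀ ×ˢ Set.univ) ∧
        IsSelfSimilarHSolution ξ₀ g o (solitonInterval c t₀) t₀
          (fun t x => solitonScale c t₀ t ^ ((q : ℤ) - (p : ℤ)) • pullbackField (f t) ξ x) ∧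
        ∀ t ∈ solitonInterval c t₀, SolitonEquation g
          (fun x => solitonScale c t₀ t ^ ((q : ℤ) - (p : ℤ)) • pullbackField (f t) ξ x)
          (fun x => solitonRate c t₀ t • X x)) := by
  refine ⟨⟨solitonScale_self c t₀, solitonRate_self c t₀, isOpen_solitonInterval c t₀,
    ordConnected_solitonInterval c t₀, self_mem_solitonInterval c t₀, fun h t ht => ?_,
    fun h t ht => ?_, fun t ht => solitonScale_pos ht, contDiffOn_solitonScale c t₀,
    contDiffOn_solitonRate c t₀, fun t ht => solitonRate_eq_logDeriv ht,
    fun δ hδ => exists_pos_smooth_extension_solitonScale c t₀ hδ⟩, ?_, ?_⟩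
  · have h1 : t ≤ t₀ := ht
    have h2 : c * (t - t₀) ≤ 0 := mul_nonpos_of_nonneg_of_nonpos h (sub_nonpos.2 h1)
    rw [mem_solitonInterval]
    linarith
  · have h1 : t₀ ≤ t := ht
    have h2 : c * (t - t₀) ≤ 0 := mul_nonpos_of_nonpos_of_nonneg h (sub_nonneg.2 h1)
    rw [mem_solitonInterval]
    linarith
  · intro M _ _ _ _ g o Φ X hΦ hX
    have h : IsHarmonicHSoliton cayleyForm g o Φ X c :=
      ⟨hΦ.isSpin7Structure, hΦ.smooth, hΦ.lie, hΦ.equation⟩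
    obtain ⟨f, h1, h2, h3, ⟨hflow, ht₀, ρ, Ψ, f', hρ, hρ', hΨ, hΨf⟩, h5⟩ :=
      exists_selfSimilar_solution h hX t₀
    -- For type `(0, 4)` the integer exponent `q - p` is the natural number `4`; apart from this the
    -- `Spin(7)` notions are those for the model tensor `cayleyForm`.
    have hpow : ∀ r : ℝ, r ^ (((4 : ℕ) : ℤ) - ((0 : ℕ) : ℤ)) = r ^ 4 := fun r => zpow_natCast r 4
    simp only [hpow] at hflow hΨf h5
    exact ⟨f, h1, h2, h3, ⟨⟨hflow.isHStructure, hflow.smooth, hflow.equation⟩, ht₀, ρ, Ψ, f',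
      hρ, hρ', hΨ, hΨf⟩, h5⟩
  · intro n p q ξ₀ M _ _ _ _ g o ξ X h hX
    exact exists_selfSimilar_solution h hX t₀
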